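/- Let $p$ be an odd prime, let $k$ be an algebraically closed field of characteristic $p$, and let $X$ be the smooth projective curve over $k$ with affine equation $y^2 = x^p - x$, that is, the curve $y^2 = x^p z - x z^p$ in the weighted projective plane $\mathbb{P}(1,1,(p+1)/2)$ with coordinates $x, z, y$. Let $G = \operatorname{Aut}_k(X)$ be the group of automorphisms of $X$ over $k$, acting on $H^0(X, \Omega^1_{X/k})$, $H^1(X, \mathcal{O}_X)$ and $H^1(X, \Omega^1_{X/k})$ from the left, $\sigma \in G$ acting as pullback along $\sigma^{-1}$. Then: 1. The canonical representation $H^0(X, \Omega^1_{X/k})$ has dimension $g = (p-1)/2$ over $k$ and is an irreducible $k[G]$-module. 2. $H^1(X, \mathcal{O}_X)$ is the contragredient of $H^0(X, \Omega^1_{X/k})$ via $G$-equivariant Serre duality. Explicitly, $H^1(X, \Omega^1_{X/k})$ is one-dimensional over $k$ with trivial $G$-action, and for every $k$-linear isomorphism $t : H^1(X, \Omega^1_{X/k}) \to k$ (a trace map, unique up to a scalar) the pairing $$H^0(X, \Omega^1_{X/k}) \times H^1(X, \mathcal{O}_X) \to k, \qquad (\omega, c) \mapsto t(\omega \cup c),$$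 induces an isomorphism of $k[G]$-modules $H^1(X, \mathcal{O}_X) \to H^0(X, \Omega^1_{X/k})^*$, $c \mapsto (\omega \mapsto t(\omega \cup c))$, onto the dual representation. 3. $H^1(X, \mathcal{O}_X)$ is an irreducible $k[G]$-module. -/

import Mathlib

open CategoryTheory TopologicalSpace Opposite AlgebraicGeometry
open scoped KaehlerDifferential

universe u

noncomputable section

/-! ## First Čech cohomology of a presheaf of modules on a topological space

`Ȟ¹(T, F)` is the colimit over all open covers of `T` of the first Čech cohomology of the cover.
The covers indexed by the points of `T`, with `x` lying in the `x`-th member, are cofinal among all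
open covers and are directed under memberwise inclusion, so the colimit is taken over them. For a
sheaf `F` on any topological space this is the sheaf cohomology `H¹(T, F)`. -/

namespace CechCohomology

/-- A presheaf of `k`-modules on a topological space. -/
structure ModPresheaf (k : Type u) [CommRing k] (T : Type u) [TopologicalSpace T] where
  obj : Opens T → Type u
  [addCommGroup : ∀ U, AddCommGroup (obj U)]
  [module : ∀ U, Module k (obj U)]
  res {U V : Opens T} (h : U ≤ V) : obj V →ₗ[k] obj U
  res_self : ∀ {U : Opens T} (s : obj U), res le_rfl s = s
  res_res : ∀ {U V W : Opens T} (h : U ≤ V) (h' : V ≤ W) (s : obj W),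
    res h (res h' s) = res (h.trans h') s

attribute [instance] ModPresheaf.addCommGroup ModPresheaf.module

/-- An open cover of `T` indexed by the points of `T`. -/
structure PointCover (T : Type u) [TopologicalSpace T] where
  nhd : T → Opens T
  mem : ∀ x, x ∈ nhd x

namespace PointCover

variable {S T : Type u} [TopologicalSpace S] [TopologicalSpace T]

/-- `U ≤ V` when `V` refines `U` memberwise. -/
instance : Preorder (PointCover T) where
  le U V := ∀ x, V.nhd x ≤ U.nhd x
  le_refl _ _ := le_rfl
  le_trans _ _ _ h h' x := (h' x).trans (h x)

instance : Nonempty (PointCover T) := ⟨⟨fun _ => ⊤, fun _ => trivial⟩⟩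

instance : IsDirectedOrder (PointCover T) where
  directed U V := ⟨⟨fun x => U.nhd x ⊓ V.nhd x, fun x => ⟨U.mem x, V.mem x⟩⟩,
    fun _ => inf_le_left, fun _ => inf_le_right⟩

/-- The pullback of a cover along a continuous map. -/
def pullback (φ : C(S, T)) (U : PointCover T) : PointCover S :=
  ⟨fun s => (U.nhd (φ s)).comap φ, fun s => U.mem (φ s)⟩

/-- The cover `V` of `S` refines the pullback of the cover `U` of `T`, along `φ : S → T`. -/
abbrev Refines (φ : C(S, T)) (U : PointCover T) (V : PointCover S) : Prop :=
  ∀ s, ∀ z ∈ V.nhd s, φ z ∈ U.nhd (φ s)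

theorem Refines.pair {φ : C(S, T)} {U : PointCover T} {V : PointCover S} (h : Refines φ U V)
    (s t : S) : ∀ z ∈ V.nhd s ⊓ V.nhd t, φ z ∈ U.nhd (φ s) ⊓ U.nhd (φ t) :=
  fun z hz => ⟨h s z hz.1, h t z hz.2⟩

theorem Refines.triple {φ : C(S, T)} {U : PointCover T} {V : PointCover S} (h : Refines φ U V)
    (s t r : S) : ∀ z ∈ V.nhd s ⊓ V.nhd t ⊓ V.nhd r,
      φ z ∈ U.nhd (φ s) ⊓ U.nhd (φ t) ⊓ U.nhd (φ r) :=
  fun z hz => ⟨⟨h s z hz.1.1, h t z hz.1.2⟩, h r z hz.2⟩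

theorem refines_pullback (φ : C(S, T)) (U : PointCover T) : Refines φ U (U.pullback φ) :=
  fun _ _ hz => hz

theorem pullback_mono (φ : C(S, T)) {U V : PointCover T} (h : U ≤ V) :
    U.pullback φ ≤ V.pullback φ :=
  fun s _ hx => h (φ s) hx

theorem le_left (U : PointCover T) (x y : T) : U.nhd x ⊓ U.nhd y ≤ U.nhd x :=
  fun _ h => h.1

theorem le_right (U : PointCover T) (x y : T) : U.nhd x ⊓ U.nhd y ≤ U.nhd y :=
  fun _ h => h.2

theorem le_fst_snd (U : PointCover T) (x y z : T) :
    U.nhd x ⊓ U.nhd y ⊓ U.nhd z ≤ U.nhd x ⊓ U.nhd y :=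
  fun _ h => h.1

theorem le_fst_thd (U : PointCover T) (x y z : T) :
    U.nhd x ⊓ U.nhd y ⊓ U.nhd z ≤ U.nhd x ⊓ U.nhd z :=
  fun _ h => ⟨h.1.1, h.2⟩

theorem le_snd_thd (U : PointCover T) (x y z : T) :
    U.nhd x ⊓ U.nhd y ⊓ U.nhd z ≤ U.nhd y ⊓ U.nhd z :=
  fun _ h => ⟨h.1.2, h.2⟩

theorem pair_le {U V : PointCover T} (h : U ≤ V) (x y : T) :
    V.nhd x ⊓ V.nhd y ≤ U.nhd x ⊓ U.nhd y :=
  inf_le_inf (h x) (h y)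

theorem refines_id {U V : PointCover T} (h : U ≤ V) : Refines (.id T) U V :=
  fun s _ hz => h s hz

end PointCover

variable {k : Type u} [CommRing k]

section Cochains

variable {T : Type u} [TopologicalSpace T] (F : ModPresheaf k T) (U : PointCover T)

/-- `1`-cochains: a section over `U_x ∩ U_y` for all `x`, `y`. -/
abbrev Cochain1 : Type u := ∀ x y : T, F.obj (U.nhd x ⊓ U.nhd y)

/-- The differential of `0`-cochains: `(b_x) ↦ (b_y - b_x)`. -/
def d0 : (∀ x : T, F.obj (U.nhd x)) →ₗ[k] Cochain1 F U where
  toFun b x y := F.res (U.le_right x y) (b y) - F.res (U.le_left x y) (b x)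
  map_add' b b' := by
    funext x y
    simp only [Pi.add_apply, map_add]
    abel
  map_smul' r b := by
    funext x y
    simp only [Pi.smul_apply, map_smul, RingHom.id_apply, smul_sub]

/-- `1`-cocycles: `c_yz - c_xz + c_xy = 0` over `U_x ∩ U_y ∩ U_z`. -/
def cocycles : Submodule k (Cochain1 F U) where
  carrier := {c | ∀ x y z : T,
    F.res (U.le_snd_thd x y z) (c y z) - F.res (U.le_fst_thd x y z) (c x z)
      + F.res (U.le_fst_snd x y z) (c x y) = 0}
  zero_mem' x y z := by simp
  add_mem' {c c'} h h' x y z := by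
    have := congrArg₂ (· + ·) (h x y z) (h' x y z)
    simp only [add_zero] at this
    rw [← this]
    simp only [Pi.add_apply, map_add]
    abel
  smul_mem' r c h x y z := by
    have := congrArg (r • ·) (h x y z)
    simp only [smul_zero, smul_add, smul_sub] at this
    rw [← this]
    simp only [Pi.smul_apply, map_smul]

/-- `1`-coboundaries, as a submodule of the `1`-cocycles. -/
def coboundaries : Submodule k (cocycles F U) :=
  (LinearMap.range (d0 F U)).comap (cocycles F U).subtype

/-- The first Čech cohomology of a cover. -/
abbrev CoverH1 : Type u := cocycles F U ⧸ coboundaries F U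

end Cochains

section Maps

variable {S T : Type u} [TopologicalSpace S] [TopologicalSpace T]

/-- A morphism of presheaves `F → φ_* G` over a continuous map `φ : S → T`, given by its components
`F(U) → G(V)` for all open `U ⊆ T` and `V ⊆ S` with `φ(V) ⊆ U`. -/
structure HomOver (φ : C(S, T)) (F : ModPresheaf k T) (G : ModPresheaf k S) where
  app (U : Opens T) (V : Opens S) (h : ∀ z ∈ V, φ z ∈ U) : F.obj U →ₗ[k] G.obj V
  app_res : ∀ {U U' : Opens T} {V : Opens S} (hU : U ≤ U') (h : ∀ z ∈ V, φ z ∈ U) (s : F.obj U'),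
    app U V h (F.res hU s) = app U' V (fun z hz => hU (h z hz)) s
  res_app : ∀ {U : Opens T} {V V' : Opens S} (hV : V ≤ V') (h : ∀ z ∈ V', φ z ∈ U) (s : F.obj U),
    G.res hV (app U V' h s) = app U V (fun z hz => h z (hV hz)) s

/-- The identity of `F`, over the identity map. -/
def HomOver.id (F : ModPresheaf k T) : HomOver (.id T) F F where
  app _ _ h := F.res h
  app_res _ _ _ := F.res_res _ _ _
  res_app _ _ _ := F.res_res _ _ _

variable {φ : C(S, T)} {F : ModPresheaf k T} {G : ModPresheaf k S} (α : HomOver φ F G)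
  {U : PointCover T} {V : PointCover S} (h : PointCover.Refines φ U V)

/-- The map on `1`-cochains induced by a morphism `F → φ_* G`, for a cover `U` of `T` and a cover
`V` of `S` that refines `φ⁻¹ U`: the cochain `c` goes to `(s, t) ↦ α(c (φ s) (φ t))`. -/
def cochainMap : Cochain1 F U →ₗ[k] Cochain1 G V where
  toFun c s t := α.app (U.nhd (φ s) ⊓ U.nhd (φ t)) (V.nhd s ⊓ V.nhd t)
    (PointCover.Refines.pair h s t) (c (φ s) (φ t))
  map_add' c c' := by
    funext s t
    simp only [Pi.add_apply, map_add]
  map_smul' r c := by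
    funext s t
    simp only [Pi.smul_apply, map_smul, RingHom.id_apply]

theorem cochainMap_mem (c : Cochain1 F U) (hc : c ∈ cocycles F U) :
    cochainMap α h c ∈ cocycles G V := by
  intro x y z
  have key := congrArg (α.app (U.nhd (φ x) ⊓ U.nhd (φ y) ⊓ U.nhd (φ z))
    (V.nhd x ⊓ V.nhd y ⊓ V.nhd z) (PointCover.Refines.triple h x y z)) (hc (φ x) (φ y) (φ z))
  simp only [map_add, map_sub, map_zero, α.app_res] at key
  simpa only [cochainMap, LinearMap.coe_mk, AddHom.coe_mk, α.res_app] using key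

theorem cochainMap_d0 (b : ∀ x : T, F.obj (U.nhd x)) :
    cochainMap α h (d0 F U b) =
      d0 G V (fun s => α.app (U.nhd (φ s)) (V.nhd s) (h s) (b (φ s))) := by
  funext x y
  simp only [cochainMap, d0, LinearMap.coe_mk, AddHom.coe_mk, map_sub, α.app_res, α.res_app]

/-- The induced map on the first Čech cohomology of covers. -/
def coverH1Map : CoverH1 F U →ₗ[k] CoverH1 G V :=
  Submodule.mapQ _ _ ((cochainMap α h).restrict (cochainMap_mem α h)) (by
    rintro ⟨_, _⟩ ⟨b, rfl⟩
    exact ⟨_, (cochainMap_d0 α h b).symm⟩)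

/-- Restriction of cohomology classes to a finer cover. -/
def refine (F : ModPresheaf k T) (U V : PointCover T) (h : U ≤ V) :
    CoverH1 F U →ₗ[k] CoverH1 F V :=
  coverH1Map (HomOver.id F) (PointCover.refines_id h)

open Classical in
/-- The first Čech cohomology of `T` with coefficients in `F`. -/
abbrev H1 (F : ModPresheaf k T) : Type u :=
  Module.DirectLimit (fun U : PointCover T => CoverH1 F U) (refine F)

open Classical in
instance (F : ModPresheaf k T) : AddCommGroup (H1 F) :=
  Module.addCommMonoidToAddCommGroup k

open Classical in
/-- The class in `Ȟ¹(T, F)` of a cocycle of a cover. -/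
def H1.mk (F : ModPresheaf k T) (U : PointCover T) : cocycles F U →ₗ[k] H1 F :=
  Module.DirectLimit.of k (PointCover T) (fun U : PointCover T => CoverH1 F U) (refine F) U ∘ₗ
    (coboundaries F U).mkQ

theorem H1.mk_refine {U V : PointCover T} (h : U ≤ V) (c : cocycles F U) :
    H1.mk F V ⟨cochainMap (HomOver.id F) (PointCover.refines_id h) c.1,
      cochainMap_mem _ _ c.1 c.2⟩ = H1.mk F U c := by
  classical
  exact Module.DirectLimit.of_f (G := fun U : PointCover T => CoverH1 F U) (f := refine F)
    (hij := h) (x := Submodule.Quotient.mk c)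

/-- Two cocycles that agree on a common refinement of their covers have the same class. -/
theorem H1.mk_eq_mk {U U' : PointCover T} (h : U ≤ U') (c : cocycles F U) (c' : cocycles F U')
    (hc : ∀ x y, c'.1 x y = F.res (PointCover.pair_le h x y) (c.1 x y)) :
    H1.mk F U' c' = H1.mk F U c := by
  rw [← H1.mk_refine h]
  congr 1
  ext x y
  exact hc x y

theorem H1.exists_mk (c : H1 F) : ∃ (U : PointCover T) (z : cocycles F U), H1.mk F U z = c := by
  classical
  obtain ⟨U, z, rfl⟩ := Module.DirectLimit.exists_of c
  obtain ⟨z, rfl⟩ := Submodule.Quotient.mk_surjective _ z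
  exact ⟨U, z, rfl⟩

open Classical in
/-- The map `Ȟ¹(T, F) → Ȟ¹(S, G)` induced by a morphism `F → φ_* G`. -/
def H1.map : H1 F →ₗ[k] H1 G :=
  Module.DirectLimit.lift k (PointCover T) (fun U : PointCover T => CoverH1 F U) (refine F)
    (fun U => Module.DirectLimit.of k (PointCover S) (fun V : PointCover S => CoverH1 G V)
      (refine G) (U.pullback φ) ∘ₗ coverH1Map α (U.refines_pullback φ))
    (by
      intro U V h x
      obtain ⟨c, rfl⟩ := Submodule.Quotient.mk_surjective _ x
      refine H1.mk_eq_mk (PointCover.pullback_mono φ h)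
        ⟨cochainMap α (U.refines_pullback φ) c.1, cochainMap_mem α _ c.1 c.2⟩
        ⟨cochainMap α (V.refines_pullback φ) (cochainMap (HomOver.id F)
          (PointCover.refines_id h) c.1), cochainMap_mem α _ _ (cochainMap_mem _ _ c.1 c.2)⟩ ?_
      intro s t
      exact (α.app_res (PointCover.pair_le h (φ s) (φ t)) _ (c.1 (φ s) (φ t))).trans
        (α.res_app (PointCover.pair_le (PointCover.pullback_mono φ h) s t)
          (fun _ hz => hz) (c.1 (φ s) (φ t))).symm)

theorem H1.map_mk (c : cocycles F U) :
    H1.map α (H1.mk F U c) = H1.mk G (U.pullback φ)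
      ⟨cochainMap α (U.refines_pullback φ) c.1, cochainMap_mem α _ c.1 c.2⟩ := by
  classical
  exact Module.DirectLimit.lift_of (G := fun U : PointCover T => CoverH1 F U) _ _ _

theorem H1.map_id {χ : C(T, T)} (hχ : χ = .id T) (α : HomOver χ F F)
    (hα : ∀ (U : Opens T) (h : ∀ z ∈ U, χ z ∈ U) (s : F.obj U), α.app U U h s = s) (c : H1 F) :
    H1.map α c = c := by
  subst hχ
  obtain ⟨U, z, rfl⟩ := H1.exists_mk c
  rw [H1.map_mk]
  refine congrArg (H1.mk F U) (Subtype.ext ?_)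
  funext x y
  exact hα _ _ _

theorem H1.map_comp {R : Type u} [TopologicalSpace R] {ψ : C(R, S)} {χ : C(R, T)}
    {H : ModPresheaf k R} (α : HomOver φ F G) (β : HomOver ψ G H) (γ : HomOver χ F H)
    (hχ : χ = φ.comp ψ)
    (hγ : ∀ (U : Opens T) (V : Opens S) (W : Opens R) (h : ∀ z ∈ V, φ z ∈ U)
      (h' : ∀ z ∈ W, ψ z ∈ V) (h'' : ∀ z ∈ W, χ z ∈ U) (s : F.obj U),
      γ.app U W h'' s = β.app V W h' (α.app U V h s)) (c : H1 F) :
    H1.map γ c = H1.map β (H1.map α c) := by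
  subst hχ
  obtain ⟨U, z, rfl⟩ := H1.exists_mk c
  rw [H1.map_mk, H1.map_mk, H1.map_mk]
  refine congrArg (H1.mk H _) (Subtype.ext ?_)
  funext x y
  exact hγ _ _ _ _ _ _ _

end Maps

end CechCohomology

/-! ## Differential forms -/

section Kaehler

variable {k A B C : Type u} [CommRing k] [CommRing A] [CommRing B] [CommRing C] [Algebra k A]
  [Algebra k B] [Algebra k C]

/-- The map `Ω[A⁄k] → Ω[B⁄k]`, `a da' ↦ f(a) d(f(a'))`, induced by a `k`-algebra map `f : A → B`. -/
def kaehlerMap (f : A →ₐ[k] B) : Ω[A⁄k] →ₗ[k] Ω[B⁄k] :=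
  letI := f.toRingHom.toAlgebra
  haveI : IsScalarTower k A B := .of_algHom f
  (KaehlerDifferential.map k k A B).restrictScalars k

theorem kaehlerMap_D (f : A →ₐ[k] B) (a : A) :
    kaehlerMap f (KaehlerDifferential.D k A a) = KaehlerDifferential.D k B (f a) :=
  letI := f.toRingHom.toAlgebra
  haveI : IsScalarTower k A B := .of_algHom f
  KaehlerDifferential.map_D k k A B a

theorem kaehlerMap_smul (f : A →ₐ[k] B) (a : A) (ω : Ω[A⁄k]) :
    kaehlerMap f (a • ω) = f a • kaehlerMap f ω :=
  letI := f.toRingHom.toAlgebra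
  haveI : IsScalarTower k A B := .of_algHom f
  ((KaehlerDifferential.map k k A B).map_smul a ω).trans
    (algebraMap_smul B a (KaehlerDifferential.map k k A B ω)).symm

theorem kaehler_induction {P : Ω[A⁄k] → Prop} (ω : Ω[A⁄k]) (zero : P 0)
    (add : ∀ x y, P x → P y → P (x + y)) (smul : ∀ (a : A) x, P x → P (a • x))
    (D : ∀ a, P (KaehlerDifferential.D k A a)) : P ω := by
  have h : ω ∈ Submodule.span A (Set.range (KaehlerDifferential.D k A)) := by
    rw [KaehlerDifferential.span_range_derivation]; trivial
  induction h using Submodule.span_induction with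
  | mem x hx => obtain ⟨a, rfl⟩ := hx; exact D a
  | zero => exact zero
  | add x y _ _ hx hy => exact add x y hx hy
  | smul a x _ hx => exact smul a x hx

theorem kaehlerMap_id (ω : Ω[A⁄k]) : kaehlerMap (AlgHom.id k A) ω = ω := by
  induction ω using kaehler_induction with
  | zero => simp
  | add x y hx hy => simp [hx, hy]
  | smul a x hx => rw [kaehlerMap_smul, hx]; rfl
  | D a => rw [kaehlerMap_D]; rfl

theorem kaehlerMap_comp (g : B →ₐ[k] C) (f : A →ₐ[k] B) (ω : Ω[A⁄k]) :
    kaehlerMap (g.comp f) ω = kaehlerMap g (kaehlerMap f ω) := by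
  induction ω using kaehler_induction with
  | zero => simp
  | add x y hx hy => simp [hx, hy]
  | smul a x hx => rw [kaehlerMap_smul, hx, kaehlerMap_smul, kaehlerMap_smul]; rfl
  | D a => rw [kaehlerMap_D, kaehlerMap_D, kaehlerMap_D]; rfl

end Kaehler

namespace KScheme

variable {k : Type u} [CommRing k] (X Y Z : Over (Spec (CommRingCat.of k)))

/-- The structure morphism of a `k`-scheme. -/
abbrev structMap : X.left ⟶ Spec (CommRingCat.of k) := X.hom

theorem le_preimage_top {W W' : Scheme.{u}} (f : W ⟶ W') (U : W.Opens) : U ≤ f ⁻¹ᵁ ⊤ :=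
  fun _ _ => trivial

/-- The ring homomorphism from `k` to the sections of the structure sheaf of a `k`-scheme. -/
def fromBase (U : X.left.Opens) : CommRingCat.of k ⟶ Γ(X.left, U) :=
  (Scheme.ΓSpecIso (CommRingCat.of k)).inv ≫
    (structMap X).appLE ⊤ U (le_preimage_top (structMap X) U)

/-- The sections of the structure sheaf of a `k`-scheme over an open subset, as a `k`-algebra. -/
instance sectionsAlgebra (U : X.left.Opens) : Algebra k Γ(X.left, U) :=
  (fromBase X U).hom.toAlgebra

/-- The local rings of a `k`-scheme, as `k`-algebras. -/
instance stalkAlgebra (x : X.left) : Algebra k (X.left.presheaf.stalk x) :=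
  (fromBase X ⊤ ≫ X.left.presheaf.germ ⊤ x trivial).hom.toAlgebra

variable {X Y Z}

theorem fromBase_appLE (f : X ⟶ Y) (U : Y.left.Opens) (V : X.left.Opens)
    (h : V ≤ f.left ⁻¹ᵁ U) : fromBase Y U ≫ f.left.appLE U V h = fromBase X V := by
  have hw : f.left ≫ structMap Y = structMap X := Over.w f
  simp only [fromBase, Category.assoc, Scheme.Hom.appLE_comp_appLE, hw]

theorem fromBase_germ (U : X.left.Opens) (x : X.left) (hx : x ∈ U) :
    fromBase X U ≫ X.left.presheaf.germ U x hx =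
      fromBase X ⊤ ≫ X.left.presheaf.germ ⊤ x trivial := by
  have h : fromBase X ⊤ ≫ X.left.presheaf.map (homOfLE (le_top : U ≤ ⊤)).op = fromBase X U := by
    simp only [fromBase, Category.assoc, Scheme.Hom.appLE_map]
  rw [← h, Category.assoc, TopCat.Presheaf.germ_res]

/-- Pullback of functions along a morphism `f : X → Y` of `k`-schemes, from `U ⊆ Y` to `V ⊆ X` with
`f(V) ⊆ U`. For `f = 𝟙 X` this is restriction. -/
def appLE (f : X ⟶ Y) (U : Y.left.Opens) (V : X.left.Opens) (h : V ≤ f.left ⁻¹ᵁ U) :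
    Γ(Y.left, U) →ₐ[k] Γ(X.left, V) where
  __ := (f.left.appLE U V h).hom
  commutes' r := ConcreteCategory.congr_hom (fromBase_appLE f U V h) r

/-- The germ at `x` of a function. -/
def germ (U : X.left.Opens) (x : X.left) (hx : x ∈ U) :
    Γ(X.left, U) →ₐ[k] X.left.presheaf.stalk x where
  __ := (X.left.presheaf.germ U x hx).hom
  commutes' r := ConcreteCategory.congr_hom (fromBase_germ U x hx) r

theorem mem_of_le {f : X ⟶ Y} {U : Y.left.Opens} {V : X.left.Opens} (h : V ≤ f.left ⁻¹ᵁ U)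
    {x : X.left} (hx : x ∈ V) : f.left x ∈ U :=
  h hx

theorem germ_appLE (f : X ⟶ Y) (U : Y.left.Opens) (V : X.left.Opens) (h : V ≤ f.left ⁻¹ᵁ U)
    (x : X.left) (hx : x ∈ V) :
    Y.left.presheaf.germ U (f.left x) (mem_of_le h hx) ≫ f.left.stalkMap x =
      f.left.appLE U V h ≫ X.left.presheaf.germ V x hx := by
  rw [Scheme.Hom.germ_stalkMap, Scheme.Hom.appLE, Category.assoc, TopCat.Presheaf.germ_res]

/-- The map on local rings induced by a morphism of `k`-schemes. -/
def stalkMap (f : X ⟶ Y) (x : X.left) :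
    Y.left.presheaf.stalk (f.left x) →ₐ[k] X.left.presheaf.stalk x where
  __ := (f.left.stalkMap x).hom
  commutes' r := by
    have h : (fromBase Y ⊤ ≫ Y.left.presheaf.germ ⊤ (f.left x) trivial) ≫ f.left.stalkMap x =
        fromBase X ⊤ ≫ X.left.presheaf.germ ⊤ x trivial := by
      rw [Category.assoc, germ_appLE f ⊤ ⊤ (le_preimage_top f.left ⊤) x trivial, ← Category.assoc,
        fromBase_appLE]
    exact ConcreteCategory.congr_hom h r

theorem stalkMap_germ (f : X ⟶ Y) (U : Y.left.Opens) (V : X.left.Opens) (h : V ≤ f.left ⁻¹ᵁ U)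
    (x : X.left) (hx : x ∈ V) :
    (stalkMap f x).comp (germ U (f.left x) (mem_of_le h hx)) =
      (germ V x hx).comp (appLE f U V h) :=
  AlgHom.ext fun s => ConcreteCategory.congr_hom (germ_appLE f U V h x hx) s

theorem fromBase_map {U V : X.left.Opens} (h : V ≤ U) :
    fromBase X U ≫ X.left.presheaf.map (homOfLE h).op = fromBase X V := by
  simp only [fromBase, Category.assoc, Scheme.Hom.appLE_map]

/-- Restriction of functions. -/
def resFun {U V : X.left.Opens} (h : V ≤ U) : Γ(X.left, U) →ₐ[k] Γ(X.left, V) where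
  __ := (X.left.presheaf.map (homOfLE h).op).hom
  commutes' r := ConcreteCategory.congr_hom (fromBase_map h) r

theorem germ_res {U V : X.left.Opens} (h : V ≤ U) (x : X.left) (hx : x ∈ V) :
    (germ V x hx).comp (resFun h) = germ U x (h hx) :=
  AlgHom.ext fun s => ConcreteCategory.congr_hom
    (TopCat.Presheaf.germ_res X.left.presheaf (homOfLE h) x hx) s

theorem germ_res_apply {U V : X.left.Opens} (h : V ≤ U) (x : X.left) (hx : x ∈ V)
    (s : Γ(X.left, U)) : germ V x hx (resFun h s) = germ U x (h hx) s :=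
  AlgHom.congr_fun (germ_res h x hx) s

theorem stalkMap_germ_apply (f : X ⟶ Y) (U : Y.left.Opens) (V : X.left.Opens)
    (h : V ≤ f.left ⁻¹ᵁ U) (x : X.left) (hx : x ∈ V) (s : Γ(Y.left, U)) :
    stalkMap f x (germ U (f.left x) (mem_of_le h hx) s) = germ V x hx (appLE f U V h s) :=
  AlgHom.congr_fun (stalkMap_germ f U V h x hx) s

open CechCohomology

variable (X) in
/-- The structure sheaf of a `k`-scheme, as a presheaf of `k`-modules. -/
def structureSheaf : ModPresheaf k X.left where
  obj U := Γ(X.left, U)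
  res h := (resFun h).toLinearMap
  res_self {U} s := by
    have h : X.left.presheaf.map (homOfLE (le_refl U)).op = 𝟙 _ := X.left.presheaf.map_id _
    exact ConcreteCategory.congr_hom h s
  res_res {U V W} h h' s := by
    have h : X.left.presheaf.map (homOfLE h').op ≫ X.left.presheaf.map (homOfLE h).op =
        X.left.presheaf.map (homOfLE (h.trans h')).op := (X.left.presheaf.map_comp _ _).symm
    exact ConcreteCategory.congr_hom h s

variable (X) in
/-- The sheaf of relative differentials `Ω¹_{X/k}`, the sheaf associated with the presheaf
`U ↦ Ω[Γ(X, U)⁄k]`: a section over `U` is a family of elements of the stalks `Ω[𝒪_{X,x}⁄k]`, `x ∈ U`,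
that locally comes from an element of `Ω[Γ(X, V)⁄k]`. -/
def formsSubmodule (U : X.left.Opens) :
    Submodule k (∀ x : U, Ω[X.left.presheaf.stalk x.1⁄k]) where
  carrier := {ω | ∀ x ∈ U, ∃ (V : X.left.Opens) (_ : x ∈ V) (hV : V ≤ U) (η : Ω[Γ(X.left, V)⁄k]),
    ∀ (y : X.left) (hy : y ∈ V), ω ⟨y, hV hy⟩ = kaehlerMap (germ V y hy) η}
  zero_mem' x hx := ⟨U, hx, le_rfl, 0, fun _ _ => by simp⟩
  add_mem' {ω ω'} h h' x hx := by
    obtain ⟨V, hxV, hV, η, hη⟩ := h x hx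
    obtain ⟨V', hxV', hV', η', hη'⟩ := h' x hx
    refine ⟨V ⊓ V', ⟨hxV, hxV'⟩, fun _ hy => hV hy.1,
      kaehlerMap (resFun (U := V) (V := V ⊓ V') (fun _ hy => hy.1)) η +
        kaehlerMap (resFun (U := V') (V := V ⊓ V') (fun _ hy => hy.2)) η', fun y hy => ?_⟩
    rw [map_add, ← kaehlerMap_comp, ← kaehlerMap_comp, germ_res, germ_res, ← hη y hy.1,
      ← hη' y hy.2]
    rfl
  smul_mem' r ω h x hx := by
    obtain ⟨V, hxV, hV, η, hη⟩ := h x hx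
    refine ⟨V, hxV, hV, r • η, fun y hy => ?_⟩
    rw [map_smul, ← hη y hy]
    rfl

theorem coe_smul_forms (U : X.left.Opens) (r : k) (ω : formsSubmodule X U) (x : U) :
    (r • ω).1 x = r • ω.1 x := rfl

variable (X) in
/-- The sheaf of relative differentials, as a presheaf of `k`-modules. -/
def formsSheaf : ModPresheaf k X.left where
  obj U := formsSubmodule X U
  res {U V} h :=
    { toFun := fun ω => ⟨fun x => ω.1 ⟨x.1, h x.2⟩, fun x hx => by
        obtain ⟨W, hxW, hW, η, hη⟩ := ω.2 x (h hx)
        refine ⟨U ⊓ W, ⟨hx, hxW⟩, fun _ hy => hy.1,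
          kaehlerMap (resFun (U := W) (V := U ⊓ W) (fun _ hy => hy.2)) η, fun y hy => ?_⟩
        rw [← kaehlerMap_comp, germ_res, ← hη y hy.2]⟩
      map_add' := fun _ _ => rfl
      map_smul' := fun _ _ => rfl }
  res_self _ := rfl
  res_res _ _ _ := rfl

/-- Pullback of functions along a morphism `f : X → Y` of `k`-schemes: the morphism
`𝒪_Y → f_* 𝒪_X`. -/
def pullFun (f : X ⟶ Y) :
    HomOver (f.left.base.hom) (structureSheaf Y) (structureSheaf X) where
  app U V h := (appLE f U V h).toLinearMap
  app_res {U _ V} hU h s := ConcreteCategory.congr_hom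
    (Scheme.Hom.map_appLE f.left (V := V) (U := U) h (homOfLE hU).op) s
  res_app {U _ V'} hV h s := ConcreteCategory.congr_hom
    (Scheme.Hom.appLE_map f.left (U := U) (V := V') h (homOfLE hV).op) s

/-- Pullback of differential forms along a morphism `f : X → Y` of `k`-schemes: the morphism
`Ω¹_{Y/k} → f_* Ω¹_{X/k}`. -/
def pullForms (f : X ⟶ Y) :
    HomOver (f.left.base.hom) (formsSheaf Y) (formsSheaf X) where
  app U V h :=
    { toFun := fun ω => ⟨fun x => kaehlerMap (stalkMap f x.1) (ω.1 ⟨f.left x.1, h x.1 x.2⟩),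
        fun x hx => by
          obtain ⟨W, hxW, hW, η, hη⟩ := ω.2 (f.left x) (h x hx)
          refine ⟨V ⊓ f.left ⁻¹ᵁ W, ⟨hx, hxW⟩, fun _ hy => hy.1,
            kaehlerMap (appLE f W (V ⊓ f.left ⁻¹ᵁ W) (fun _ hy => hy.2)) η, fun y hy => ?_⟩
          rw [← kaehlerMap_comp, ← stalkMap_germ, kaehlerMap_comp, ← hη (f.left y) hy.2]⟩
      map_add' := fun ω ω' => Subtype.ext (funext fun x => map_add _ _ _)
      map_smul' := fun r ω => Subtype.ext (funext fun x => LinearMap.map_smul _ _ _) }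
  app_res _ _ _ := rfl
  res_app _ _ _ := rfl

/-- Multiplication of functions by a global differential form `ω`: the morphism
`𝒪_X → Ω¹_{X/k}`, `f ↦ f ω`. -/
def mulForm (ω : (formsSheaf X).obj ⊤) :
    HomOver (.id X.left) (structureSheaf X) (formsSheaf X) where
  app U V h :=
    { toFun := fun s => ⟨fun x => germ U x.1 (h x.1 x.2) s • ω.1 ⟨x.1, trivial⟩, fun x hx => by
        obtain ⟨W, hxW, hW, η, hη⟩ := ω.2 x trivial
        refine ⟨V ⊓ W, ⟨hx, hxW⟩, fun _ hy => hy.1,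
          resFun (U := U) (V := V ⊓ W) (fun y hy => h y hy.1) s •
            kaehlerMap (resFun (U := W) (V := V ⊓ W) (fun _ hy => hy.2)) η, fun y hy => ?_⟩
        rw [kaehlerMap_smul, ← kaehlerMap_comp, germ_res, ← hη y hy.2]
        exact congrArg (· • ω.1 ⟨y, trivial⟩)
          (germ_res_apply (U := U) (V := V ⊓ W) (fun z hz => h z hz.1) y hy s).symm⟩
      map_add' := fun s s' => Subtype.ext (funext fun x => by
        exact (congrArg (· • ω.1 ⟨x.1, trivial⟩) (map_add (germ U x.1 (h x.1 x.2)) s s')).trans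
          (add_smul _ _ _))
      map_smul' := fun r s => Subtype.ext (funext fun x => by
        exact (congrArg (· • ω.1 ⟨x.1, trivial⟩) (map_smul (germ U x.1 (h x.1 x.2)) r s)).trans
          (smul_assoc _ _ _)) }
  app_res {U U' V} hU h s := Subtype.ext (funext fun x => by
    exact congrArg (· • ω.1 ⟨x.1, trivial⟩) (germ_res_apply hU x.1 (h x.1 x.2) s))
  res_app _ _ _ := rfl

variable (X) in
/-- The space `H⁰(X, Ω¹_{X/k})` of global differential forms. -/
abbrev H0Forms : Type u := (formsSheaf X).obj ⊤

variable (X) in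
/-- The space `H¹(X, 𝒪_X)`. -/
abbrev H1Fun : Type u := H1 (structureSheaf X)

variable (X) in
/-- The space `H¹(X, Ω¹_{X/k})`. -/
abbrev H1Forms : Type u := H1 (formsSheaf X)

variable (X) in
/-- The cup product `H⁰(X, Ω¹_{X/k}) × H¹(X, 𝒪_X) → H¹(X, Ω¹_{X/k})`, which on cocycles is
`(ω, (c_xy)) ↦ (c_xy ω)`. -/
def cup : H0Forms X →ₗ[k] H1Fun X →ₗ[k] H1Forms X :=
  LinearMap.mk₂ k (fun ω c => H1.map (mulForm ω) c)
    (fun ω ω' c => by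
      obtain ⟨U, z, rfl⟩ := H1.exists_mk c
      simp only [H1.map_mk]
      rw [← map_add]
      refine congrArg (H1.mk _ _) (Subtype.ext ?_)
      funext s t
      exact Subtype.ext (funext fun x => smul_add _ _ _))
    (fun r ω c => by
      obtain ⟨U, z, rfl⟩ := H1.exists_mk c
      simp only [H1.map_mk]
      rw [← map_smul]
      refine congrArg (H1.mk _ _) (Subtype.ext ?_)
      funext s t
      exact Subtype.ext (funext fun x => smul_comm _ r _))
    (fun ω c c' => map_add _ c c')
    (fun r ω c => map_smul _ r c)

/-! ### The action of the automorphism group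

`σ ∈ Aut_k(X)` acts on the three spaces from the left, as pullback along `σ⁻¹`. -/

theorem stalkMap_id (x : X.left) : stalkMap (𝟙 X) x = AlgHom.id k _ :=
  AlgHom.ext fun s => ConcreteCategory.congr_hom (Scheme.Hom.stalkMap_id X.left x) s

theorem stalkMap_comp (f : X ⟶ Y) (g : Y ⟶ Z) (x : X.left) :
    stalkMap (f ≫ g) x = (stalkMap f x).comp (stalkMap g (f.left x)) :=
  AlgHom.ext fun s => ConcreteCategory.congr_hom (Scheme.Hom.stalkMap_comp f.left g.left x) s

theorem pullForms_id (U : X.left.Opens) (h : ∀ z ∈ U, (𝟙 X : X ⟶ X).left z ∈ U)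
    (ω : (formsSheaf X).obj U) : (pullForms (𝟙 X)).app U U h ω = ω :=
  Subtype.ext (funext fun x => by
    exact (congrArg (fun f => kaehlerMap f (ω.1 x)) (stalkMap_id x.1)).trans (kaehlerMap_id _))

theorem pullForms_comp (f : X ⟶ Y) (g : Y ⟶ Z) (U : Z.left.Opens) (V : Y.left.Opens)
    (W : X.left.Opens) (h : ∀ z ∈ V, g.left z ∈ U) (h' : ∀ z ∈ W, f.left z ∈ V)
    (h'' : ∀ z ∈ W, (f ≫ g).left z ∈ U) (ω : (formsSheaf Z).obj U) :
    (pullForms (f ≫ g)).app U W h'' ω = (pullForms f).app V W h' ((pullForms g).app U V h ω) :=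
  Subtype.ext (funext fun x => by
    exact (congrArg (fun φ => kaehlerMap φ (ω.1 ⟨g.left (f.left x.1), h'' x.1 x.2⟩))
      (stalkMap_comp f g x.1)).trans (kaehlerMap_comp _ _ _))

theorem pullFun_id (U : X.left.Opens) (h : ∀ z ∈ U, (𝟙 X : X ⟶ X).left z ∈ U)
    (s : (structureSheaf X).obj U) : (pullFun (𝟙 X)).app U U h s = s := by
  have : (𝟙 X.left : X.left ⟶ X.left).appLE U U h = 𝟙 _ := by
    rw [← Scheme.Hom.id_app]
    exact Scheme.Hom.appLE_eq_app (𝟙 X.left)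
  exact ConcreteCategory.congr_hom this s

theorem pullFun_comp (f : X ⟶ Y) (g : Y ⟶ Z) (U : Z.left.Opens) (V : Y.left.Opens)
    (W : X.left.Opens) (h : ∀ z ∈ V, g.left z ∈ U) (h' : ∀ z ∈ W, f.left z ∈ V)
    (h'' : ∀ z ∈ W, (f ≫ g).left z ∈ U) (s : (structureSheaf Z).obj U) :
    (pullFun (f ≫ g)).app U W h'' s = (pullFun f).app V W h' ((pullFun g).app U V h s) :=
  (ConcreteCategory.congr_hom (Scheme.Hom.appLE_comp_appLE f.left g.left U V W h h') s).symm

/-- Pullback of global differential forms. -/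
def pullH0Forms (f : X ⟶ Y) : H0Forms Y →ₗ[k] H0Forms X :=
  (pullForms f).app ⊤ ⊤ (fun _ _ => trivial)

/-- Pullback on `H¹` of the structure sheaf. -/
def pullH1Fun (f : X ⟶ Y) : H1Fun Y →ₗ[k] H1Fun X :=
  H1.map (pullFun f)

/-- Pullback on `H¹` of the sheaf of differentials. -/
def pullH1Forms (f : X ⟶ Y) : H1Forms Y →ₗ[k] H1Forms X :=
  H1.map (pullForms f)

theorem pullH0Forms_id : pullH0Forms (𝟙 X) = LinearMap.id :=
  LinearMap.ext fun ω => pullForms_id ⊤ _ ω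

theorem pullH0Forms_comp (f : X ⟶ Y) (g : Y ⟶ Z) :
    pullH0Forms (f ≫ g) = pullH0Forms f ∘ₗ pullH0Forms g :=
  LinearMap.ext fun ω => pullForms_comp f g ⊤ ⊤ ⊤ (fun _ _ => trivial) (fun _ _ => trivial) _ ω

theorem pullH1Fun_id : pullH1Fun (𝟙 X) = LinearMap.id :=
  have hχ : (𝟙 X : X ⟶ X).left.base.hom = .id X.left := rfl
  have h := H1.map_id hχ (pullFun (𝟙 X)) pullFun_id
  LinearMap.ext h

theorem H1_map_pullFun_comp (f : X ⟶ Y) (g : Y ⟶ Z) (c : H1Fun Z) :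
    H1.map (pullFun (f ≫ g)) c = H1.map (pullFun f) (H1.map (pullFun g) c) := by
  apply H1.map_comp (pullFun g) (pullFun f) (pullFun (f ≫ g)) rfl
  intro U V W h h' h'' s
  exact pullFun_comp f g U V W h h' h'' s

theorem pullH1Fun_comp (f : X ⟶ Y) (g : Y ⟶ Z) :
    pullH1Fun (f ≫ g) = pullH1Fun f ∘ₗ pullH1Fun g := by
  apply LinearMap.ext
  intro c
  rw [LinearMap.comp_apply]
  unfold pullH1Fun
  rw [H1_map_pullFun_comp]

theorem pullH1Forms_id : pullH1Forms (𝟙 X) = LinearMap.id :=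
  have hχ : (𝟙 X : X ⟶ X).left.base.hom = .id X.left := rfl
  have h := H1.map_id hχ (pullForms (𝟙 X)) pullForms_id
  LinearMap.ext h

theorem H1_map_pullForms_comp (f : X ⟶ Y) (g : Y ⟶ Z) (c : H1Forms Z) :
    H1.map (pullForms (f ≫ g)) c = H1.map (pullForms f) (H1.map (pullForms g) c) := by
  apply H1.map_comp (pullForms g) (pullForms f) (pullForms (f ≫ g)) rfl
  intro U V W h h' h'' s
  exact pullForms_comp f g U V W h h' h'' s

theorem pullH1Forms_comp (f : X ⟶ Y) (g : Y ⟶ Z) :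
    pullH1Forms (f ≫ g) = pullH1Forms f ∘ₗ pullH1Forms g := by
  apply LinearMap.ext
  intro c
  rw [LinearMap.comp_apply]
  unfold pullH1Forms
  rw [H1_map_pullForms_comp]

variable (X) in
/-- The canonical representation: `Aut_k(X)` acting on `H⁰(X, Ω¹_{X/k})`. -/
def H0FormsRep : Representation k (Aut X) (H0Forms X) where
  toFun σ := pullH0Forms σ.inv
  map_one' := pullH0Forms_id
  map_mul' σ τ := pullH0Forms_comp σ.inv τ.inv

variable (X) in
/-- The action of `Aut_k(X)` on `H¹(X, 𝒪_X)`. -/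
def H1FunRep : Representation k (Aut X) (H1Fun X) where
  toFun σ := pullH1Fun σ.inv
  map_one' := pullH1Fun_id
  map_mul' σ τ := pullH1Fun_comp σ.inv τ.inv

variable (X) in
/-- The action of `Aut_k(X)` on `H¹(X, Ω¹_{X/k})`. -/
def H1FormsRep : Representation k (Aut X) (H1Forms X) where
  toFun σ := pullH1Forms σ.inv
  map_one' := pullH1Forms_id
  map_mul' σ τ := pullH1Forms_comp σ.inv τ.inv

end KScheme

/-! ## The curve `y² = x^p - x` -/

section QuotientGrading

open DirectSum

variable {R A : Type u} [CommRing R] [CommRing A] [Algebra R A] (𝒜 : ℕ → Submodule R A)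
  [GradedAlgebra 𝒜] (I : Ideal A)

/-- The grading of `A ⧸ I` by the images of the graded pieces of `A`. -/
def quotientGrading (n : ℕ) : Submodule R (A ⧸ I) :=
  (𝒜 n).map (Ideal.Quotient.mkₐ R I).toLinearMap

/-- The components of an element of `A`, as elements of the graded pieces of `A ⧸ I`. -/
def quotientDecomposeAux : A →ₗ[R] ⨁ n, quotientGrading 𝒜 I n :=
  (DirectSum.lmap fun n => ((Ideal.Quotient.mkₐ R I).toLinearMap.restrict
    (p := 𝒜 n) (q := quotientGrading 𝒜 I n) fun _ hx => Submodule.mem_map_of_mem hx)) ∘ₗ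
    (decomposeLinearEquiv 𝒜).toLinearMap

theorem quotientDecomposeAux_apply (a : A) (n : ℕ) :
    ((quotientDecomposeAux 𝒜 I a n : quotientGrading 𝒜 I n) : A ⧸ I) =
      Ideal.Quotient.mk I (decompose 𝒜 a n) := rfl

/-- The decomposition of an element of `A ⧸ I` into components, for a homogeneous ideal `I`. -/
def quotientDecompose (hI : I.IsHomogeneous 𝒜) : A ⧸ I →ₗ[R] ⨁ n, quotientGrading 𝒜 I n :=
  ((I.restrictScalars R).liftQ (quotientDecomposeAux 𝒜 I) fun _ ha =>
    DFinsupp.ext (β := fun n => quotientGrading 𝒜 I n) fun n => Subtype.ext (Ideal.Quotient.eq_zero_iff_mem.mpr (hI n ha)) :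
      (A ⧸ I.restrictScalars R) →ₗ[R] ⨁ n, quotientGrading 𝒜 I n) ∘ₗ
    (Submodule.Quotient.restrictScalarsEquiv R I).symm.toLinearMap

theorem quotientDecompose_mk (hI : I.IsHomogeneous 𝒜) (a : A) :
    quotientDecompose 𝒜 I hI (Ideal.Quotient.mk I a) = quotientDecomposeAux 𝒜 I a := rfl

/-- The quotient of a graded algebra by a homogeneous ideal is graded. -/
@[reducible]
def quotientGradedAlgebra (hI : I.IsHomogeneous 𝒜) : GradedAlgebra (quotientGrading 𝒜 I) where
  one_mem := ⟨1, SetLike.GradedOne.one_mem, rfl⟩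
  mul_mem := by
    rintro i j _ _ ⟨a, ha, rfl⟩ ⟨b, hb, rfl⟩
    exact ⟨a * b, SetLike.GradedMul.mul_mem ha hb, rfl⟩
  decompose' := quotientDecompose 𝒜 I hI
  left_inv := by
    intro x
    obtain ⟨a, rfl⟩ := Ideal.Quotient.mk_surjective x
    change DirectSum.coeLinearMap (quotientGrading 𝒜 I) (quotientDecomposeAux 𝒜 I a) = _
    induction a using DirectSum.Decomposition.inductionOn 𝒜 with
    | zero => simp
    | add a b ha hb => rw [map_add, map_add, ha, hb, map_add]
    | homogeneous a =>
      rename_i i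
      have : quotientDecomposeAux 𝒜 I (a : A) =
          DirectSum.lof R ℕ (fun n => quotientGrading 𝒜 I n) i
            ⟨Ideal.Quotient.mk I a, Submodule.mem_map_of_mem a.2⟩ := by
        simp only [quotientDecomposeAux, LinearMap.comp_apply, LinearEquiv.coe_coe,
          decomposeLinearEquiv_apply, decompose_coe]
        exact DirectSum.lmap_lof _ _ _
      rw [this, DirectSum.coeLinearMap_lof]
  right_inv := by
    intro x
    change quotientDecompose 𝒜 I hI (DirectSum.coeLinearMap (quotientGrading 𝒜 I) x) = x
    induction x using DirectSum.induction_on with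
    | zero => simp
    | add a b ha hb => rw [map_add, map_add, ha, hb]
    | of i y =>
      obtain ⟨_, a, ha, rfl⟩ := y
      change quotientDecompose 𝒜 I hI (DirectSum.coeLinearMap (quotientGrading 𝒜 I)
        (DirectSum.lof R ℕ (fun n => quotientGrading 𝒜 I n) i _)) = _
      rw [DirectSum.coeLinearMap_lof]
      change quotientDecomposeAux 𝒜 I a = _
      simp only [quotientDecomposeAux, LinearMap.comp_apply, LinearEquiv.coe_coe,
        decomposeLinearEquiv_apply, decompose_of_mem 𝒜 ha]
      exact DirectSum.lmap_lof _ _ _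

end QuotientGrading

namespace ASCurve

open MvPolynomial

variable (k : Type u) [Field k] (p : ℕ)

/-- The weights of the homogeneous coordinates `x`, `z`, `y` of the weighted projective plane
`ℙ(1, 1, (p + 1) / 2)`. -/
def weights : Fin 3 → ℕ := ![1, 1, (p + 1) / 2]

/-- The weighted homogeneous form `y² - (x ^ p z - x z ^ p)`, where `x`, `z`, `y` are the variables
`X 0`, `X 1`, `X 2`. Setting `z = 1` gives `y² = x ^ p - x`. -/
def equation : MvPolynomial (Fin 3) k :=
  X 2 ^ 2 - (X 0 ^ p * X 1 - X 0 * X 1 ^ p)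

/-- The homogeneous coordinate ring `k[x, z, y] / (y² - x ^ p z + x z ^ p)`. -/
abbrev CoordRing : Type u := MvPolynomial (Fin 3) k ⧸ Ideal.span {equation k p}

/-- The grading of the homogeneous coordinate ring. -/
def grading : ℕ → Submodule k (CoordRing k p) :=
  quotientGrading (weightedHomogeneousSubmodule k (weights p)) (Ideal.span {equation k p})

variable [Fact p.Prime] [Fact (2 < p)]

theorem equation_isHomogeneous : IsWeightedHomogeneous (weights p) (equation k p) (p + 1) := by
  have hodd : Odd p := (Fact.out : p.Prime).odd_of_ne_two (Fact.out : 2 < p).ne'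
  have h0 : IsWeightedHomogeneous (weights p) (X 0 : MvPolynomial (Fin 3) k) 1 :=
    isWeightedHomogeneous_X k (weights p) 0
  have h1 : IsWeightedHomogeneous (weights p) (X 1 : MvPolynomial (Fin 3) k) 1 :=
    isWeightedHomogeneous_X k (weights p) 1
  have h2 : IsWeightedHomogeneous (weights p) (X 2 : MvPolynomial (Fin 3) k) ((p + 1) / 2) :=
    isWeightedHomogeneous_X k (weights p) 2
  have e2 : 2 • ((p + 1) / 2) = p + 1 := by
    obtain ⟨m, hm⟩ := hodd
    simp only [smul_eq_mul]
    omega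
  have a := h2.pow 2
  rw [e2] at a
  have b := (h0.pow p).mul h1
  have c := h0.mul (h1.pow p)
  rw [smul_eq_mul, mul_one] at b c
  rw [add_comm 1 p] at c
  exact (weightedHomogeneousSubmodule k (weights p) (p + 1)).sub_mem a
    ((weightedHomogeneousSubmodule k (weights p) (p + 1)).sub_mem b c)

instance : GradedAlgebra (grading k p) :=
  letI : GradedAlgebra (weightedHomogeneousSubmodule k (weights p)) :=
    weightedGradedAlgebra k (weights p)
  quotientGradedAlgebra _ _ (Ideal.homogeneous_span _ _ fun _ hx =>
    ⟨p + 1, (Set.mem_singleton_iff.mp hx) ▸ equation_isHomogeneous k p⟩)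

/-- The smooth projective curve `X` with affine equation `y² = x ^ p - x`, as a scheme over `k`: the
curve `y² = x ^ p z - x z ^ p` in the weighted projective plane `ℙ(1, 1, (p + 1) / 2)`. -/
def curve : Over (Spec (CommRingCat.of k)) :=
  Over.mk (Proj.toSpecZero (grading k p) ≫
    Spec.map (CommRingCat.ofHom (algebraMap k (grading k p 0))))

end ASCurve

end

/-! Write p = 2m + 1. The curve is covered by two affine charts: U with coordinates x, y and y² =
x^p - x, and V with u = 1/x, v = y/x^(m+1) and v² = u - u^p. Everything is computed inside the
function field K, where the monomials x^i and y x^i (i any integer) form a k-basis of the functions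
regular on U ∩ V. Regularity on U means i ≥ 0. Regularity on V means i ≤ 0 for x^i and i ≤ -(m+1)
for y x^i.

In characteristic p the equation gives dx = -2y dy and dv = x^(m-1) dy. Hence dy generates Ω¹ on U,
and a form f dy is regular on V exactly when x^(-(m-1)) f is. So Ω¹ is the structure sheaf twisted
by m - 1 at infinity, and both sheaves are handled by one computation (`IsTwist`) with twist n = 0
or n = m - 1. The outcome is: H⁰(Ω¹) has basis x^i dy for 0 ≤ i < m; H¹(𝒪) has basis the classes of
y x^j for -m ≤ j ≤ -1; H¹(Ω¹) is spanned by the class of (y/x) dy. Since x^i · y x^j is y/x exactly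
for j = -1 - i, the cup product pairs these bases perfectly (`serreMap_bijective`).

To make Čech classes computable, a sheaf of lattices in K is considered (`LatticeModel`). A class is
then a family (b_q) in K indexed by points, with b_r - b_q regular over N_q ∩ N_r for some cover N,
and it vanishes iff one g in K satisfies b_q - g ∈ lat q for all q (`Represents.eq_zero_iff`). A
partition of unity gives vanishing on affine opens (`splits_of_isAffineOpen`), and Mayer–Vietoris
for U, V does the rest.

Automorphisms act on the line H¹(Ω¹) trivially, for the following reason. The function (y + b)/(x -
a) has simple poles only at (a, b) and at infinity, so the class of (y/x) dy at infinity equals the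
class of ds/s placed at (a, b), for any uniformizer s there (`exists_dlog`). An automorphism carries
ds/s to the logarithmic differential of another uniformizer at another point, which has the same
class. With this, the cup product pairing is equivariant, and H¹(𝒪) is the contragredient of H⁰(Ω¹).

Irreducibility of H⁰(Ω¹) needs two automorphisms. Under (x, y) ↦ (x + 1, y) the form P(x) dy becomes
P(x + 1) dy. As deg P < p, repeated differences lower the degree by exactly one, so a stable
subspace containing P(x) dy contains Q(x) dy for every Q of degree at most deg P, in particular dy.
The automorphism (x, y) ↦ (1/x, i y/x^(m+1)) with i² = -1 sends dy to i x^(m-1) dy, of the top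
degree, and a second use of translations gives everything. Irreducibility of H¹(𝒪) follows by
duality. -/

noncomputable section

/-! ## Sheaves of lattices in a vector space and adelic description of `Ȟ¹` -/

namespace CechCohomology

variable {k : Type u} [CommRing k] {T : Type u} [TopologicalSpace T]

theorem H1.mk_eq_zero_of_mem (F : ModPresheaf k T) (U : PointCover T) (c : cocycles F U)
    (h : c ∈ coboundaries F U) : H1.mk F U c = 0 := by
  rw [H1.mk, LinearMap.comp_apply, Submodule.mkQ_apply, (Submodule.Quotient.mk_eq_zero _).mpr h,
    map_zero]

/-- Covers are directed under refinement, and an element that dies in a directed colimit already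
dies at some stage. -/
theorem H1.exists_mem_of_mk_eq_zero (F : ModPresheaf k T) (U : PointCover T) (c : cocycles F U)
    (h : H1.mk F U c = 0) : ∃ (V : PointCover T) (hUV : U ≤ V),
      (⟨cochainMap (HomOver.id F) (PointCover.refines_id hUV) c.1,
        cochainMap_mem _ _ c.1 c.2⟩ : cocycles F V) ∈ coboundaries F V := by
  classical
  -- Restriction to a finer cover is functorial, which is inherited from the presheaf entry by
  -- entry.
  have : DirectedSystem (fun U : PointCover T => CoverH1 F U)
      (fun U V h => refine F U V h) := by
    constructor
    · intro U x
      obtain ⟨c, rfl⟩ := Submodule.Quotient.mk_surjective _ x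
      refine congrArg Submodule.Quotient.mk (Subtype.ext ?_)
      funext x y
      exact F.res_self _
    · intro U V W h h' x
      obtain ⟨c, rfl⟩ := Submodule.Quotient.mk_surjective _ x
      refine congrArg Submodule.Quotient.mk (Subtype.ext ?_)
      funext x y
      exact F.res_res _ _ _
  obtain ⟨V, hUV, hV⟩ := Module.DirectLimit.of.zero_exact
    (G := fun U : PointCover T => CoverH1 F U) (f := refine F) h
  exact ⟨V, hUV, (Submodule.Quotient.mk_eq_zero _).mp hV⟩

/-- A realisation of a presheaf `F` on an irreducible space with generic point `η` as the sheaf of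
sections of a family of lattices `lat x` in a fixed module `K`. -/
structure LatticeModel (F : ModPresheaf k T) (K : Type u) [AddCommGroup K] [Module k K] where
  η : T
  generic : ∀ {U : Opens T} {x : T}, x ∈ U → η ∈ U
  toK (U : Opens T) (h : η ∈ U) : F.obj U →ₗ[k] K
  toK_res : ∀ {U V : Opens T} (h : U ≤ V) (hU : η ∈ U) (s : F.obj V),
    toK U hU (F.res h s) = toK V (h hU) s
  toK_injective : ∀ (U : Opens T) (h : η ∈ U), Function.Injective (toK U h)
  lat : T → Submodule k K
  toK_mem : ∀ (U : Opens T) (h : η ∈ U) (s : F.obj U), ∀ x ∈ U, toK U h s ∈ lat x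
  exists_toK : ∀ (U : Opens T) (h : η ∈ U) (f : K), (∀ x ∈ U, f ∈ lat x) → ∃ s, toK U h s = f
  lat_open : ∀ (x : T), ∀ f ∈ lat x, ∃ U : Opens T, x ∈ U ∧ ∀ y ∈ U, f ∈ lat y

namespace LatticeModel

variable {F G : ModPresheaf k T} {K : Type u} [AddCommGroup K] [Module k K]
  (M : LatticeModel F K)

/-- The generic point lies in all pairwise intersections of a cover. -/
theorem generic_pair (N : PointCover T) (x y : T) : M.η ∈ N.nhd x ⊓ N.nhd y :=
  ⟨M.generic (N.mem x), M.generic (N.mem y)⟩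

theorem generic_triple (N : PointCover T) (x y z : T) : M.η ∈ N.nhd x ⊓ N.nhd y ⊓ N.nhd z :=
  ⟨M.generic_pair N x y, M.generic (N.mem z)⟩

/-- The families `(b_x)` of elements of `K` for which `b_y - b_x` is a section of the lattices over
`N_x ∩ N_y`, for some cover `N`. -/
def adeles : Submodule k (T → K) where
  carrier := {b | ∃ N : PointCover T, ∀ x y, ∀ z ∈ N.nhd x ⊓ N.nhd y, b y - b x ∈ M.lat z}
  zero_mem' := ⟨⟨fun _ => ⊤, fun _ => trivial⟩, fun x y z _ => by simp⟩
  add_mem' := by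
    rintro b b' ⟨N, h⟩ ⟨N', h'⟩
    refine ⟨⟨fun x => N.nhd x ⊓ N'.nhd x, fun x => ⟨N.mem x, N'.mem x⟩⟩, fun x y z hz => ?_⟩
    have : (b + b') y - (b + b') x = (b y - b x) + (b' y - b' x) := by
      simp only [Pi.add_apply]; abel
    rw [this]
    exact add_mem (h x y z ⟨hz.1.1, hz.2.1⟩) (h' x y z ⟨hz.1.2, hz.2.2⟩)
  smul_mem' := by
    rintro r b ⟨N, h⟩
    refine ⟨N, fun x y z hz => ?_⟩
    simp only [Pi.smul_apply, ← smul_sub]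
    exact Submodule.smul_mem _ _ (h x y z hz)

/-- The family `b` represents the cohomology class `c`. -/
def Represents (b : T → K) (c : H1 F) : Prop :=
  ∃ (N : PointCover T) (z : cocycles F N), H1.mk F N z = c ∧
    ∀ x y, M.toK _ (M.generic_pair N x y) (z.1 x y) = b y - b x

theorem mem_cocycles {N : PointCover T} {c : Cochain1 F N} {b : T → K}
    (h : ∀ x y, M.toK _ (M.generic_pair N x y) (c x y) = b y - b x) : c ∈ cocycles F N := by
  intro x y z
  apply M.toK_injective _ (M.generic_triple N x y z)
  simp only [map_add, map_sub, M.toK_res, h, map_zero]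
  abel

variable {M}

theorem Represents.mem_adeles {b : T → K} {c : H1 F} (h : M.Represents b c) : b ∈ M.adeles := by
  obtain ⟨N, z, -, h⟩ := h
  exact ⟨N, fun x y w hw => h x y ▸ M.toK_mem _ _ _ w hw⟩

theorem Represents.refine {b : T → K} {N V : PointCover T} (hNV : N ≤ V) {z : cocycles F N}
    (h : ∀ x y, M.toK _ (M.generic_pair N x y) (z.1 x y) = b y - b x) :
    ∃ z' : cocycles F V, H1.mk F V z' = H1.mk F N z ∧
      ∀ x y, M.toK _ (M.generic_pair V x y) (z'.1 x y) = b y - b x :=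
  ⟨⟨cochainMap (HomOver.id F) (PointCover.refines_id hNV) z.1, cochainMap_mem _ _ z.1 z.2⟩,
    H1.mk_refine hNV z, fun x y => (M.toK_res _ _ _).trans (h x y)⟩

theorem Represents.add {b b' : T → K} {c c' : H1 F} (h : M.Represents b c)
    (h' : M.Represents b' c') : M.Represents (b + b') (c + c') := by
  obtain ⟨N, z, rfl, h⟩ := h
  obtain ⟨N', z', rfl, h'⟩ := h'
  obtain ⟨V, hV, hV'⟩ := exists_ge_ge N N'
  obtain ⟨w, hw, hb⟩ := Represents.refine hV h
  obtain ⟨w', hw', hb'⟩ := Represents.refine hV' h'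
  refine ⟨V, w + w', by rw [map_add, hw, hw'], fun x y => ?_⟩
  simp only [Submodule.coe_add, Pi.add_apply, map_add, hb, hb']
  abel

theorem Represents.smul {b : T → K} {c : H1 F} (r : k) (h : M.Represents b c) :
    M.Represents (r • b) (r • c) := by
  obtain ⟨N, z, rfl, h⟩ := h
  refine ⟨N, r • z, by rw [map_smul], fun x y => ?_⟩
  simp only [Submodule.coe_smul, Pi.smul_apply, map_smul, h, smul_sub]

theorem Represents.sub {b b' : T → K} {c c' : H1 F} (h : M.Represents b c)
    (h' : M.Represents b' c') : M.Represents (b - b') (c - c') := by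
  simpa [sub_eq_add_neg] using h.add (h'.smul (-1))

/-- If the cocycle is the coboundary of (β_x) on a finer cover, then b_x - β_x does not depend on x,
and this constant is g. Conversely b_x - g, lying in the lattice at x, is a section near x, and
these local sections form a 0-cochain with the required coboundary. -/
theorem Represents.eq_zero_iff {b : T → K} {c : H1 F} (h : M.Represents b c) :
    c = 0 ↔ ∃ g, ∀ x, b x - g ∈ M.lat x := by
  obtain ⟨N, z, rfl, h⟩ := h
  constructor
  · intro h0
    obtain ⟨V, hV, β, hβ⟩ := H1.exists_mem_of_mk_eq_zero F N z h0
    -- Comparison with the index `M.η` shows that β_x - b_x is independent of x.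
    have key : ∀ x, M.toK _ (M.generic (V.mem x)) (β x) - b x
        = M.toK _ (M.generic (V.mem M.η)) (β M.η) - b M.η := by
      intro x
      have h1 := congrArg (M.toK _ (M.generic_pair V M.η x)) (congrFun (congrFun hβ M.η) x)
      have h2 : M.toK _ (M.generic_pair V M.η x) (F.res (PointCover.pair_le hV M.η x) (z.1 M.η x))
        = b x - b M.η := (M.toK_res _ _ _).trans (h _ _)
      have h3 : M.toK _ (M.generic_pair V M.η x) (d0 F V β M.η x) =
          M.toK _ (M.generic (V.mem x)) (β x) - M.toK _ (M.generic (V.mem M.η)) (β M.η) := by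
        simp only [d0, LinearMap.coe_mk, AddHom.coe_mk, map_sub, M.toK_res]
      have h4 := h3.symm.trans (h1.trans h2)
      rw [sub_eq_sub_iff_add_eq_add] at h4 ⊢
      rw [h4]; abel
    refine ⟨b M.η - M.toK _ (M.generic (V.mem M.η)) (β M.η), fun x => ?_⟩
    have : b x - (b M.η - M.toK _ (M.generic (V.mem M.η)) (β M.η)) =
        M.toK _ (M.generic (V.mem x)) (β x) := by
      rw [sub_eq_iff_eq_add.mp (key x)]; abel
    rw [this]
    exact M.toK_mem _ _ _ x (V.mem x)
  · rintro ⟨g, hg⟩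
    choose W hxW hW using fun x => M.lat_open x _ (hg x)
    let V : PointCover T := ⟨fun x => N.nhd x ⊓ W x, fun x => ⟨N.mem x, hxW x⟩⟩
    have hV : N ≤ V := fun x => inf_le_left
    obtain ⟨z', hz', hb⟩ := Represents.refine hV h
    rw [← hz']
    apply H1.mk_eq_zero_of_mem
    choose β hβ using fun x => M.exists_toK (V.nhd x) (M.generic (V.mem x)) _
      (fun y hy => hW x y hy.2)
    refine ⟨β, ?_⟩
    funext x y
    apply M.toK_injective _ (M.generic_pair V x y)
    refine Eq.trans ?_ (hb x y).symm
    simp only [d0, LinearMap.coe_mk, AddHom.coe_mk, map_sub, M.toK_res, hβ]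
    abel

theorem Represents.eq_iff {b b' : T → K} {c c' : H1 F} (h : M.Represents b c)
    (h' : M.Represents b' c') : c = c' ↔ ∃ g, ∀ x, b x - b' x - g ∈ M.lat x := by
  rw [← sub_eq_zero]
  exact (h.sub h').eq_zero_iff

variable (M)

/-- Inside K the cocycle has a primitive: the generic point lies in every member of the cover, so x
↦ c_ηx makes sense, and the cocycle identity for (η, x, y) reads c_xy = c_ηy - c_ηx. -/
theorem exists_represents (c : H1 F) : ∃ b, M.Represents b c := by
  obtain ⟨N, z, rfl⟩ := H1.exists_mk c
  refine ⟨fun x => M.toK _ (M.generic_pair N M.η x) (z.1 M.η x), N, z, rfl, fun x y => ?_⟩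
  have h := congrArg (M.toK _ (M.generic_triple N M.η x y)) (z.2 M.η x y)
  simp only [map_add, map_sub, M.toK_res, map_zero] at h
  rw [eq_sub_iff_add_eq, ← sub_eq_zero, ← h]
  abel

theorem exists_represented {b : T → K} (hb : b ∈ M.adeles) : ∃ c, M.Represents b c := by
  obtain ⟨N, h⟩ := hb
  choose c hc using fun x y => M.exists_toK _ (M.generic_pair N x y) _ (h x y)
  exact ⟨_, N, ⟨c, M.mem_cocycles hc⟩, rfl, hc⟩

/-- The cohomology class represented by an adele. -/
def classOf : M.adeles →ₗ[k] H1 F where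
  toFun b := (M.exists_represented b.2).choose
  map_add' b b' := by
    -- An adele determines the class it represents, so the chosen class is additive; the two adeles
    -- coincide and g = 0 works.
    refine (Represents.eq_iff (M.exists_represented (b + b').2).choose_spec
      ((M.exists_represented b.2).choose_spec.add
        (M.exists_represented b'.2).choose_spec)).mpr ⟨0, fun x => ?_⟩
    simp
  map_smul' r b := by
    refine (Represents.eq_iff (M.exists_represented (r • b).2).choose_spec
      ((M.exists_represented b.2).choose_spec.smul r)).mpr ⟨0, fun x => ?_⟩
    simp

theorem represents_classOf (b : M.adeles) : M.Represents b.1 (M.classOf b) :=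
  (M.exists_represented b.2).choose_spec

/-- If a morphism of presheaves is the restriction of a linear endomorphism `m` of `K`, then the
induced map on cohomology is `m` on adeles. -/
theorem Represents.map_id {M : LatticeModel F K} {M' : LatticeModel G K}
    (α : HomOver (.id T) F G) (m : K →ₗ[k] K)
    (hη : M'.η = M.η)
    (hα : ∀ (U : Opens T) (h : M.η ∈ U) (s : F.obj U),
      M'.toK U (hη ▸ h) (α.app U U (fun _ hz => hz) s) = m (M.toK U h s))
    {b : T → K} {c : H1 F} (h : M.Represents b c) :
    M'.Represents (fun x => m (b x)) (H1.map α c) := by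
  obtain ⟨N, z, rfl, h⟩ := h
  refine ⟨N, ⟨cochainMap α (PointCover.refines_id le_rfl) z.1, cochainMap_mem α _ z.1 z.2⟩,
    (H1.map_mk α z).symm, fun x y => ?_⟩
  rw [← map_sub, ← h]
  exact hα _ _ _

/-! ### The Mayer–Vietoris sequence of two open subsets, in terms of adeles. -/

section TwoCharts

variable (U V : Opens T)

/-- The elements of `K` that lie in all lattices over an open subset. -/
def sections (U : Opens T) : Submodule k K where
  carrier := {f | ∀ x ∈ U, f ∈ M.lat x}
  zero_mem' _ _ := zero_mem _
  add_mem' h h' x hx := add_mem (h x hx) (h' x hx)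
  smul_mem' r _ h x hx := Submodule.smul_mem _ r (h x hx)

/-- Every adele can be approximated on `U` by an element of `K`. -/
def Splits : Prop := ∀ b ∈ M.adeles, ∃ g, ∀ x ∈ U, b x - g ∈ M.lat x

open Classical in
/-- The family that vanishes on `U` and equals `f` elsewhere. -/
def extendOff : K →ₗ[k] (T → K) where
  toFun f x := if x ∈ U then 0 else f
  map_add' f g := by funext x; simp only [Pi.add_apply]; split_ifs <;> simp
  map_smul' r f := by funext x; simp only [Pi.smul_apply, RingHom.id_apply]; split_ifs <;> simp

theorem extendOff_of_mem (f : K) {x : T} (hx : x ∈ U) :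
    extendOff (k := k) U f x = 0 := if_pos hx

theorem extendOff_of_notMem (f : K) {x : T} (hx : x ∉ U) :
    extendOff (k := k) U f x = f := if_neg hx

variable {U V}

/-- Take the cover whose member at x is U if x ∈ U and V otherwise. Differences of the family are 0
or ±f, and ±f occurs only over U ∩ V. -/
theorem extendOff_mem_adeles (hUV : U ⊔ V = ⊤) {f : K} (hf : f ∈ M.sections (U ⊓ V)) :
    extendOff (k := k) U f ∈ M.adeles := by
  classical
  have hV : ∀ x, x ∉ U → x ∈ V := fun x hx =>
    ((show x ∈ U ⊔ V from hUV ▸ trivial) : x ∈ U ∨ x ∈ V).resolve_left hx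
  refine ⟨⟨fun x => if x ∈ U then U else V, fun x => ?_⟩, fun x y z hz => ?_⟩
  · split_ifs with h
    exacts [h, hV x h]
  · obtain ⟨hx, hy⟩ := hz
    dsimp only at hx hy
    by_cases h1 : x ∈ U <;> by_cases h2 : y ∈ U <;>
      simp only [h1, h2, if_true, if_false] at hx hy <;>
      simp only [extendOff, LinearMap.coe_mk, AddHom.coe_mk, h1, h2, if_true, if_false, sub_self,
        zero_sub, sub_zero, neg_mem_iff, zero_mem]
    exacts [hf z ⟨hx, hy⟩, hf z ⟨hy, hx⟩]

/-- The connecting map of the Mayer-Vietoris sequence of two open subsets. -/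
def connecting (hUV : U ⊔ V = ⊤) : M.sections (U ⊓ V) →ₗ[k] H1 F :=
  M.classOf ∘ₗ ((extendOff U).comp (M.sections (U ⊓ V)).subtype).codRestrict M.adeles
    fun f => M.extendOff_mem_adeles hUV f.2

theorem represents_connecting (hUV : U ⊔ V = ⊤) (f : M.sections (U ⊓ V)) :
    M.Represents (extendOff (k := k) U f.1) (M.connecting hUV f) :=
  M.represents_classOf _

/-- If g and g' approximate the adele b on U and on V, then b - g is negligible on U and congruent
to g' - g off U. So b - g is equivalent to the extension of g' - g by zero, and subtracting the
constant g does not change the class. -/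
theorem connecting_surjective (hUV : U ⊔ V = ⊤) (hU : M.Splits U) (hV : M.Splits V) :
    Function.Surjective (M.connecting hUV) := by
  intro c
  obtain ⟨b, hb⟩ := M.exists_represents c
  obtain ⟨g, hg⟩ := hU b hb.mem_adeles
  obtain ⟨g', hg'⟩ := hV b hb.mem_adeles
  refine ⟨⟨g' - g, fun x hx => ?_⟩, ?_⟩
  · have := sub_mem (hg x hx.1) (hg' x hx.2)
    rwa [sub_sub_sub_cancel_left] at this
  · refine ((M.represents_connecting hUV _).eq_iff hb).mpr ⟨-g, fun x => ?_⟩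
    by_cases hx : x ∈ U
    · rw [extendOff_of_mem U _ hx]
      have := neg_mem (hg x hx)
      convert this using 1; abel
    · have hxV : x ∈ V := ((show x ∈ U ⊔ V from hUV ▸ trivial) : x ∈ U ∨ x ∈ V).resolve_left hx
      rw [extendOff_of_notMem U _ hx]
      have := neg_mem (hg' x hxV)
      convert this using 1; dsimp only; abel

/-- The constant g provided by `Represents.eq_zero_iff` is regular on U, and f - g is regular on V,
which is the splitting of f. -/
theorem connecting_eq_zero_iff (hUV : U ⊔ V = ⊤) (f : M.sections (U ⊓ V)) :
    M.connecting hUV f = 0 ↔ f.1 ∈ M.sections U ⊔ M.sections V := by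
  rw [(M.represents_connecting hUV f).eq_zero_iff, Submodule.mem_sup]
  constructor
  · rintro ⟨g, hg⟩
    have h1 : g ∈ M.sections U := fun x hx => by
      have := hg x
      rwa [extendOff_of_mem U _ hx, zero_sub, neg_mem_iff] at this
    refine ⟨g, h1, f.1 - g, fun x hx => ?_, by abel⟩
    by_cases hxU : x ∈ U
    · exact sub_mem (f.2 x ⟨hxU, hx⟩) (h1 x hxU)
    · have := hg x
      rwa [extendOff_of_notMem U _ hxU] at this
  · rintro ⟨g, hg, g', hg', h⟩
    refine ⟨g, fun x => ?_⟩
    by_cases hx : x ∈ U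
    · rw [extendOff_of_mem U _ hx, zero_sub, neg_mem_iff]
      exact hg x hx
    · have hxV : x ∈ V := ((show x ∈ U ⊔ V from hUV ▸ trivial) : x ∈ U ∨ x ∈ V).resolve_left hx
      rw [extendOff_of_notMem U _ hx, ← h, add_sub_cancel_left]
      exact hg' x hxV

end TwoCharts

end LatticeModel

end CechCohomology

end

noncomputable section

/-! ## Functions and differential forms on an integral scheme as elements of the function field -/

namespace KScheme

open CechCohomology

variable {k : Type u} [Field k] {X : Over (Spec (CommRingCat.of k))} [IsIntegral X.left]

variable (X) in
/-- The function field of an integral `k`-scheme. -/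
abbrev FunField : Type u := X.left.functionField

theorem generic_mem {U : X.left.Opens} {x : X.left} (hx : x ∈ U) : genericPoint X.left ∈ U :=
  ((genericPoint_spec X.left).mem_open_set_iff U.isOpen).mpr ⟨x, trivial, hx⟩

/-- A function on an open subset as an element of the function field. -/
abbrev toFF (U : X.left.Opens) (h : genericPoint X.left ∈ U) : Γ(X.left, U) →ₐ[k] FunField X :=
  germ U (genericPoint X.left) h

theorem toFF_injective (U : X.left.Opens) (h : genericPoint X.left ∈ U) :
    Function.Injective (toFF U h) :=
  germ_injective_of_isIntegral X.left _ h

/-- The inclusion of a local ring into the function field. -/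
def stalkToFF (x : X.left) : X.left.presheaf.stalk x →ₐ[k] FunField X where
  __ := (X.left.presheaf.stalkSpecializes ((genericPoint_spec X.left).specializes trivial)).hom
  commutes' r := by
    have h := X.left.presheaf.germ_stalkSpecializes (U := ⊤) (y := x) trivial
      ((genericPoint_spec X.left).specializes trivial)
    exact ConcreteCategory.congr_hom h ((fromBase X ⊤).hom r)

theorem stalkToFF_germ (U : X.left.Opens) (x : X.left) (hx : x ∈ U) (s : Γ(X.left, U)) :
    stalkToFF x (germ U x hx s) = toFF U (generic_mem hx) s :=
  ConcreteCategory.congr_hom (X.left.presheaf.germ_stalkSpecializes (U := U) (y := x) hx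
      ((genericPoint_spec X.left).specializes trivial)) s

omit [IsIntegral X.left] in
theorem exists_germ (x : X.left) (f : X.left.presheaf.stalk x) :
    ∃ (U : X.left.Opens) (hx : x ∈ U) (s : Γ(X.left, U)), germ U x hx s = f :=
  X.left.presheaf.exists_germ_eq f

theorem stalkToFF_injective (x : X.left) : Function.Injective (stalkToFF x) :=
  IsFractionRing.injective (X.left.presheaf.stalk x) X.left.functionField

/-- The local ring of a point, as a subring of the function field. -/
def localRing (x : X.left) : Subalgebra k (FunField X) := (stalkToFF x).range

theorem toFF_mem_localRing (U : X.left.Opens) (h : genericPoint X.left ∈ U) (s : Γ(X.left, U))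
    {x : X.left} (hx : x ∈ U) : toFF U h s ∈ localRing x :=
  ⟨germ U x hx s, stalkToFF_germ U x hx s⟩

theorem exists_toFF_of_mem {x : X.left} {f : FunField X} (hf : f ∈ localRing x) :
    ∃ (U : X.left.Opens) (hx : x ∈ U) (s : Γ(X.left, U)), toFF U (generic_mem hx) s = f := by
  obtain ⟨g, rfl⟩ := hf
  obtain ⟨U, hx, s, rfl⟩ := exists_germ x g
  exact ⟨U, hx, s, (stalkToFF_germ U x hx s).symm⟩

/-- Local representatives of f agree on overlaps because sections embed into the function field, so
they glue. -/
theorem exists_toFF (U : X.left.Opens) (h : genericPoint X.left ∈ U) (f : FunField X)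
    (hf : ∀ x ∈ U, f ∈ localRing x) : ∃ s : Γ(X.left, U), toFF U h s = f := by
  choose V hxV s hs using fun x : U => exists_toFF_of_mem (hf x.1 x.2)
  let W : U → X.left.Opens := fun x => U ⊓ V x
  have hW : ∀ x : U, x.1 ∈ W x := fun x => ⟨x.2, hxV x⟩
  obtain ⟨t, ht, -⟩ := TopCat.Sheaf.existsUnique_gluing' X.left.sheaf W U
    (fun x => homOfLE inf_le_left) (fun x hx => Opens.mem_iSup.mpr ⟨⟨x, hx⟩, hW ⟨x, hx⟩⟩)
    (fun x => resFun (inf_le_right : W x ≤ V x) (s x)) (by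
      intro x y
      have hη : genericPoint X.left ∈ W x ⊓ W y := ⟨generic_mem (hW x), generic_mem (hW y)⟩
      apply toFF_injective (W x ⊓ W y) hη
      refine (germ_res_apply (inf_le_left : W x ⊓ W y ≤ W x) _ hη _).trans
        (Eq.trans ?_ (germ_res_apply (inf_le_right : W x ⊓ W y ≤ W y) _ hη _).symm)
      rw [germ_res_apply, germ_res_apply]
      exact (hs x).trans (hs y).symm)
  refine ⟨t, ?_⟩
  have h1 := germ_res_apply (inf_le_left : W ⟨_, h⟩ ≤ U) _ (hW ⟨_, h⟩) t
  refine h1.symm.trans (Eq.trans (congrArg _ (ht ⟨_, h⟩)) ?_)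
  rw [germ_res_apply]
  exact hs _

variable (X) in
/-- The structure sheaf as a sheaf of lattices in the function field. -/
def functionModel : LatticeModel (structureSheaf X) (FunField X) where
  η := genericPoint X.left
  generic := generic_mem
  toK U h := (toFF U h).toLinearMap
  toK_res h hU s := germ_res_apply h _ hU s
  toK_injective := toFF_injective
  lat x := (localRing x).toSubmodule
  toK_mem U h s _ hx := toFF_mem_localRing U h s hx
  exists_toK := exists_toFF
  lat_open x f hf := by
    obtain ⟨U, hx, s, rfl⟩ := exists_toFF_of_mem hf
    exact ⟨U, hx, fun y hy => toFF_mem_localRing U _ s hy⟩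

/-! ### Differential forms as lattices in the function field, through a derivation. -/

section Forms

variable (δ : Derivation k (FunField X) (FunField X))

/-- The linear map `f dg ↦ f δ(g)` on the differential forms of a local ring. -/
def contract (x : X.left) : Ω[X.left.presheaf.stalk x⁄k] →ₗ[k] FunField X :=
  (δ.liftKaehlerDifferential.restrictScalars k) ∘ₗ kaehlerMap (stalkToFF x)

theorem contract_D (x : X.left) (f : X.left.presheaf.stalk x) :
    contract δ x (KaehlerDifferential.D k _ f) = δ (stalkToFF x f) := by
  simp [contract, kaehlerMap_D]

theorem contract_smul (x : X.left) (f : X.left.presheaf.stalk x)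
    (ω : Ω[X.left.presheaf.stalk x⁄k]) :
    contract δ x (f • ω) = stalkToFF x f * contract δ x ω := by
  simp only [contract, LinearMap.comp_apply, kaehlerMap_smul, LinearMap.restrictScalars_apply,
    map_smul, smul_eq_mul]

/-- The linear map `f dg ↦ f δ(g)` on the differential forms of the ring of sections. -/
def contractSections (U : X.left.Opens) (h : genericPoint X.left ∈ U) :
    Ω[Γ(X.left, U)⁄k] →ₗ[k] FunField X :=
  (δ.liftKaehlerDifferential.restrictScalars k) ∘ₗ kaehlerMap (toFF U h)

theorem contract_germ (U : X.left.Opens) (x : X.left) (hx : x ∈ U) (η : Ω[Γ(X.left, U)⁄k]) :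
    contract δ x (kaehlerMap (germ U x hx) η) = contractSections δ U (generic_mem hx) η := by
  have h : (stalkToFF x).comp (germ U x hx) = toFF U (generic_mem hx) :=
    AlgHom.ext (stalkToFF_germ U x hx)
  rw [contract, LinearMap.comp_apply, ← kaehlerMap_comp, h]
  rfl

/-- `δ` is a coordinate on differential forms: locally, `Ω¹` is generated by a form `dw` with
`δ(w) ≠ 0`. -/
def IsFormCoordinate : Prop :=
  ∀ x : X.left, ∃ (U : X.left.Opens) (hx : x ∈ U) (w : Γ(X.left, U)),
    δ (toFF U (generic_mem hx) w) ≠ 0 ∧ ∀ (y : X.left) (hy : y ∈ U)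
      (ω : Ω[X.left.presheaf.stalk y⁄k]),
      ∃ a : X.left.presheaf.stalk y, ω = a • KaehlerDifferential.D k _ (germ U y hy w)

variable {δ} (hδ : IsFormCoordinate δ)
include hδ

/-- Each form at x is a dw, and its image a δ(w) determines a because δ(w) ≠ 0 in a field. -/
theorem IsFormCoordinate.contract_injective (x : X.left) : Function.Injective (contract δ x) := by
  obtain ⟨U, hx, w, hw, hU⟩ := hδ x
  rw [injective_iff_map_eq_zero]
  intro ω hω
  obtain ⟨a, rfl⟩ := hU x hx ω
  rw [contract_smul, contract_D, stalkToFF_germ] at hω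
  rw [(map_eq_zero_iff _ (stalkToFF_injective x)).mp ((mul_eq_zero.mp hω).resolve_right hw),
    zero_smul]

/-- A form a dw at x spreads out to a neighbourhood by lifting the germ a to a section. -/
theorem IsFormCoordinate.exists_contractSections {x : X.left}
    (ω : Ω[X.left.presheaf.stalk x⁄k]) : ∃ (U : X.left.Opens) (hx : x ∈ U) (η : Ω[Γ(X.left, U)⁄k]),
      kaehlerMap (germ U x hx) η = ω := by
  obtain ⟨U, hx, w, hw, hU⟩ := hδ x
  obtain ⟨a, rfl⟩ := hU x hx ω
  obtain ⟨V, hxV, s, rfl⟩ := exists_germ x a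
  have hxW : x ∈ U ⊓ V := ⟨hx, hxV⟩
  refine ⟨U ⊓ V, hxW, resFun (inf_le_right : U ⊓ V ≤ V) s •
    KaehlerDifferential.D k _ (resFun (inf_le_left : U ⊓ V ≤ U) w), ?_⟩
  rw [kaehlerMap_smul, kaehlerMap_D, germ_res_apply, germ_res_apply]

/-- The sheaf of differential forms as a sheaf of lattices in the function field. -/
def formsModel : LatticeModel (formsSheaf X) (FunField X) where
  η := genericPoint X.left
  generic := generic_mem
  toK U h := contract δ (genericPoint X.left) ∘ₗ
    { toFun := fun ω => ω.1 ⟨_, h⟩, map_add' := fun _ _ => rfl, map_smul' := fun _ _ => rfl }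
  toK_res _ _ _ := rfl
  toK_injective U h := by
    rw [injective_iff_map_eq_zero]
    intro ω hω
    refine Subtype.ext (funext fun x => ?_)
    apply hδ.contract_injective x.1
    obtain ⟨V, hxV, hV, η, hη⟩ := ω.2 x.1 x.2
    have h1 := hη _ (generic_mem hxV)
    have h2 := hη x.1 hxV
    refine (congrArg (contract δ x.1) h2).trans ?_
    refine Eq.trans ?_ (map_zero _).symm
    refine Eq.trans ?_ hω
    refine Eq.trans ?_ (congrArg (contract δ _) h1).symm
    rw [contract_germ, contract_germ]
  lat x := LinearMap.range (contract δ x)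
  toK_mem U h ω x hx := by
    obtain ⟨V, hxV, hV, η, hη⟩ := ω.2 x hx
    refine ⟨ω.1 ⟨x, hx⟩, ?_⟩
    refine (congrArg (contract δ x) (hη x hxV)).trans
      (Eq.trans ?_ (congrArg (contract δ _) (hη _ (generic_mem hxV))).symm)
    rw [contract_germ, contract_germ]
  exists_toK U h f hf := by
    choose ω hω using fun x : U => hf x.1 x.2
    refine ⟨⟨ω, fun x hx => ?_⟩, hω ⟨_, h⟩⟩
    obtain ⟨V, hxV, η, hη⟩ := hδ.exists_contractSections (ω ⟨x, hx⟩)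
    refine ⟨U ⊓ V, ⟨hx, hxV⟩, inf_le_left, kaehlerMap (resFun (inf_le_right : U ⊓ V ≤ V)) η,
      fun y hy => ?_⟩
    rw [← kaehlerMap_comp, germ_res]
    apply hδ.contract_injective y
    refine (hω ⟨y, inf_le_left (b := V) hy⟩).trans (Eq.trans ?_ (contract_germ δ V y hy.2 η).symm)
    rw [← contract_germ δ V x hxV, hη]
    exact (hω ⟨x, hx⟩).symm
  lat_open x f hf := by
    obtain ⟨ω, rfl⟩ := hf
    obtain ⟨V, hxV, η, rfl⟩ := hδ.exists_contractSections ω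
    refine ⟨V, hxV, fun y hy => ⟨kaehlerMap (germ V y hy) η, ?_⟩⟩
    rw [contract_germ, contract_germ]

/-- The embedding into the function field is defined at the generic point; this allows it to be read
off at any point of U. -/
theorem formsModel_toK (U : X.left.Opens) (h : genericPoint X.left ∈ U)
    (ω : (formsSheaf X).obj U) {x : X.left} (hx : x ∈ U) :
    (formsModel hδ).toK U h ω = contract δ x (ω.1 ⟨x, hx⟩) := by
  obtain ⟨V, hxV, hV, η, hη⟩ := ω.2 x hx
  refine (congrArg (contract δ _) (hη _ (generic_mem hxV))).trans
    (Eq.trans ?_ (congrArg (contract δ x) (hη x hxV)).symm)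
  rw [contract_germ, contract_germ]

end Forms

end KScheme

end

noncomputable section

/-! ## The affine algebras of the curve -/

namespace ASCurve

open Polynomial

/-- `R` is the `k`-algebra generated by two elements `a`, `b` subject to `b² = c (a ^ p - a)`. -/
structure IsASChart {k : Type u} [Field k] (p : ℕ) (c : k) {R : Type u} [CommRing R] [Algebra k R]
    (a b : R) : Prop where
  sq_eq : b ^ 2 = c • (a ^ p - a)
  adjoin_eq : Algebra.adjoin k {a, b} = ⊤
  exists_lift : ∀ (S : Type u) [CommRing S] [Algebra k S] (r s : S), s ^ 2 = c • (r ^ p - r) →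
    ∃ φ : R →ₐ[k] S, φ a = r ∧ φ b = s

namespace IsASChart

variable {k : Type u} [Field k] {p : ℕ} {c : k} {R : Type u} [CommRing R] [Algebra k R] {a b : R}
  (h : IsASChart p c a b)
include h

theorem exists_eq (r : R) : ∃ P Q : k[X], r = aeval a P + b * aeval a Q := by
  have hr : r ∈ Algebra.adjoin k {a, b} := h.adjoin_eq ▸ Algebra.mem_top
  induction hr using Algebra.adjoin_induction with
  | mem x hx =>
    rcases hx with rfl | rfl
    · exact ⟨X, 0, by simp⟩
    · exact ⟨0, 1, by simp⟩
  | algebraMap r => exact ⟨C r, 0, by simp⟩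
  | add x y _ _ hx hy =>
    obtain ⟨P, Q, rfl⟩ := hx
    obtain ⟨P', Q', rfl⟩ := hy
    exact ⟨P + P', Q + Q', by simp only [map_add]; ring⟩
  | mul x y _ _ hx hy =>
    obtain ⟨P, Q, rfl⟩ := hx
    obtain ⟨P', Q', rfl⟩ := hy
    refine ⟨P * P' + c • (X ^ p - X) * (Q * Q'), P * Q' + P' * Q, ?_⟩
    simp only [map_add, map_mul, map_smul, map_sub, map_pow, aeval_X, ← h.sq_eq]
    ring

theorem algHom_ext {S : Type*} [Semiring S] [Algebra k S] {φ ψ : R →ₐ[k] S} (ha : φ a = ψ a)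
    (hb : φ b = ψ b) : φ = ψ := by
  refine AlgHom.ext_of_adjoin_eq_top h.adjoin_eq fun x hx => ?_
  rcases hx with rfl | rfl
  exacts [ha, hb]

variable (hp : Odd p) (hp2 : 2 < p) (hc : c ≠ 0)
include hp hp2 hc

omit h in
-- Parity of degrees: if Q ≠ 0, the left side has even degree and the right side has degree p + 2
-- deg Q, which is odd.
theorem sq_ne_mul_sq {P Q : k[X]} (hPQ : P ^ 2 = c • (X ^ p - X) * Q ^ 2) : P = 0 ∧ Q = 0 := by
  have hdeg : (c • (X ^ p - X : k[X])).natDegree = p := by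
    rw [natDegree_smul _ hc, natDegree_sub_eq_left_of_natDegree_lt] <;> (simp; try omega)
  have hne : c • (X ^ p - X : k[X]) ≠ 0 := by
    intro h0
    rw [h0, natDegree_zero] at hdeg
    omega
  by_cases hQ : Q = 0
  · subst hQ
    exact ⟨by simpa using hPQ, rfl⟩
  · exfalso
    have := congrArg natDegree hPQ
    rw [natDegree_pow, natDegree_mul hne (pow_ne_zero _ hQ), natDegree_pow, hdeg] at this
    obtain ⟨m, rfl⟩ := hp
    omega

/-- Send a to a transcendental t and b to a square root of c(t^p - t) in an algebraic closure of
k(t). A relation P(t) + s Q(t) = 0 would give P² = c(X^p - X)Q², excluded by parity. This yields at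
once that R is a domain and that 1, b are independent over k[a]. -/
theorem exists_field : ∃ (L : Type u) (_ : Field L) (_ : Algebra k L) (φ : R →ₐ[k] L),
    Function.Injective φ ∧ ∀ P Q : k[X], φ (aeval a P + b * aeval a Q) = 0 → P = 0 ∧ Q = 0 := by
  let L := AlgebraicClosure (RatFunc k)
  let t : L := algebraMap (RatFunc k) L RatFunc.X
  have hinj : Function.Injective (aeval t : k[X] →ₐ[k] L) := by
    have h1 : (aeval t : k[X] →ₐ[k] L) = (IsScalarTower.toAlgHom k (RatFunc k) L).comp
        (IsScalarTower.toAlgHom k k[X] (RatFunc k)) := by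
      apply Polynomial.algHom_ext
      simp [t]
    rw [h1]
    exact (algebraMap (RatFunc k) L).injective.comp (IsFractionRing.injective k[X] (RatFunc k))
  obtain ⟨s, hs⟩ := IsAlgClosed.exists_pow_nat_eq (c • (t ^ p - t)) (n := 2) (by norm_num)
  obtain ⟨φ, hφa, hφb⟩ := h.exists_lift L t s hs
  have key : ∀ P Q : k[X], φ (aeval a P + b * aeval a Q) = 0 → P = 0 ∧ Q = 0 := by
    intro P Q h0
    rw [map_add, map_mul, ← aeval_algHom_apply, ← aeval_algHom_apply, hφa, hφb] at h0
    apply sq_ne_mul_sq hp hp2 hc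
    apply hinj
    simp only [map_pow, map_mul, map_smul, map_sub, aeval_X, ← hs]
    rw [eq_neg_of_add_eq_zero_left h0]
    ring
  refine ⟨L, inferInstance, inferInstance, φ, ?_, key⟩
  rw [injective_iff_map_eq_zero]
  intro r hr
  obtain ⟨P, Q, rfl⟩ := h.exists_eq r
  obtain ⟨rfl, rfl⟩ := key P Q hr
  simp

theorem isDomain : IsDomain R := by
  obtain ⟨L, _, _, φ, hφ, -⟩ := h.exists_field hp hp2 hc
  exact hφ.isDomain φ.toRingHom

theorem eq_zero_of_eq_zero {P Q : k[X]} (h0 : aeval a P + b * aeval a Q = 0) : P = 0 ∧ Q = 0 := by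
  obtain ⟨L, _, _, φ, -, hφ⟩ := h.exists_field hp hp2 hc
  exact hφ P Q (by rw [h0, map_zero])

end IsASChart

section Derivation

variable {k : Type u} [Field k] {p : ℕ} {R : Type u} [CommRing R] [Algebra k R] {a b : R}

/-- A derivation of K is the ε-part of a lift of the identity to the dual numbers K[ε]. The
assignment a ↦ a - 2bε, b ↦ b + ε respects b² = a^p - a since (a - 2bε)^p = a^p in characteristic p.
Elements with nonzero K-part are units of K[ε], so the map extends from R to its fraction field. -/
theorem IsASChart.exists_derivation [CharP k p] [Fact p.Prime] (h : IsASChart p (1 : k) a b)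
    (hp2 : 2 < p) (K : Type u) [Field K]
    [Algebra k K] [Algebra R K] [IsScalarTower k R K] [IsFractionRing R K] :
    ∃ δ : Derivation k K K, δ (algebraMap R K b) = 1 ∧
      δ (algebraMap R K a) = -2 * algebraMap R K b := by
  have hp : p.Prime := Fact.out
  have : IsDomain R := h.isDomain (hp.odd_of_ne_two hp2.ne') hp2 one_ne_zero
  have : CharP K p := (Algebra.charP_iff k K p).mp inferInstance
  let a' : TrivSqZeroExt K K := (algebraMap R K a, -2 * algebraMap R K b)
  let b' : TrivSqZeroExt K K := (algebraMap R K b, 1)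
  have hsq := congrArg (algebraMap R K) h.sq_eq
  rw [one_smul, map_pow, map_sub, map_pow] at hsq
  have hb' : b' ^ 2 = (1 : k) • (a' ^ p - a') := by
    rw [one_smul]
    apply TrivSqZeroExt.ext
    · rw [TrivSqZeroExt.fst_sub, TrivSqZeroExt.fst_pow, TrivSqZeroExt.fst_pow]
      exact hsq
    · rw [TrivSqZeroExt.snd_sub, TrivSqZeroExt.snd_pow, TrivSqZeroExt.snd_pow, ← Nat.cast_smul_eq_nsmul K p,
        CharP.cast_eq_zero, zero_smul, zero_sub]
      change 2 • ((algebraMap R K b) ^ (2 - 1) • (1 : K)) = -(-2 * algebraMap R K b)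
      simp
  obtain ⟨φ, hφa, hφb⟩ := h.exists_lift _ a' b' hb'
  have hfst : ∀ r, (φ r).fst = algebraMap R K r := by
    have : (TrivSqZeroExt.fstHom k K K).comp φ = IsScalarTower.toAlgHom k R K := by
      apply h.algHom_ext
      · exact congrArg TrivSqZeroExt.fst hφa
      · exact congrArg TrivSqZeroExt.fst hφb
    exact AlgHom.congr_fun this
  have hunit : ∀ y : nonZeroDivisors R, IsUnit (φ y) := by
    intro y
    rw [TrivSqZeroExt.isUnit_iff_isUnit_fst, hfst]
    exact IsLocalization.map_units K y
  let Φ : K →ₐ[k] TrivSqZeroExt K K :=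
    IsLocalization.liftAlgHom (M := nonZeroDivisors R) (f := φ) hunit
  have hΦ : ∀ r, Φ (algebraMap R K r) = φ r := fun r => IsLocalization.lift_eq _ r
  have hΦfst : ∀ f, (Φ f).fst = f := by
    have : (TrivSqZeroExt.fstHom k K K).comp Φ = AlgHom.id k K := by
      apply IsLocalization.algHom_ext (nonZeroDivisors R)
      refine AlgHom.ext fun r => ?_
      exact (congrArg TrivSqZeroExt.fst (hΦ r)).trans (hfst r)
    exact AlgHom.congr_fun this
  let δ : Derivation k K K :=
    Derivation.mk' ((TrivSqZeroExt.sndHom K K).restrictScalars k ∘ₗ Φ.toLinearMap) (by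
      intro f g
      change (Φ (f * g)).snd = f * (Φ g).snd + g * (Φ f).snd
      rw [map_mul, TrivSqZeroExt.snd_mul, hΦfst, hΦfst, smul_eq_mul, MulOpposite.smul_eq_mul_unop,
        MulOpposite.unop_op, mul_comm (Φ f).snd])
  exact ⟨δ, congrArg TrivSqZeroExt.snd ((hΦ b).trans hφb),
    congrArg TrivSqZeroExt.snd ((hΦ a).trans hφa)⟩

end Derivation

end ASCurve

end

noncomputable section

/-! ## Approximation on affine open subsets -/

namespace KScheme

open CechCohomology

section Affine

variable {k : Type u} [Field k] {X : Over (Spec (CommRingCat.of k))} [IsIntegral X.left]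

theorem toFF_inv_mem {U : X.left.Opens} (h : genericPoint X.left ∈ U) (s : Γ(X.left, U))
    {x : X.left} (hx : x ∈ X.left.basicOpen s) : (toFF U h s)⁻¹ ∈ localRing x := by
  have hxU : x ∈ U := X.left.basicOpen_le s hx
  obtain ⟨t, ht⟩ := ((X.left.mem_basicOpen s x hxU).mp hx).exists_right_inv
  refine ⟨t, ?_⟩
  have h1 : stalkToFF x (germ U x hxU s * t) = 1 := (congrArg (stalkToFF x) ht).trans (map_one _)
  rw [map_mul, stalkToFF_germ] at h1
  exact (inv_eq_of_mul_eq_one_right h1).symm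

theorem exists_toFF_pow_mul {U : X.left.Opens} (hU : IsAffineOpen U)
    (h : genericPoint X.left ∈ U) (s : Γ(X.left, U)) {x : X.left} (hx : x ∈ X.left.basicOpen s)
    {f : FunField X} (hf : ∀ y ∈ X.left.basicOpen s, f ∈ localRing y) :
    ∃ (n : ℕ) (t : Γ(X.left, U)), toFF U h t = toFF U h s ^ n * f := by
  have hη := generic_mem hx
  obtain ⟨g, rfl⟩ := exists_toFF _ hη f hf
  obtain ⟨n, t, ht⟩ := exists_eq_pow_mul_of_isAffineOpen X.left U hU s g
  refine ⟨n, t, ?_⟩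
  have h1 := congrArg (toFF (X.left.basicOpen s) hη) ht
  rw [map_mul, map_pow] at h1
  refine (germ_res_apply (X.left.basicOpen_le s) _ hη t).symm.trans (h1.trans ?_)
  congr 2
  exact germ_res_apply (X.left.basicOpen_le s) _ hη s

/-- Adeles with values in an invertible sheaf that is trivial on an affine open subset can be
approximated there by elements of the function field. -/
theorem splits_of_isAffineOpen {F : ModPresheaf k X.left} (M : LatticeModel F (FunField X))
    {U : X.left.Opens} (hU : IsAffineOpen U) (hη : genericPoint X.left ∈ U) (g : FunField X)
    (hM : ∀ x ∈ U, ∀ f, f ∈ M.lat x ↔ g * f ∈ localRing x) : M.Splits U := by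
  classical
  rintro b ⟨N, hN⟩
  choose f hfN hf using fun z : U =>
    hU.exists_basicOpen_le (V := N.nhd z.1 ⊓ U) ⟨z.1, N.mem z.1, z.2⟩ z.2
  obtain ⟨t, ht⟩ := hU.isCompact.elim_finite_subcover
    (fun z : U => (X.left.basicOpen (f z) : Set X.left)) (fun z => (X.left.basicOpen (f z)).isOpen)
    (fun x hx => Set.mem_iUnion.mpr ⟨⟨x, hx⟩, hf ⟨x, hx⟩⟩)
  have hcov : ∀ x ∈ U, ∃ w ∈ t, x ∈ X.left.basicOpen (f w) := by
    intro x hx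
    simpa using! ht hx
  have hspan : Ideal.span (Set.range fun z : t => f z.1) = ⊤ := by
    rw [← hU.self_le_iSup_basicOpen_iff]
    intro x hx
    obtain ⟨w, hw, hxw⟩ := hcov x hx
    exact Opens.mem_iSup.mpr ⟨⟨_, ⟨w, hw⟩, rfl⟩, hxw⟩
  -- On D(f_z f_w) the function g(b_w - b_z) is regular, so some power of f_z f_w, and every higher
  -- one, makes it regular on all of U.
  have hdiff : ∀ z w : U, ∃ n : ℕ, ∀ m ≥ n, ∃ s, toFF U hη s =
      toFF U hη (f z) ^ m * toFF U hη (f w) ^ m * (g * (b w - b z)) := by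
    intro z w
    have hη' : genericPoint X.left ∈ X.left.basicOpen (f z * f w) := by
      rw [Scheme.basicOpen_mul]
      exact ⟨generic_mem (hf z), generic_mem (hf w)⟩
    obtain ⟨n, s, hs⟩ := exists_toFF_pow_mul hU hη (f z * f w) hη' (f := g * (b w - b z)) (by
      intro y hy
      rw [Scheme.basicOpen_mul] at hy
      rw [← hM y (X.left.basicOpen_le _ hy.1)]
      exact hN z w y ⟨(hfN z hy.1).1, (hfN w hy.2).1⟩)
    refine ⟨n, fun m hm => ⟨(f z * f w) ^ (m - n) * s, ?_⟩⟩
    rw [map_mul, map_pow, hs, ← mul_assoc, ← pow_add, Nat.sub_add_cancel hm, map_mul, mul_pow]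
  choose n hn using hdiff
  -- The sum dominates each of the finitely many exponents, so one exponent serves for all pairs.
  let m := ∑ z ∈ t, ∑ w ∈ t, n z w
  have hm : ∀ z ∈ t, ∀ w ∈ t, n z w ≤ m := fun z hz w hw =>
    (Finset.single_le_sum (f := fun w => n z w) (fun _ _ => Nat.zero_le _) hw).trans
      (Finset.single_le_sum (f := fun z => ∑ w ∈ t, n z w) (fun _ _ => Nat.zero_le _) hz)
  -- The powers f_z^m still generate the unit ideal: 1 = Σ c_z f_z^m. The approximation is the
  -- average Σ c_z f_z^m b_z. On D(f_w) it differs from b_w by Σ c_z f_z^m (b_w - b_z), and g times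
  -- this is regular there because f_w is invertible.
  have hspan' := Ideal.span_pow_eq_top _ hspan m
  rw [← Set.range_comp, Ideal.eq_top_iff_one, Ideal.mem_span_range_iff_exists_fun] at hspan'
  obtain ⟨c, hc⟩ := hspan'
  have hc' : ∑ z : t, toFF U hη (c z) * toFF U hη (f z.1) ^ m = 1 := by
    simpa using congrArg (toFF U hη) hc
  refine ⟨∑ z : t, toFF U hη (c z) * toFF U hη (f z.1) ^ m * b z.1, fun x hx => ?_⟩
  obtain ⟨w, hw, hxw⟩ := hcov x hx
  have h1 : b x - b w ∈ M.lat x := hN w x x ⟨(hfN w hxw).1, N.mem x⟩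
  have h2 : b w - ∑ z : t, toFF U hη (c z) * toFF U hη (f z.1) ^ m * b z.1 ∈ M.lat x := by
    rw [hM x hx]
    have h3 : g * (b w - ∑ z : t, toFF U hη (c z) * toFF U hη (f z.1) ^ m * b z.1) =
        ∑ z : t, (toFF U hη (f w))⁻¹ ^ m * (toFF U hη (c z) *
          (toFF U hη (f z.1) ^ m * toFF U hη (f w) ^ m * (g * (b w - b z.1)))) := by
      have hne : toFF U hη (f w) ≠ 0 := by
        intro h0
        have := toFF_injective U hη (h0.trans (map_zero _).symm)
        rw [this, Scheme.basicOpen_zero] at hxw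
        exact hxw
      calc _ = g * ((∑ z : t, toFF U hη (c z) * toFF U hη (f z.1) ^ m) * b w -
            ∑ z : t, toFF U hη (c z) * toFF U hη (f z.1) ^ m * b z.1) := by rw [hc', one_mul]
        _ = ∑ z : t, g * (toFF U hη (c z) * toFF U hη (f z.1) ^ m * (b w - b z.1)) := by
          rw [Finset.sum_mul, ← Finset.sum_sub_distrib, Finset.mul_sum]
          exact Finset.sum_congr rfl fun z _ => by ring
        _ = _ := Finset.sum_congr rfl fun z _ => by
          rw [inv_pow]
          field_simp
    rw [h3]
    refine sum_mem fun z _ => mul_mem (pow_mem (toFF_inv_mem hη _ hxw) _)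
      (mul_mem (toFF_mem_localRing U hη _ hx) ?_)
    obtain ⟨s, hs⟩ := hn z.1 w m (hm z.1 z.2 w hw)
    rw [← hs]
    exact toFF_mem_localRing U hη s hx
  have := add_mem h1 h2
  rwa [sub_add_sub_cancel] at this

end Affine

end KScheme

/-- A scheme covered by two affine open subsets with integral coordinate rings and nonempty
intersection is integral. -/
theorem isIntegral_of_two_affine_opens {X : Scheme.{u}} {U V : X.Opens} (hU : IsAffineOpen U)
    (hV : IsAffineOpen V) [IsDomain Γ(X, U)] [IsDomain Γ(X, V)] (hUV : U ⊔ V = ⊤)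
    (hne : ∃ x, x ∈ U ⊓ V) : IsIntegral X := by
  have hirr : ∀ W : X.Opens, IsAffineOpen W → IsDomain Γ(X, W) → IsIrreducible (W : Set X) := by
    intro W hW _
    rw [← hW.range_fromSpec, ← Set.image_univ]
    exact (IrreducibleSpace.isIrreducible_univ (PrimeSpectrum Γ(X, W))).image _
      hW.fromSpec.continuous.continuousOn
  have hcov : ∀ x : X, x ∈ U ∨ x ∈ V := fun x => show x ∈ U ⊔ V from hUV ▸ trivial
  obtain ⟨q, hqU, hqV⟩ := hne
  -- U is dense: an open set meeting the irreducible V meets the nonempty open subset U ∩ V of V as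
  -- well.
  have hmeet : ∀ W : Set X, IsOpen W → W.Nonempty → ((U : Set X) ∩ W).Nonempty := by
    rintro W hW ⟨w, hw⟩
    rcases hcov w with h | h
    · exact ⟨w, h, hw⟩
    · obtain ⟨z, -, h1, h2⟩ := (hirr V hV inferInstance).2 U W U.isOpen hW ⟨q, hqV, hqU⟩ ⟨w, h, hw⟩
      exact ⟨z, h1, h2⟩
  have : PreirreducibleSpace X := ⟨fun W W' hW hW' ⟨w, _, hw⟩ ⟨w', _, hw'⟩ => by
    obtain ⟨z, -, h1⟩ := (hirr U hU inferInstance).2 W W' hW hW' (hmeet W hW ⟨w, hw⟩)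
      (hmeet W' hW' ⟨w', hw'⟩)
    exact ⟨z, trivial, h1⟩⟩
  have : IrreducibleSpace X := { toNonempty := ⟨q⟩ }
  have hst : ∀ (W : X.Opens) (_ : IsAffineOpen W) (_ : IsDomain Γ(X, W)) (x : X) (_ : x ∈ W),
      IsDomain (X.presheaf.stalk x) := by
    intro W hW _ x hx
    let _ := TopCat.Presheaf.algebra_section_stalk X.presheaf (⟨x, hx⟩ : W)
    have := hW.isLocalization_stalk ⟨x, hx⟩
    exact IsLocalization.isDomain_of_atPrime _ (hW.primeIdealOf ⟨x, hx⟩).asIdeal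
  have (x : X) : _root_.IsReduced (X.presheaf.stalk x) := by
    have : IsDomain (X.presheaf.stalk x) := by
      rcases hcov x with h | h
      exacts [hst U hU inferInstance x h, hst V hV inferInstance x h]
    infer_instance
  have := isReduced_of_isReduced_stalk X
  exact isIntegral_of_irreducibleSpace_of_isReduced X

end

noncomputable section

/-! ## The curve as the union of two affine charts -/

namespace ASCurve

open CechCohomology KScheme Polynomial

variable {k : Type u} [Field k]

/-- Two affine charts `y² = x ^ p - x` and `v² = u - u ^ p` of a `k`-scheme, glued along
`u = x⁻¹`, `v = y x ^ (-(m + 1))`, for `p = 2 m + 1`. -/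
structure Charts (X : Over (Spec (CommRingCat.of k))) (p m : ℕ) where
  p_eq : p = 2 * m + 1
  m_pos : 0 < m
  U : X.left.Opens
  V : X.left.Opens
  affine_U : IsAffineOpen U
  affine_V : IsAffineOpen V
  sup_eq : U ⊔ V = ⊤
  x : Γ(X.left, U)
  y : Γ(X.left, U)
  u : Γ(X.left, V)
  v : Γ(X.left, V)
  chart_U : IsASChart p (1 : k) x y
  chart_V : IsASChart p (-1 : k) u v
  basicOpen_x : X.left.basicOpen x = U ⊓ V
  basicOpen_u : X.left.basicOpen u = U ⊓ V
  x_mul_u : resFun (inf_le_left : U ⊓ V ≤ U) x * resFun (inf_le_right : U ⊓ V ≤ V) u = 1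
  y_eq : resFun (inf_le_left : U ⊓ V ≤ U) y = resFun (inf_le_right : U ⊓ V ≤ V) v *
    resFun (inf_le_left : U ⊓ V ≤ U) x ^ (m + 1)

namespace Charts

variable {X : Over (Spec (CommRingCat.of k))} {p m : ℕ} (D : Charts X p m)
include D

theorem odd_p : Odd p := ⟨m, D.p_eq⟩

theorem two_lt_p : 2 < p := by have := D.p_eq; have := D.m_pos; omega

theorem isDomain_U : IsDomain Γ(X.left, D.U) :=
  D.chart_U.isDomain D.odd_p D.two_lt_p one_ne_zero

theorem isDomain_V : IsDomain Γ(X.left, D.V) :=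
  D.chart_V.isDomain D.odd_p D.two_lt_p (neg_ne_zero.mpr one_ne_zero)

/-- If D(x) = U ∩ V were empty, x would be nilpotent, hence zero in a domain, whereas x satisfies no
polynomial relation over k. -/
theorem exists_mem_inf : ∃ q, q ∈ D.U ⊓ D.V := by
  by_contra! hne
  have h0 : X.left.basicOpen D.x = ⊥ := by
    rw [D.basicOpen_x]
    exact eq_bot_iff.mpr fun q hq => (hne q hq).elim
  rw [← Scheme.isNilpotent_iff_basicOpen_eq_bot_of_isCompact D.affine_U.isCompact] at h0
  have := D.isDomain_U
  have h1 := D.chart_U.eq_zero_of_eq_zero D.odd_p D.two_lt_p one_ne_zero (P := Polynomial.X) (Q := 0)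
    (by simpa using h0.eq_zero)
  exact Polynomial.X_ne_zero h1.1

theorem isIntegral : AlgebraicGeometry.IsIntegral X.left :=
  have := D.isDomain_U
  have := D.isDomain_V
  isIntegral_of_two_affine_opens D.affine_U D.affine_V D.sup_eq D.exists_mem_inf

theorem mem_or_mem (q : X.left) : q ∈ D.U ∨ q ∈ D.V :=
  show q ∈ D.U ⊔ D.V from D.sup_eq ▸ trivial

section FunctionField

variable [AlgebraicGeometry.IsIntegral X.left]

theorem mem_U : genericPoint X.left ∈ D.U :=
  let ⟨_, h⟩ := D.exists_mem_inf
  generic_mem h.1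

theorem mem_V : genericPoint X.left ∈ D.V :=
  let ⟨_, h⟩ := D.exists_mem_inf
  generic_mem h.2

theorem mem_inf : genericPoint X.left ∈ D.U ⊓ D.V := ⟨D.mem_U, D.mem_V⟩

/-- The coordinate `x` as a rational function. -/
def xF : FunField X := toFF D.U D.mem_U D.x

/-- The coordinate `y` as a rational function. -/
def yF : FunField X := toFF D.U D.mem_U D.y

theorem yF_sq : D.yF ^ 2 = D.xF ^ p - D.xF := by
  have := congrArg (toFF D.U D.mem_U) D.chart_U.sq_eq
  rwa [one_smul, map_pow, map_sub, map_pow] at this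

theorem xF_mul_u : D.xF * toFF D.V D.mem_V D.u = 1 := by
  have := congrArg (toFF (D.U ⊓ D.V) D.mem_inf) D.x_mul_u
  rw [map_mul, map_one] at this
  refine Eq.trans ?_ this
  congr 1
  · exact (germ_res_apply inf_le_left _ D.mem_inf D.x).symm
  · exact (germ_res_apply inf_le_right _ D.mem_inf D.u).symm

theorem xF_ne_zero : D.xF ≠ 0 := left_ne_zero_of_mul_eq_one D.xF_mul_u

theorem toFF_u : toFF D.V D.mem_V D.u = D.xF⁻¹ := eq_inv_of_mul_eq_one_right D.xF_mul_u

theorem yF_eq : D.yF = toFF D.V D.mem_V D.v * D.xF ^ (m + 1) := by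
  have := congrArg (toFF (D.U ⊓ D.V) D.mem_inf) D.y_eq
  rw [map_mul, map_pow] at this
  refine ((germ_res_apply inf_le_left _ D.mem_inf D.y).symm.trans this).trans ?_
  congr 1
  · exact germ_res_apply inf_le_right _ D.mem_inf D.v
  · exact congrArg (· ^ (m + 1)) (germ_res_apply inf_le_left _ D.mem_inf D.x)

theorem toFF_v : toFF D.V D.mem_V D.v = D.yF * D.xF⁻¹ ^ (m + 1) := by
  rw [D.yF_eq, mul_assoc, ← mul_pow, mul_inv_cancel₀ D.xF_ne_zero, one_pow, mul_one]

theorem xF_mem {q : X.left} (hq : q ∈ D.U) : D.xF ∈ localRing q := toFF_mem_localRing _ _ _ hq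

theorem yF_mem {q : X.left} (hq : q ∈ D.U) : D.yF ∈ localRing q := toFF_mem_localRing _ _ _ hq

theorem xF_inv_mem {q : X.left} (hq : q ∈ D.V) : D.xF⁻¹ ∈ localRing q :=
  D.toFF_u ▸ toFF_mem_localRing _ _ _ hq

theorem v_mem {q : X.left} (hq : q ∈ D.V) : D.yF * D.xF⁻¹ ^ (m + 1) ∈ localRing q :=
  D.toFF_v ▸ toFF_mem_localRing _ _ _ hq

theorem xF_zpow_mem {q : X.left} (hq : q ∈ D.U ⊓ D.V) (i : ℤ) : D.xF ^ i ∈ localRing q := by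
  rcases i with i | i
  · rw [Int.ofNat_eq_natCast, zpow_natCast]
    exact pow_mem (D.xF_mem hq.1) _
  · rw [zpow_negSucc, ← inv_pow]
    exact pow_mem (D.xF_inv_mem hq.2) _

/-- The monomials `x ^ i` and `y x ^ i`, for all integers `i`. -/
def monomials : ℤ ⊕ ℤ → FunField X :=
  Sum.elim (fun i => D.xF ^ i) (fun i => D.yF * D.xF ^ i)

/-- Multiplication by a large power of x turns a relation between the monomials into P(x) + y Q(x) =
0 with polynomials P, Q, which must vanish. -/
theorem linearIndependent_monomials : LinearIndependent k D.monomials := by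
  classical
  rw [linearIndependent_iff]
  intro l hl
  let deg : ℤ ⊕ ℤ → ℤ := Sum.elim id id
  -- N bounds the absolute values of all exponents that occur, so x^N clears every negative power.
  let N : ℕ := ∑ j ∈ l.support, (deg j).natAbs
  have hN : ∀ j ∈ l.support, 0 ≤ deg j + N := by
    intro j hj
    have : (deg j).natAbs ≤ N :=
      Finset.single_le_sum (f := fun j => (deg j).natAbs) (fun _ _ => Nat.zero_le _) hj
    omega
  let f : ℤ ⊕ ℤ → k[X] := Sum.elim (fun i => monomial (i + N).toNat (l (.inl i))) 0
  let g : ℤ ⊕ ℤ → k[X] := Sum.elim 0 (fun i => monomial (i + N).toNat (l (.inr i)))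
  have key : aeval D.x (∑ j ∈ l.support, f j) + D.y * aeval D.x (∑ j ∈ l.support, g j) = 0 := by
    apply toFF_injective D.U D.mem_U
    rw [map_zero, map_add, map_mul, ← aeval_algHom_apply, ← aeval_algHom_apply]
    change aeval D.xF _ + D.yF * aeval D.xF _ = 0
    have h0 : D.xF ^ (N : ℤ) * Finsupp.linearCombination k D.monomials l = 0 := by rw [hl, mul_zero]
    rw [Finsupp.linearCombination_apply, Finsupp.sum, Finset.mul_sum] at h0
    rw [map_sum, map_sum, Finset.mul_sum, ← Finset.sum_add_distrib, ← h0]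
    refine Finset.sum_congr rfl fun j hj => ?_
    have hj := hN j hj
    have hx := D.xF_ne_zero
    rcases j with i | i <;> simp only [deg, Sum.elim_inl, Sum.elim_inr, id] at hj <;>
      simp only [f, g, Sum.elim_inl, Sum.elim_inr, aeval_monomial, Pi.zero_apply, map_zero,
        mul_zero, add_zero, zero_add, monomials, Algebra.smul_def] <;>
      rw [← zpow_natCast D.xF (i + N).toNat, Int.toNat_of_nonneg hj, zpow_add₀ hx] <;> ring
  obtain ⟨h1, h2⟩ := D.chart_U.eq_zero_of_eq_zero D.odd_p D.two_lt_p one_ne_zero key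
  ext j
  rw [Finsupp.coe_zero, Pi.zero_apply]
  by_contra hne
  have hj : j ∈ l.support := Finsupp.mem_support_iff.mpr hne
  apply hne
  rcases j with i | i
  · have h3 := congrArg (fun P => coeff P (i + N).toNat) h1
    simp only [finsetSum_coeff, coeff_zero] at h3
    rw [Finset.sum_eq_single_of_mem _ hj] at h3
    · simpa [f] using h3
    · rintro (i' | i') hj' hne'
      · have h4 := hN _ hj
        have h5 := hN _ hj'
        simp only [deg, Sum.elim_inl, id] at h4 h5
        have : i' ≠ i := fun h => hne' (by rw [h])
        simp only [f, Sum.elim_inl, coeff_monomial]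
        rw [if_neg (by omega)]
      · simp [f]
  · have h3 := congrArg (fun P => coeff P (i + N).toNat) h2
    simp only [finsetSum_coeff, coeff_zero] at h3
    rw [Finset.sum_eq_single_of_mem _ hj] at h3
    · simpa [g] using h3
    · rintro (i' | i') hj' hne'
      · simp [g]
      · have h4 := hN _ hj
        have h5 := hN _ hj'
        simp only [deg, Sum.elim_inr, id] at h4 h5
        have : i' ≠ i := fun h => hne' (by rw [h])
        simp only [g, Sum.elim_inr, coeff_monomial]
        rw [if_neg (by omega)]

/-- The span of a set of monomials. -/
def band (S : Set (ℤ ⊕ ℤ)) : Submodule k (FunField X) := Submodule.span k (D.monomials '' S)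

theorem linearCombination_mem_band {S : Set (ℤ ⊕ ℤ)} {l : ℤ ⊕ ℤ →₀ k} :
    Finsupp.linearCombination k D.monomials l ∈ D.band S ↔ l ∈ Finsupp.supported k k S := by
  rw [band, Finsupp.mem_span_image_iff_linearCombination]
  refine ⟨?_, fun h => ⟨l, h, rfl⟩⟩
  rintro ⟨l', h, hl⟩
  rwa [D.linearIndependent_monomials hl] at h

theorem exists_of_mem_band {S : Set (ℤ ⊕ ℤ)} {f : FunField X} (hf : f ∈ D.band S) :
    ∃ l ∈ Finsupp.supported k k S, Finsupp.linearCombination k D.monomials l = f := by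
  rwa [band, Finsupp.mem_span_image_iff_linearCombination] at hf

theorem band_sup (S S' : Set (ℤ ⊕ ℤ)) : D.band S ⊔ D.band S' = D.band (S ∪ S') := by
  rw [band, band, band, Set.image_union, Submodule.span_union]

theorem zpow_mul_monomials (a : ℤ) (j : ℤ ⊕ ℤ) :
    D.xF ^ a * D.monomials j = D.monomials (Sum.map (a + ·) (a + ·) j) := by
  rcases j with i | i <;>
    simp only [monomials, Sum.elim_inl, Sum.elim_inr, Sum.map_inl, Sum.map_inr,
      zpow_add₀ D.xF_ne_zero]
  ring

theorem zpow_mul_linearCombination (a : ℤ) (l : ℤ ⊕ ℤ →₀ k) :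
    D.xF ^ a * Finsupp.linearCombination k D.monomials l =
      Finsupp.linearCombination k D.monomials (l.mapDomain (Sum.map (a + ·) (a + ·))) := by
  rw [Finsupp.linearCombination_mapDomain, Finsupp.linearCombination_apply,
    Finsupp.linearCombination_apply, Finsupp.mul_sum]
  refine Finsupp.sum_congr fun j _ => ?_
  rw [Function.comp_apply, ← D.zpow_mul_monomials, mul_smul_comm]

theorem zpow_mul_mem_band {a : ℤ} {S S' : Set (ℤ ⊕ ℤ)}
    (h : ∀ j ∈ S, Sum.map (a + ·) (a + ·) j ∈ S') {f : FunField X} (hf : f ∈ D.band S) :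
    D.xF ^ a * f ∈ D.band S' := by
  induction hf using Submodule.span_induction with
  | mem f hf =>
    obtain ⟨j, hj, rfl⟩ := hf
    rw [D.zpow_mul_monomials]
    exact Submodule.subset_span ⟨_, h j hj, rfl⟩
  | zero => rw [mul_zero]; exact zero_mem _
  | add f g _ _ hf hg => rw [mul_add]; exact add_mem hf hg
  | smul r f _ hf => rw [mul_smul_comm]; exact Submodule.smul_mem _ _ hf

omit D in
/-- The exponents of the monomials that are regular on the first chart. -/
def highSet : Set (ℤ ⊕ ℤ) := Sum.elim (fun i => 0 ≤ i) (fun i => 0 ≤ i)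

omit D in
/-- The exponents of the monomials `f` such that `x ^ (-n) f` is regular on the second chart. -/
def lowSet (m : ℕ) (n : ℤ) : Set (ℤ ⊕ ℤ) :=
  Sum.elim (fun i => i ≤ n) (fun i => i ≤ n - (m + 1))

theorem forall_mem_U_iff (f : FunField X) :
    (∀ q ∈ D.U, f ∈ localRing q) ↔ f ∈ D.band highSet := by
  constructor
  · intro hf
    obtain ⟨s, rfl⟩ := exists_toFF D.U D.mem_U f hf
    obtain ⟨P, Q, rfl⟩ := D.chart_U.exists_eq s
    rw [map_add, map_mul, ← aeval_algHom_apply, ← aeval_algHom_apply]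
    change aeval D.xF P + D.yF * aeval D.xF Q ∈ _
    rw [aeval_eq_sum_range, aeval_eq_sum_range, Finset.mul_sum]
    refine add_mem (sum_mem fun i _ => Submodule.smul_mem _ _ (Submodule.subset_span
      ⟨.inl i, Int.natCast_nonneg i, zpow_natCast _ _⟩)) (sum_mem fun i _ => ?_)
    rw [mul_smul_comm]
    refine Submodule.smul_mem _ _ (Submodule.subset_span ⟨.inr i, Int.natCast_nonneg i, ?_⟩)
    simp [monomials]
  · intro hf q hq
    have : D.band highSet ≤ (localRing q).toSubmodule := by
      rw [band, Submodule.span_le]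
      rintro _ ⟨i | i, hi, rfl⟩
      · obtain ⟨i, rfl⟩ := Int.eq_ofNat_of_zero_le hi
        change D.xF ^ (i : ℤ) ∈ localRing q
        rw [zpow_natCast]
        exact pow_mem (D.xF_mem hq) _
      · obtain ⟨i, rfl⟩ := Int.eq_ofNat_of_zero_le hi
        change D.yF * D.xF ^ (i : ℤ) ∈ localRing q
        rw [zpow_natCast]
        exact mul_mem (D.yF_mem hq) (pow_mem (D.xF_mem hq) _)
    exact this hf

/-- Functions on V are P(u) + v Q(u), and v u^i = y x^(-(m+1+i)); this is the source of the shift by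
m + 1 in `lowSet`. -/
theorem forall_mem_V_iff (f : FunField X) :
    (∀ q ∈ D.V, f ∈ localRing q) ↔ f ∈ D.band (lowSet m 0) := by
  constructor
  · intro hf
    obtain ⟨s, rfl⟩ := exists_toFF D.V D.mem_V f hf
    obtain ⟨P, Q, rfl⟩ := D.chart_V.exists_eq s
    rw [map_add, map_mul, ← aeval_algHom_apply, ← aeval_algHom_apply, D.toFF_u, D.toFF_v]
    rw [aeval_eq_sum_range, aeval_eq_sum_range, Finset.mul_sum]
    refine add_mem (sum_mem fun i _ => Submodule.smul_mem _ _ (Submodule.subset_span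
      ⟨.inl (-i), neg_nonpos.mpr (Int.natCast_nonneg i), ?_⟩)) (sum_mem fun i _ => ?_)
    · simp [monomials]
    · rw [mul_smul_comm]
      refine Submodule.smul_mem _ _ (Submodule.subset_span ⟨.inr (-(m + 1 + i : ℕ)), ?_, ?_⟩)
      · change (-(m + 1 + i : ℕ) : ℤ) ≤ 0 - (m + 1)
        push_cast; omega
      · simp only [monomials, Sum.elim_inr, zpow_neg, zpow_natCast, mul_assoc, pow_add, inv_pow, mul_inv]
  · intro hf q hq
    have : D.band (lowSet m 0) ≤ (localRing q).toSubmodule := by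
      rw [band, Submodule.span_le]
      rintro _ ⟨i | i, hi, rfl⟩
      · change i ≤ 0 at hi
        obtain ⟨i, rfl⟩ := Int.exists_eq_neg_ofNat hi
        change D.xF ^ (-(i : ℤ)) ∈ localRing q
        rw [zpow_neg, zpow_natCast, ← inv_pow]
        exact pow_mem (D.xF_inv_mem hq) _
      · change i ≤ 0 - (m + 1) at hi
        obtain ⟨i, rfl⟩ : ∃ i' : ℕ, i = -(m + 1 + i' : ℕ) :=
          ⟨(-i - (m + 1)).toNat, by push_cast; omega⟩
        change D.yF * D.xF ^ (-((m + 1 + i : ℕ) : ℤ)) ∈ localRing q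
        rw [zpow_neg, zpow_natCast, ← inv_pow, pow_add, ← mul_assoc]
        exact mul_mem (D.v_mem hq) (pow_mem (D.xF_inv_mem hq) _)
    exact this hf

/-- U ∩ V is the locus x ≠ 0 in U, so a power of x makes f regular on U, and dividing by it again
only shifts exponents. -/
theorem forall_mem_inf_iff (f : FunField X) :
    (∀ q ∈ D.U ⊓ D.V, f ∈ localRing q) ↔ f ∈ D.band Set.univ := by
  constructor
  · intro hf
    obtain ⟨n, t, ht⟩ := exists_toFF_pow_mul D.affine_U D.mem_U D.x
      (D.basicOpen_x ▸ D.mem_inf) (f := f) (fun q hq => hf q (D.basicOpen_x ▸ hq))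
    have h1 : D.xF ^ n * f ∈ D.band highSet := by
      rw [← D.forall_mem_U_iff]
      intro q hq
      exact ht ▸ toFF_mem_localRing D.U D.mem_U t hq
    have h2 := D.zpow_mul_mem_band (a := -n) (S' := Set.univ) (fun _ _ => trivial) h1
    rwa [← zpow_natCast, ← mul_assoc, ← zpow_add₀ D.xF_ne_zero, neg_add_cancel, zpow_zero,
      one_mul] at h2
  · intro hf q hq
    have : D.band Set.univ ≤ (localRing q).toSubmodule := by
      rw [band, Submodule.span_le]
      rintro _ ⟨i | i, -, rfl⟩
      · exact D.xF_zpow_mem hq i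
      · exact (localRing q).mul_mem (D.yF_mem hq.1) (D.xF_zpow_mem hq i)
    exact this hf

end FunctionField

end Charts

end ASCurve

end

noncomputable section

/-! ## Cohomology of the structure sheaf and of the differentials of the curve -/

namespace KScheme

/-- If the differentials of the coordinate ring of an affine open subset are generated by `dw`, then
so are those of its local rings. -/
theorem exists_eq_smul_D_germ {k : Type u} [Field k] {X : Over (Spec (CommRingCat.of k))}
    {U : X.left.Opens} (hU : IsAffineOpen U) (w : Γ(X.left, U))
    (hw : ∀ η : Ω[Γ(X.left, U)⁄k], ∃ r : Γ(X.left, U), η = r • KaehlerDifferential.D k _ w)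
    {q : X.left} (hq : q ∈ U) (ω : Ω[X.left.presheaf.stalk q⁄k]) :
    ∃ a : X.left.presheaf.stalk q, ω = a • KaehlerDifferential.D k _ (germ U q hq w) := by
  have hD : ∀ r : Γ(X.left, U), ∃ r' : Γ(X.left, U),
      KaehlerDifferential.D k _ (germ U q hq r) =
        germ U q hq r' • KaehlerDifferential.D k _ (germ U q hq w) := by
    intro r
    obtain ⟨r', hr'⟩ := hw (KaehlerDifferential.D k _ r)
    refine ⟨r', ?_⟩
    rw [← kaehlerMap_D, hr', kaehlerMap_smul, kaehlerMap_D]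
  induction ω using kaehler_induction with
  | zero => exact ⟨0, (zero_smul _ _).symm⟩
  | add ω ω' h h' =>
    obtain ⟨a, ha⟩ := h
    obtain ⟨a', ha'⟩ := h'
    exact ⟨a + a', by rw [ha, ha', add_smul]⟩
  | smul b ω h =>
    obtain ⟨a, ha⟩ := h
    exact ⟨b * a, by rw [ha, mul_smul]⟩
  | D f =>
    let _ := TopCat.Presheaf.algebra_section_stalk X.left.presheaf (⟨q, hq⟩ : U)
    have := hU.isLocalization_stalk ⟨q, hq⟩
    obtain ⟨⟨r, s⟩, hrs⟩ := IsLocalization.surj (hU.primeIdealOf ⟨q, hq⟩).asIdeal.primeCompl f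
    have hs : IsUnit (germ U q hq s.1) :=
      IsLocalization.map_units (X.left.presheaf.stalk q) s
    have hrs : f * germ U q hq s.1 = germ U q hq r := hrs
    obtain ⟨r', hr'⟩ := hD r
    obtain ⟨s', hs'⟩ := hD s.1
    obtain ⟨i, hi⟩ := hs.exists_left_inv
    -- The quotient rule: f s = r gives s df = dr - f ds, and s is a unit at the point.
    have h1 := congrArg (KaehlerDifferential.D k _) hrs
    rw [Derivation.leibniz, hr', hs', ← eq_sub_iff_add_eq', ← mul_smul, ← sub_smul] at h1
    refine ⟨i * (germ U q hq r' - f * germ U q hq s'), ?_⟩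
    rw [mul_smul, ← h1, ← mul_smul, hi, one_smul]

end KScheme

namespace ASCurve

open CechCohomology KScheme Polynomial

/-- Differentiating b² = c(a^p - a) kills a^p in characteristic p and leaves 2b db = -c da, so da is
a multiple of db. -/
theorem IsASChart.exists_eq_smul_D {k : Type u} [Field k] {p : ℕ} [CharP k p] {c : k}
    {R : Type u} [CommRing R] [Algebra k R] {a b : R} (h : IsASChart p c a b) (hc : c ≠ 0)
    (η : Ω[R⁄k]) : ∃ r : R, η = r • KaehlerDifferential.D k R b := by
  have hDa : ∃ r : R, KaehlerDifferential.D k R a = r • KaehlerDifferential.D k R b := by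
    have h1 := congrArg (KaehlerDifferential.D k R) h.sq_eq
    rw [Derivation.map_smul, map_sub, Derivation.leibniz_pow, Derivation.leibniz_pow,
      ← Nat.cast_smul_eq_nsmul k p, CharP.cast_eq_zero, zero_smul, zero_sub] at h1
    refine ⟨algebraMap k R (-c⁻¹) * (2 * b), ?_⟩
    rw [mul_smul, algebraMap_smul, mul_smul, ofNat_smul_eq_nsmul]
    simp only [Nat.add_one_sub_one, pow_one] at h1
    rw [h1, neg_smul, smul_neg, smul_neg, neg_neg, smul_smul, inv_mul_cancel₀ hc, one_smul]
  have hD : ∀ r : R, ∃ r' : R, KaehlerDifferential.D k R r = r' • KaehlerDifferential.D k R b := by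
    intro r
    have hr : r ∈ Algebra.adjoin k {a, b} := h.adjoin_eq ▸ Algebra.mem_top
    induction hr using Algebra.adjoin_induction with
    | mem x hx =>
      rcases hx with rfl | rfl
      · exact hDa
      · exact ⟨1, (one_smul _ _).symm⟩
    | algebraMap r => exact ⟨0, by simp⟩
    | add x y _ _ hx hy =>
      obtain ⟨x', hx⟩ := hx
      obtain ⟨y', hy⟩ := hy
      exact ⟨x' + y', by rw [map_add, hx, hy, add_smul]⟩
    | mul x y _ _ hx hy =>
      obtain ⟨x', hx⟩ := hx
      obtain ⟨y', hy⟩ := hy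
      exact ⟨x * y' + y * x', by rw [Derivation.leibniz, hx, hy, add_smul, mul_smul, mul_smul]⟩
  induction η using kaehler_induction with
  | zero => exact ⟨0, (zero_smul _ _).symm⟩
  | add ω ω' h h' =>
    obtain ⟨a, ha⟩ := h
    obtain ⟨a', ha'⟩ := h'
    exact ⟨a + a', by rw [ha, ha', add_smul]⟩
  | smul b ω h =>
    obtain ⟨a, ha⟩ := h
    exact ⟨b * a, by rw [ha, mul_smul]⟩
  | D f => exact hD f

namespace Charts

variable {k : Type u} [Field k]
variable {X : Over (Spec (CommRingCat.of k))} {p m : ℕ} (D : Charts X p m)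
  [AlgebraicGeometry.IsIntegral X.left]

/-- `M` consists of the functions `f` for which `f` is regular on the first chart and `x ^ (-n) f`
on the second. -/
structure IsTwist {F : ModPresheaf k X.left} (M : LatticeModel F (FunField X)) (n : ℤ) : Prop where
  mem_lat_U : ∀ q ∈ D.U, ∀ f, f ∈ M.lat q ↔ f ∈ localRing q
  mem_lat_V : ∀ q ∈ D.V, ∀ f, f ∈ M.lat q ↔ D.xF ^ (-n) * f ∈ localRing q

namespace IsTwist

variable {D} {F : ModPresheaf k X.left} {M : LatticeModel F (FunField X)} {n : ℤ}
  (T : D.IsTwist M n)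
include T

theorem splits_U : M.Splits D.U :=
  splits_of_isAffineOpen M D.affine_U D.mem_U 1 fun q hq f => by rw [one_mul, T.mem_lat_U q hq]

theorem splits_V : M.Splits D.V :=
  splits_of_isAffineOpen M D.affine_V D.mem_V (D.xF ^ (-n)) T.mem_lat_V

theorem sections_U : M.sections D.U = D.band highSet := by
  ext f
  rw [← D.forall_mem_U_iff]
  exact forall₂_congr fun q hq => T.mem_lat_U q hq f

theorem sections_V : M.sections D.V = D.band (lowSet m n) := by
  ext f
  have h1 : f ∈ M.sections D.V ↔ D.xF ^ (-n) * f ∈ D.band (lowSet m 0) := by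
    rw [← D.forall_mem_V_iff]
    exact forall₂_congr fun q hq => T.mem_lat_V q hq f
  rw [h1]
  constructor
  · intro h
    have := D.zpow_mul_mem_band (a := n) (S' := lowSet m n) (by
      rintro (i | i) hi
      · change i ≤ 0 at hi
        change n + i ≤ n
        omega
      · change i ≤ 0 - (m + 1) at hi
        change n + i ≤ n - (m + 1)
        omega) h
    rwa [← mul_assoc, ← zpow_add₀ D.xF_ne_zero, add_neg_cancel, zpow_zero, one_mul] at this
  · refine D.zpow_mul_mem_band ?_
    rintro (i | i) hi
    · change i ≤ n at hi
      change -n + i ≤ 0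
      omega
    · change i ≤ n - (m + 1) at hi
      change -n + i ≤ 0 - (m + 1)
      omega

theorem sections_inf : M.sections (D.U ⊓ D.V) = D.band Set.univ := by
  ext f
  rw [← D.forall_mem_inf_iff]
  exact forall₂_congr fun q hq => T.mem_lat_U q hq.1 f

theorem linearCombination_mem (l : ℤ ⊕ ℤ →₀ k) :
    Finsupp.linearCombination k D.monomials l ∈ M.sections (D.U ⊓ D.V) := by
  rw [T.sections_inf, D.linearCombination_mem_band, Finsupp.supported_univ]
  trivial

/-- The cohomology class of a Laurent tail, given by its coefficients. -/
def tailClass : (ℤ ⊕ ℤ →₀ k) →ₗ[k] H1 F :=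
  M.connecting D.sup_eq ∘ₗ
    (Finsupp.linearCombination k D.monomials).codRestrict _ T.linearCombination_mem

theorem represents_tailClass (l : ℤ ⊕ ℤ →₀ k) :
    M.Represents (LatticeModel.extendOff (k := k) D.U (Finsupp.linearCombination k D.monomials l))
      (T.tailClass l) :=
  M.represents_connecting D.sup_eq _

theorem tailClass_surjective : Function.Surjective T.tailClass := by
  intro c
  obtain ⟨⟨f, hf⟩, rfl⟩ := M.connecting_surjective D.sup_eq T.splits_U T.splits_V c
  obtain ⟨l, -, rfl⟩ := D.exists_of_mem_band (T.sections_inf ▸ hf)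
  exact ⟨l, rfl⟩

/-- Sections over U and over V are spanned by monomials and the monomials are independent. Hence
only the coefficients in the gap between the two exponent sets obstruct a splitting. -/
theorem tailClass_eq_zero_iff (l : ℤ ⊕ ℤ →₀ k) :
    T.tailClass l = 0 ↔ ∀ j ∉ highSet ∪ lowSet m n, l j = 0 := by
  rw [tailClass, LinearMap.comp_apply, M.connecting_eq_zero_iff, T.sections_U, T.sections_V,
    D.band_sup]
  refine D.linearCombination_mem_band.trans ?_
  rw [Finsupp.mem_supported']

end IsTwist

theorem isTwist_functionModel : D.IsTwist (functionModel X) 0 where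
  mem_lat_U q _ f := Iff.rfl
  mem_lat_V q _ f := by
    rw [neg_zero, zpow_zero, one_mul]
    exact Iff.rfl

section Differentials

variable [CharP k p]

/-- The derivation with respect to `y`. -/
def IsDerivY (δ : Derivation k (FunField X) (FunField X)) : Prop :=
  δ D.yF = 1 ∧ δ D.xF = -2 * D.yF

theorem exists_isDerivY [Fact p.Prime] : ∃ δ, D.IsDerivY δ := by
  have : Nonempty D.U := ⟨⟨_, D.mem_U⟩⟩
  have : IsFractionRing Γ(X.left, D.U) (FunField X) :=
    functionField_isFractionRing_of_isAffineOpen X.left D.U D.affine_U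
  have : IsScalarTower k Γ(X.left, D.U) (FunField X) :=
    IsScalarTower.of_algebraMap_eq fun r => ((toFF D.U D.mem_U).commutes r).symm
  exact D.chart_U.exists_derivation D.two_lt_p (FunField X)

variable {D} {δ : Derivation k (FunField X) (FunField X)} (hδ : D.IsDerivY δ)
include hδ

/-- The product rule gives x^(-(m+1)) + 2(m+1) y² x^(-(m+2)). Here 2(m+1) = p + 1 = 1 in k and y² =
x^(2m+1) - x, so the first term cancels and x^(m-1) remains. -/
theorem IsDerivY.apply_v :
    δ (toFF D.V D.mem_V D.v) = D.xF ^ (m - 1) := by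
  have hx := D.xF_ne_zero
  have hinv : δ D.xF⁻¹ = 2 * D.yF * D.xF⁻¹ ^ 2 := by
    rw [Derivation.leibniz_inv, hδ.2, smul_eq_mul]
    ring
  have hp : ((2 * m + 1 : ℕ) : FunField X) = 0 := by
    rw [← D.p_eq]
    have := (Algebra.charP_iff k (FunField X) p).mp inferInstance
    exact CharP.cast_eq_zero _ _
  push_cast at hp
  rw [D.toFF_v, Derivation.leibniz, Derivation.leibniz_pow, hδ.1, hinv]
  simp only [smul_eq_mul, nsmul_eq_mul, Nat.add_sub_cancel, mul_one]
  push_cast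
  have hsq : D.yF ^ 2 = D.xF ^ (2 * m + 1) - D.xF := by rw [D.yF_sq, ← D.p_eq]
  obtain ⟨j, hj⟩ : ∃ j, m = j + 1 := ⟨m - 1, by have := D.m_pos; omega⟩
  have h2 : D.yF * (((m : FunField X) + 1) * (D.xF⁻¹ ^ m * (2 * D.yF * D.xF⁻¹ ^ 2))) =
      (2 * (m : FunField X) + 1 + 1) * D.yF ^ 2 * D.xF⁻¹ ^ (m + 2) := by ring
  rw [h2, hp, hsq]
  generalize D.xF = x at hx ⊢
  rw [hj, Nat.add_sub_cancel, zero_add, one_mul, inv_pow, inv_pow]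
  field_simp
  ring

theorem IsDerivY.isFormCoordinate : IsFormCoordinate δ := by
  intro q
  rcases D.mem_or_mem q with hq | hq
  · refine ⟨D.U, hq, D.y, ?_, fun r hr ω => exists_eq_smul_D_germ D.affine_U D.y
      (D.chart_U.exists_eq_smul_D one_ne_zero) hr ω⟩
    exact ne_of_eq_of_ne hδ.1 one_ne_zero
  · refine ⟨D.V, hq, D.v, ?_, fun r hr ω => exists_eq_smul_D_germ D.affine_V D.v
      (D.chart_V.exists_eq_smul_D (neg_ne_zero.mpr one_ne_zero)) hr ω⟩
    exact ne_of_eq_of_ne hδ.apply_v (pow_ne_zero _ D.xF_ne_zero)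

/-- On U the generator is dy. On V it is dv = x^(m-1) dy, so a dv has coefficient a x^(m-1) with
respect to dy. -/
theorem IsDerivY.isTwist_formsModel :
    D.IsTwist (formsModel hδ.isFormCoordinate) ((m : ℤ) - 1) where
  mem_lat_U q hq f := by
    constructor
    · rintro ⟨ω, rfl⟩
      obtain ⟨a, rfl⟩ := exists_eq_smul_D_germ D.affine_U D.y
        (D.chart_U.exists_eq_smul_D one_ne_zero) hq ω
      refine ⟨a, ?_⟩
      rw [contract_smul, contract_D, stalkToFF_germ]
      exact (mul_one (stalkToFF q a)).symm.trans (congrArg (stalkToFF q a * ·) hδ.1.symm)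
    · rintro ⟨a, rfl⟩
      refine ⟨a • KaehlerDifferential.D k _ (germ D.U q hq D.y), ?_⟩
      rw [contract_smul, contract_D, stalkToFF_germ]
      exact (congrArg (stalkToFF q a * ·) hδ.1).trans (mul_one (stalkToFF q a))
  mem_lat_V q hq f := by
    have hx : D.xF ^ (-((m : ℤ) - 1)) * D.xF ^ (m - 1) = 1 := by
      rw [← zpow_natCast, ← zpow_add₀ D.xF_ne_zero, Nat.cast_sub D.m_pos, Nat.cast_one,
        neg_add_cancel, zpow_zero]
    constructor
    · rintro ⟨ω, rfl⟩
      obtain ⟨a, rfl⟩ := exists_eq_smul_D_germ D.affine_V D.v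
        (D.chart_V.exists_eq_smul_D (neg_ne_zero.mpr one_ne_zero)) hq ω
      refine ⟨a, ?_⟩
      rw [contract_smul, contract_D, stalkToFF_germ, hδ.apply_v, mul_left_comm, hx, mul_one]
      rfl
    · rintro ⟨a, ha⟩
      refine ⟨a • KaehlerDifferential.D k _ (germ D.V q hq D.v), ?_⟩
      rw [contract_smul, contract_D, stalkToFF_germ, hδ.apply_v]
      have ha : stalkToFF q a = D.xF ^ (-((m : ℤ) - 1)) * f := ha
      rw [ha, mul_right_comm, hx, one_mul]

end Differentials

end Charts

end ASCurve

end

noncomputable section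

/-! ## Global differential forms, and Serre duality, on the curve -/

namespace ASCurve

namespace Charts

open CechCohomology KScheme Polynomial

variable {k : Type u} [Field k]
variable {X : Over (Spec (CommRingCat.of k))} {p m : ℕ} (D : Charts X p m)
  [AlgebraicGeometry.IsIntegral X.left] [CharP k p]
variable {δ : Derivation k (FunField X) (FunField X)}

omit [CharP k p] in
theorem aeval_xF_injective : Function.Injective (aeval D.xF : k[X] →ₐ[k] FunField X) := by
  rw [injective_iff_map_eq_zero]
  intro P hP
  refine (D.chart_U.eq_zero_of_eq_zero D.odd_p D.two_lt_p one_ne_zero (Q := 0) ?_).1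
  rw [map_zero, mul_zero, add_zero]
  apply toFF_injective D.U D.mem_U
  rw [map_zero, ← aeval_algHom_apply]
  exact hP

variable {D} (hδ : D.IsDerivY δ)
include hδ

/-- The exponents common to both charts for twist m - 1 are 0 ≤ i ≤ m - 1 for x^i, and 0 ≤ i ≤ -2,
that is none, for y x^i. -/
theorem IsDerivY.mem_sections_top_iff (f : FunField X) :
    f ∈ (formsModel hδ.isFormCoordinate).sections ⊤ ↔ ∃ P ∈ degreeLT k m, aeval D.xF P = f := by
  have T := hδ.isTwist_formsModel
  have h1 : f ∈ (formsModel hδ.isFormCoordinate).sections ⊤ ↔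
      f ∈ D.band highSet ∧ f ∈ D.band (lowSet m (m - 1)) := by
    rw [← T.sections_U, ← T.sections_V]
    exact ⟨fun h => ⟨fun q _ => h q trivial, fun q _ => h q trivial⟩,
      fun h q _ => (D.mem_or_mem q).elim (h.1 q) (h.2 q)⟩
  rw [h1]
  constructor
  · rintro ⟨h, h'⟩
    obtain ⟨l, hl, rfl⟩ := D.exists_of_mem_band h
    rw [D.linearCombination_mem_band] at h'
    rw [Finsupp.linearCombination_apply]
    refine (Submodule.sum_mem (p := (degreeLT k m).map (aeval D.xF).toLinearMap) (t := l.support)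
      (f := fun j => l j • D.monomials j) fun j hj => Submodule.smul_mem _ _ ?_)
    have hj1 := hl hj
    have hj2 := h' hj
    rcases j with i | i
    · change 0 ≤ i at hj1
      change i ≤ m - 1 at hj2
      obtain ⟨i, rfl⟩ := Int.eq_ofNat_of_zero_le hj1
      refine ⟨Polynomial.X ^ i, ?_, ?_⟩
      · rw [SetLike.mem_coe, mem_degreeLT, degree_X_pow]
        exact_mod_cast (by omega : i < m)
      · simp [monomials]
    · change 0 ≤ i at hj1
      change i ≤ m - 1 - (m + 1) at hj2
      omega
  · rintro ⟨P, hP, rfl⟩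
    rw [mem_degreeLT] at hP
    have hdeg : P.natDegree < m := by
      by_cases hP0 : P = 0
      · rw [hP0, natDegree_zero]
        exact D.m_pos
      · exact (natDegree_lt_iff_degree_lt hP0).mpr hP
    rw [aeval_eq_sum_range' hdeg]
    have hmem : ∀ S : Set (ℤ ⊕ ℤ), (∀ i < m, Sum.inl (i : ℤ) ∈ S) →
        ∑ i ∈ Finset.range m, P.coeff i • D.xF ^ i ∈ D.band S := by
      intro S hS
      exact sum_mem fun i hi => Submodule.smul_mem _ _ (Submodule.subset_span
        ⟨.inl i, hS i (Finset.mem_range.mp hi), zpow_natCast _ _⟩)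
    refine ⟨hmem _ fun i _ => Int.natCast_nonneg i, hmem _ fun i hi => ?_⟩
    change (i : ℤ) ≤ m - 1
    omega

/-- A global differential form, divided by `dy`. -/
def IsDerivY.quotientByDy : H0Forms X →ₗ[k] FunField X :=
  (formsModel hδ.isFormCoordinate).toK ⊤ trivial

theorem IsDerivY.quotientByDy_injective : Function.Injective hδ.quotientByDy :=
  (formsModel hδ.isFormCoordinate).toK_injective ⊤ trivial

theorem IsDerivY.exists_form (P : degreeLT k m) :
    ∃ ω : H0Forms X, hδ.quotientByDy ω = aeval D.xF P.1 :=
  (formsModel hδ.isFormCoordinate).exists_toK ⊤ trivial _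
    ((hδ.mem_sections_top_iff _).mpr ⟨P.1, P.2, rfl⟩)

/-- The global differential form `P(x) dy`. -/
def IsDerivY.form : degreeLT k m ≃ₗ[k] H0Forms X :=
  LinearEquiv.ofBijective
    { toFun := fun P => (hδ.exists_form P).choose
      map_add' := fun P Q => hδ.quotientByDy_injective (by
        rw [map_add, (hδ.exists_form P).choose_spec, (hδ.exists_form Q).choose_spec,
          (hδ.exists_form (P + Q)).choose_spec, Submodule.coe_add, map_add])
      map_smul' := fun r P => hδ.quotientByDy_injective (by
        rw [map_smul, (hδ.exists_form P).choose_spec, (hδ.exists_form (r • P)).choose_spec,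
          Submodule.coe_smul, map_smul, RingHom.id_apply]) } (by
    constructor
    · intro P Q h
      refine Subtype.ext (D.aeval_xF_injective ?_)
      rw [← (hδ.exists_form P).choose_spec, ← (hδ.exists_form Q).choose_spec]
      exact congrArg hδ.quotientByDy h
    · intro ω
      obtain ⟨P, hP, h⟩ := (hδ.mem_sections_top_iff (hδ.quotientByDy ω)).mp fun q _ =>
        (formsModel hδ.isFormCoordinate).toK_mem ⊤ trivial ω q trivial
      exact ⟨⟨P, hP⟩, hδ.quotientByDy_injective ((hδ.exists_form ⟨P, hP⟩).choose_spec.trans h)⟩)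

theorem IsDerivY.quotientByDy_form (P : degreeLT k m) :
    hδ.quotientByDy (hδ.form P) = aeval D.xF P.1 :=
  (hδ.exists_form P).choose_spec

/-- The basis `x ^ i dy`, `i < m`, of the space of global differential forms. -/
def IsDerivY.formBasis : Module.Basis (Fin m) k (H0Forms X) := (degreeLT.basis k m).map hδ.form

theorem IsDerivY.quotientByDy_formBasis (i : Fin m) :
    hδ.quotientByDy (hδ.formBasis i) = D.xF ^ (i : ℕ) := by
  rw [formBasis, Module.Basis.map_apply, hδ.quotientByDy_form, degreeLT.basis_val, map_pow, aeval_X]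

theorem IsDerivY.finrank_H0Forms : Module.finrank k (H0Forms X) = m := by
  rw [Module.finrank_eq_card_basis hδ.formBasis, Fintype.card_fin]

theorem IsDerivY.represents_cup (ω : H0Forms X) {b : X.left → FunField X} {c : H1Fun X}
    (h : (functionModel X).Represents b c) :
    (formsModel hδ.isFormCoordinate).Represents (fun q => hδ.quotientByDy ω * b q)
      (cup X ω c) := by
  refine LatticeModel.Represents.map_id (mulForm ω) (LinearMap.mulLeft k (hδ.quotientByDy ω)) rfl
    (fun U hU s => ?_) h
  refine (contract_smul δ _ _ _).trans ?_
  rw [LinearMap.mulLeft_apply, mul_comm]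
  exact congrArg (hδ.quotientByDy ω * ·) (stalkToFF_germ U _ hU s)

theorem IsDerivY.cup_tailClass (i : Fin m) (l : ℤ ⊕ ℤ →₀ k) :
    cup X (hδ.formBasis i) (D.isTwist_functionModel.tailClass l) =
      hδ.isTwist_formsModel.tailClass
        (l.mapDomain (Sum.map (((i : ℕ) : ℤ) + ·) (((i : ℕ) : ℤ) + ·))) := by
  refine ((hδ.represents_cup _ (D.isTwist_functionModel.represents_tailClass l)).eq_iff
    (hδ.isTwist_formsModel.represents_tailClass _)).mpr ⟨0, fun q => ?_⟩
  rw [hδ.quotientByDy_formBasis, ← zpow_natCast, ← D.zpow_mul_linearCombination]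
  by_cases hq : q ∈ D.U
  · rw [LatticeModel.extendOff_of_mem _ _ hq, LatticeModel.extendOff_of_mem _ _ hq]
    simp
  · rw [LatticeModel.extendOff_of_notMem _ _ hq, LatticeModel.extendOff_of_notMem _ _ hq, sub_self,
      sub_zero]
    exact zero_mem _

/-- The class of `y / x` in the first cohomology of the sheaf of differentials. -/
def IsDerivY.fundamentalClass : H1Forms X :=
  hδ.isTwist_formsModel.tailClass (Finsupp.single (.inr (-1)) 1)

/-- For twist m - 1 the powers of x leave no gap, and y x^i is uncovered only for -2 < i < 0. -/
theorem IsDerivY.tailClass_eq (l : ℤ ⊕ ℤ →₀ k) :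
    hδ.isTwist_formsModel.tailClass l = l (.inr (-1)) • hδ.fundamentalClass := by
  rw [← sub_eq_zero, fundamentalClass, ← map_smul, ← map_sub,
    hδ.isTwist_formsModel.tailClass_eq_zero_iff]
  rintro (i | i) hi
  · exfalso
    refine hi ?_
    by_cases h : 0 ≤ i
    · exact Or.inl h
    · refine Or.inr ?_
      change i ≤ m - 1
      omega
  · have h1 : ¬ 0 ≤ i := fun h => hi (Or.inl h)
    have h2 : ¬ i ≤ m - 1 - (m + 1) := fun h => hi (Or.inr h)
    have : i = -1 := by omega
    subst this
    simp

theorem IsDerivY.fundamentalClass_ne_zero : hδ.fundamentalClass ≠ 0 := by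
  rw [fundamentalClass, Ne, hδ.isTwist_formsModel.tailClass_eq_zero_iff]
  intro h
  have := h (.inr (-1)) (by
    rintro (h | h)
    · change (0 : ℤ) ≤ -1 at h
      omega
    · change (-1 : ℤ) ≤ m - 1 - (m + 1) at h
      omega)
  simp at this

theorem IsDerivY.exists_eq_smul_fundamentalClass (c : H1Forms X) :
    ∃ r : k, c = r • hδ.fundamentalClass := by
  obtain ⟨l, rfl⟩ := hδ.isTwist_formsModel.tailClass_surjective c
  exact ⟨_, hδ.tailClass_eq l⟩

theorem IsDerivY.finrank_H1Forms : Module.finrank k (H1Forms X) = 1 :=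
  finrank_eq_one_iff'.mpr ⟨_, hδ.fundamentalClass_ne_zero, fun c =>
    let ⟨r, hr⟩ := hδ.exists_eq_smul_fundamentalClass c
    ⟨r, hr.symm⟩⟩

omit hδ in
variable (X) in
/-- The map from `H¹(X, 𝒪)` to the dual of the space of global differential forms that is given by a
trace map. -/
def serreMap (t : H1Forms X →ₗ[k] k) : H1Fun X →ₗ[k] Module.Dual k (H0Forms X) :=
  (cup X).flip.compr₂ t

/-- The form x^i dy shifts exponents by i, and only the coefficient of y/x survives in H¹(Ω¹). So
the pairing reads off the coefficient of y x^(-1-i). -/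
theorem IsDerivY.serreMap_tailClass (t : H1Forms X →ₗ[k] k) (i : Fin m) (l : ℤ ⊕ ℤ →₀ k) :
    serreMap X t (D.isTwist_functionModel.tailClass l) (hδ.formBasis i) =
      l (.inr (-1 - (i : ℕ))) * t hδ.fundamentalClass := by
  have h1 : serreMap X t (D.isTwist_functionModel.tailClass l) (hδ.formBasis i) =
      t (cup X (hδ.formBasis i) (D.isTwist_functionModel.tailClass l)) := rfl
  have h2 : (.inr (-1) : ℤ ⊕ ℤ) = Sum.map (((i : ℕ) : ℤ) + ·) (((i : ℕ) : ℤ) + ·)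
      (.inr (-1 - ((i : ℕ) : ℤ))) := by
    rw [Sum.map_inr]
    congr 1
    omega
  rw [h1, hδ.cup_tailClass, hδ.tailClass_eq, map_smul, smul_eq_mul, h2, Finsupp.mapDomain_apply]
  exact Sum.map_injective.mpr ⟨add_right_injective _, add_right_injective _⟩

/-- For twist 0 the gap consists of y x^j with -m ≤ j ≤ -1. The substitution j = -1 - i matches it
with the basis x^i dy, i < m, so up to the nonzero scalar t(fundamental class) the two bases are
dual. -/
theorem IsDerivY.serreMap_bijective (t : H1Forms X ≃ₗ[k] k) :
    Function.Bijective (serreMap X t.toLinearMap) := by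
  have ht : t.toLinearMap hδ.fundamentalClass ≠ 0 :=
    (map_ne_zero_iff _ t.injective).mpr hδ.fundamentalClass_ne_zero
  constructor
  · rw [injective_iff_map_eq_zero]
    intro c hc
    obtain ⟨l, rfl⟩ := D.isTwist_functionModel.tailClass_surjective c
    rw [D.isTwist_functionModel.tailClass_eq_zero_iff]
    rintro (i | i) hi
    · exfalso
      refine hi ?_
      by_cases h : 0 ≤ i
      · exact Or.inl h
      · refine Or.inr ?_
        change i ≤ 0
        omega
    · have h1 : ¬ 0 ≤ i := fun h => hi (Or.inl h)
      have h2 : ¬ i ≤ 0 - (m + 1) := fun h => hi (Or.inr h)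
      have h3 := hδ.serreMap_tailClass t.toLinearMap ⟨(-1 - i).toNat, by omega⟩ l
      rw [hc, LinearMap.zero_apply] at h3
      have h4 := (mul_eq_zero.mp h3.symm).resolve_right ht
      have h5 : (-1 - ((-1 - i).toNat : ℤ)) = i := by omega
      rwa [h5] at h4
  · intro φ
    refine ⟨D.isTwist_functionModel.tailClass (∑ i : Fin m, Finsupp.single
      (.inr (-1 - ((i : ℕ) : ℤ))) (φ (hδ.formBasis i) / t.toLinearMap hδ.fundamentalClass)), ?_⟩
    refine hδ.formBasis.ext fun i => ?_
    rw [hδ.serreMap_tailClass, Finsupp.finsetSum_apply, Finset.sum_eq_single i]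
    · rw [Finsupp.single_eq_same, div_mul_cancel₀ _ ht]
    · intro j _ hj
      refine Finsupp.single_eq_of_ne fun h => hj (Fin.ext ?_)
      have := Sum.inr_injective h
      omega
    · exact fun h => (h (Finset.mem_univ i)).elim

end Charts

end ASCurve

end

noncomputable section

/-! ## Zeros of functions, and pullback along isomorphisms -/

namespace KScheme

open CechCohomology

section Zeros

variable {k : Type u} [Field k] {X : Over (Spec (CommRingCat.of k))} [IsIntegral X.left]
variable {q : X.left} {f g : FunField X}

/-- The rational function `f` is regular at `q` and vanishes there. -/
def VanishesAt (q : X.left) (f : FunField X) : Prop :=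
  ∃ g ∈ IsLocalRing.maximalIdeal (X.left.presheaf.stalk q), stalkToFF q g = f

theorem VanishesAt.mem (h : VanishesAt q f) : f ∈ localRing q :=
  let ⟨g, _, hg⟩ := h
  ⟨g, hg⟩

theorem VanishesAt.mul_ne_one (h : VanishesAt q f) (hg : g ∈ localRing q) : f * g ≠ 1 := by
  obtain ⟨f, hf, rfl⟩ := h
  obtain ⟨g, rfl⟩ := hg
  have hg : stalkToFF q g = stalkToFF q g := rfl
  intro h1
  have h2 : stalkToFF q (f * g) = stalkToFF q 1 := by
    rw [map_mul, map_one]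
    exact h1
  exact hf (IsUnit.of_mul_eq_one g (stalkToFF_injective q h2))

theorem VanishesAt.add (h : VanishesAt q f) (h' : VanishesAt q g) : VanishesAt q (f + g) := by
  obtain ⟨f, hf, rfl⟩ := h
  obtain ⟨g, hg, rfl⟩ := h'
  exact ⟨f + g, add_mem hf hg, map_add _ _ _⟩

theorem VanishesAt.neg (h : VanishesAt q f) : VanishesAt q (-f) := by
  obtain ⟨f, hf, rfl⟩ := h
  exact ⟨-f, neg_mem hf, map_neg _ _⟩

theorem VanishesAt.sub (h : VanishesAt q f) (h' : VanishesAt q g) : VanishesAt q (f - g) :=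
  sub_eq_add_neg f g ▸ h.add h'.neg

theorem VanishesAt.mul_left (h : VanishesAt q f) (hg : g ∈ localRing q) :
    VanishesAt q (g * f) := by
  obtain ⟨f, hf, rfl⟩ := h
  obtain ⟨g, rfl⟩ := hg
  exact ⟨g * f, Ideal.mul_mem_left _ g hf, map_mul _ _ _⟩

theorem VanishesAt.mul_right (h : VanishesAt q f) (hg : g ∈ localRing q) :
    VanishesAt q (f * g) :=
  mul_comm g f ▸ h.mul_left hg

theorem VanishesAt.pow (h : VanishesAt q f) {n : ℕ} (hn : n ≠ 0) : VanishesAt q (f ^ n) := by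
  obtain ⟨f, hf, rfl⟩ := h
  exact ⟨f ^ n, Ideal.pow_mem_of_mem _ hf n (Nat.pos_of_ne_zero hn), map_pow _ _ _⟩

theorem vanishesAt_or_inv_mem (h : f ∈ localRing q) : VanishesAt q f ∨ f⁻¹ ∈ localRing q := by
  obtain ⟨f, rfl⟩ := h
  by_cases hf : IsUnit f
  · obtain ⟨g, hg⟩ := hf.exists_right_inv
    refine Or.inr ⟨g, ?_⟩
    have h1 := congrArg (stalkToFF q) hg
    rw [map_mul, map_one] at h1
    exact (inv_eq_of_mul_eq_one_right h1).symm
  · exact Or.inl ⟨f, hf, rfl⟩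

theorem not_vanishesAt_algebraMap {c : k} (hc : c ≠ 0) :
    ¬ VanishesAt q (algebraMap k (FunField X) c) := fun h =>
  h.mul_ne_one (Subalgebra.algebraMap_mem _ c⁻¹) (by rw [← map_mul, mul_inv_cancel₀ hc, map_one])

theorem VanishesAt.or_of_mul (h : VanishesAt q (f * g)) (hf : f ∈ localRing q)
    (hg : g ∈ localRing q) : VanishesAt q f ∨ VanishesAt q g := by
  obtain ⟨f, rfl⟩ := hf
  obtain ⟨g, rfl⟩ := hg
  obtain ⟨a, ha, h⟩ := h
  have h1 : a = f * g := stalkToFF_injective q (h.trans (map_mul (stalkToFF q) f g).symm)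
  rw [h1] at ha
  exact (Ideal.IsPrime.mem_or_mem inferInstance ha).imp (fun h => ⟨f, h, rfl⟩) fun h => ⟨g, h, rfl⟩

theorem vanishesAt_toFF_iff {U : X.left.Opens} (h : genericPoint X.left ∈ U) (hq : q ∈ U)
    (s : Γ(X.left, U)) : VanishesAt q (toFF U h s) ↔ q ∉ X.left.basicOpen s := by
  rw [X.left.mem_basicOpen s q hq]
  constructor
  · rintro ⟨a, ha, h1⟩
    have : a = germ U q hq s :=
      stalkToFF_injective q (h1.trans (stalkToFF_germ U q hq s).symm)
    rw [this] at ha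
    exact ha
  · exact fun h1 => ⟨germ U q hq s, h1, stalkToFF_germ U q hq s⟩

/-- `s` generates the maximal ideal of the local ring at `q`. -/
structure IsUniformizer (q : X.left) (s : FunField X) : Prop where
  vanishes : VanishesAt q s
  ne_zero : s ≠ 0
  div_mem : ∀ f, VanishesAt q f → f / s ∈ localRing q

theorem exists_toFF_div {U : X.left.Opens} (hU : IsAffineOpen U) (h : genericPoint X.left ∈ U)
    (hq : q ∈ U) (hf : f ∈ localRing q) :
    ∃ r s : Γ(X.left, U), ¬ VanishesAt q (toFF U h s) ∧ f = toFF U h r / toFF U h s := by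
  obtain ⟨a, rfl⟩ := hf
  let _ := TopCat.Presheaf.algebra_section_stalk X.left.presheaf (⟨q, hq⟩ : U)
  have := hU.isLocalization_stalk ⟨q, hq⟩
  obtain ⟨⟨r, s⟩, hrs⟩ := IsLocalization.surj (hU.primeIdealOf ⟨q, hq⟩).asIdeal.primeCompl a
  have hs : IsUnit (germ U q hq s.1) :=
    IsLocalization.map_units (X.left.presheaf.stalk q) s
  have hrs : a * germ U q hq s.1 = germ U q hq r := hrs
  have hv : ¬ VanishesAt q (toFF U h s.1) := by
    rw [vanishesAt_toFF_iff h hq, not_not, X.left.mem_basicOpen s.1 q hq]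
    exact hs
  refine ⟨r, s, hv, ?_⟩
  have h1 := congrArg (stalkToFF q) hrs
  rw [map_mul, stalkToFF_germ, stalkToFF_germ] at h1
  refine eq_div_of_mul_eq (fun h0 => hv ?_) h1
  rw [h0]
  exact ⟨0, zero_mem _, map_zero _⟩

omit [IsIntegral X.left] in
theorem exists_notMem_basicOpen {U : X.left.Opens} {s : Γ(X.left, U)} (hs : ¬ IsUnit s) :
    ∃ q ∈ U, q ∉ X.left.basicOpen s := by
  by_contra! h
  refine hs (RingedSpace.isUnit_of_isUnit_germ X.left.toRingedSpace U s fun q hq => ?_)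
  exact (X.left.mem_basicOpen s q hq).mp (h q hq)

omit [IsIntegral X.left] in
/-- A point of an affine open subset is determined by the values of two functions that generate the
coordinate ring. -/
theorem eq_of_notMem_basicOpen {U : X.left.Opens} (hU : IsAffineOpen U) {s t : Γ(X.left, U)}
    (hst : Algebra.adjoin k {s, t} = ⊤) (a b : k) {q r : X.left} (hq : q ∈ U) (hr : r ∈ U)
    (hqs : q ∉ X.left.basicOpen (s - algebraMap k _ a))
    (hqt : q ∉ X.left.basicOpen (t - algebraMap k _ b))
    (hrs : r ∉ X.left.basicOpen (s - algebraMap k _ a))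
    (hrt : r ∉ X.left.basicOpen (t - algebraMap k _ b)) : q = r := by
  -- At a point with coordinates (a, b) every section is congruent to a constant modulo the maximal
  -- ideal, and the constant depends on f only. So q and r lie in the same basic open subsets, and
  -- these separate points.
  have h1 : ∀ f : Γ(X.left, U), ∃ c : k, ∀ z ∈ U, z ∉ X.left.basicOpen (s - algebraMap k _ a) →
      z ∉ X.left.basicOpen (t - algebraMap k _ b) →
      ∃ e ∈ IsLocalRing.maximalIdeal (X.left.presheaf.stalk z),
        ∀ hz : z ∈ U, germ U z hz f = algebraMap k _ c + e := by
    have hz : ∀ (f : Γ(X.left, U)) (c : k) (z) (hz : z ∈ U),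
        z ∉ X.left.basicOpen (f - algebraMap k _ c) →
        ∃ e ∈ IsLocalRing.maximalIdeal (X.left.presheaf.stalk z),
          ∀ hz : z ∈ U, germ U z hz f = algebraMap k _ c + e := by
      intro f c z hz h
      rw [X.left.mem_basicOpen _ z hz] at h
      refine ⟨_, h, fun _ => ?_⟩
      change germ U z hz f = algebraMap k _ c + germ U z hz (f - algebraMap k _ c)
      rw [map_sub, AlgHom.commutes, add_sub_cancel]
    intro f
    have hf : f ∈ Algebra.adjoin k {s, t} := hst ▸ Algebra.mem_top
    induction hf using Algebra.adjoin_induction with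
    | mem f hf =>
      rcases hf with rfl | rfl
      · exact ⟨a, fun z hzU h _ => hz _ a z hzU h⟩
      · exact ⟨b, fun z hzU _ h => hz _ b z hzU h⟩
    | algebraMap c => exact ⟨c, fun z _ _ _ => ⟨0, zero_mem _, fun _ => by
        rw [AlgHom.commutes, add_zero]⟩⟩
    | add f g _ _ hf hg =>
      obtain ⟨c, hc⟩ := hf
      obtain ⟨d, hd⟩ := hg
      refine ⟨c + d, fun z hz h h' => ?_⟩
      obtain ⟨e, he, h1⟩ := hc z hz h h'
      obtain ⟨e', he', h2⟩ := hd z hz h h'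
      refine ⟨e + e', add_mem he he', fun hz => ?_⟩
      rw [map_add, h1 hz, h2 hz, map_add]
      ring
    | mul f g _ _ hf hg =>
      obtain ⟨c, hc⟩ := hf
      obtain ⟨d, hd⟩ := hg
      refine ⟨c * d, fun z hz h h' => ?_⟩
      obtain ⟨e, he, h1⟩ := hc z hz h h'
      obtain ⟨e', he', h2⟩ := hd z hz h h'
      refine ⟨algebraMap k _ c * e' + (algebraMap k _ d + e') * e,
        add_mem (Ideal.mul_mem_left _ _ he') (Ideal.mul_mem_left _ _ he), fun hz => ?_⟩
      rw [map_mul, h1 hz, h2 hz, map_mul]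
      ring
  have h2 : ∀ f : Γ(X.left, U), q ∈ X.left.basicOpen f ↔ r ∈ X.left.basicOpen f := by
    intro f
    obtain ⟨c, hc⟩ := h1 f
    have h3 : ∀ z ∈ U, z ∉ X.left.basicOpen (s - algebraMap k _ a) →
        z ∉ X.left.basicOpen (t - algebraMap k _ b) → (z ∈ X.left.basicOpen f ↔ c ≠ 0) := by
      intro z hz h h'
      obtain ⟨e, he, h4⟩ := hc z hz h h'
      have h5 : z ∈ X.left.basicOpen f ↔ IsUnit (germ U z hz f) := X.left.mem_basicOpen f z hz
      rw [h5, h4 hz]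
      constructor
      · rintro hu rfl
        rw [map_zero, zero_add] at hu
        exact he hu
      · intro hc0
        have hu : IsUnit (algebraMap k (X.left.presheaf.stalk z) c + e + -e) := by
          rw [add_neg_cancel_right]
          exact (IsUnit.mk0 c hc0).map _
        exact (IsLocalRing.isUnit_or_isUnit_of_isUnit_add hu).resolve_right (neg_mem he)
    rw [h3 q hq hqs hqt, h3 r hr hrs hrt]
  refine (inseparable_iff_forall_isOpen.mpr fun W hW => ?_).eq
  constructor
  · intro h
    obtain ⟨f, hf, hqf⟩ := hU.exists_basicOpen_le (V := ⟨W, hW⟩) ⟨q, h⟩ hq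
    exact hf ((h2 f).mp hqf)
  · intro h
    obtain ⟨f, hf, hrf⟩ := hU.exists_basicOpen_le (V := ⟨W, hW⟩) ⟨r, h⟩ hr
    exact hf ((h2 f).mpr hrf)

end Zeros

/-! ### Isomorphisms acting on the function field. -/

section Pullback

variable {k : Type u} [Field k] {X Y : Over (Spec (CommRingCat.of k))} [IsIntegral X.left]
  [IsIntegral Y.left] (σ : X ⟶ Y) [IsIso σ.left]

theorem apply_genericPoint : σ.left (genericPoint X.left) = genericPoint Y.left :=
  genericPoint_eq_of_isOpenImmersion σ.left

/-- Pullback of rational functions along an isomorphism. -/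
def pullFF : FunField Y →ₐ[k] FunField X :=
  (stalkMap σ (genericPoint X.left)).comp
    { toRingHom := (Y.left.presheaf.stalkSpecializes
        (specializes_of_eq (apply_genericPoint σ))).hom
      commutes' := fun r => by
        have h := Y.left.presheaf.germ_stalkSpecializes (U := ⊤) (y := genericPoint Y.left) trivial
          (specializes_of_eq (apply_genericPoint σ))
        exact ConcreteCategory.congr_hom h ((fromBase Y ⊤).hom r) }

theorem pullFF_stalkToFF (q : X.left) (a : Y.left.presheaf.stalk (σ.left q)) :
    pullFF σ (stalkToFF (σ.left q) a) = stalkToFF q (stalkMap σ q a) := by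
  have h1 := Scheme.Hom.stalkSpecializes_stalkMap σ.left (genericPoint X.left) q
    ((genericPoint_spec X.left).specializes trivial)
  have h2 := Y.left.presheaf.stalkSpecializes_comp (specializes_of_eq (apply_genericPoint σ))
    ((genericPoint_spec Y.left).specializes (y := σ.left q) trivial)
  refine Eq.trans ?_ (ConcreteCategory.congr_hom h1 a)
  exact congrArg (stalkMap σ (genericPoint X.left)) (ConcreteCategory.congr_hom h2 a)

theorem pullFF_toFF {U : Y.left.Opens} {V : X.left.Opens} (h : V ≤ σ.left ⁻¹ᵁ U)
    (hV : genericPoint X.left ∈ V) (hU : genericPoint Y.left ∈ U) (s : Γ(Y.left, U)) :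
    pullFF σ (toFF U hU s) = toFF V hV (appLE σ U V h s) := by
  rw [← stalkToFF_germ U _ (mem_of_le h hV), pullFF_stalkToFF, stalkMap_germ_apply σ U V h _ hV,
    stalkToFF_germ]

omit [IsIntegral X.left] [IsIntegral Y.left] in
theorem stalkMap_surjective (q : X.left) : Function.Surjective (stalkMap σ q) := by
  have h := (ConcreteCategory.bijective_of_isIso (σ.left.stalkMap q)).2
  exact h

theorem pullFF_mem_localRing_iff (q : X.left) (f : FunField Y) :
    pullFF σ f ∈ localRing q ↔ f ∈ localRing (σ.left q) := by
  constructor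
  · rintro ⟨a, ha⟩
    obtain ⟨b, rfl⟩ := stalkMap_surjective σ q a
    refine ⟨b, (pullFF σ).injective ((pullFF_stalkToFF σ q b).trans ha)⟩
  · rintro ⟨a, rfl⟩
    exact ⟨_, (pullFF_stalkToFF σ q a).symm⟩

theorem vanishesAt_pullFF {q : X.left} {f : FunField Y} (h : VanishesAt (σ.left q) f) :
    VanishesAt q (pullFF σ f) := by
  obtain ⟨a, ha, rfl⟩ := h
  refine ⟨stalkMap σ q a, fun h => ha ?_, (pullFF_stalkToFF σ q a).symm⟩
  exact isUnit_of_map_unit (σ.left.stalkMap q).hom a h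

theorem exists_pullFF {q : X.left} {f : FunField X} (h : VanishesAt q f) :
    ∃ g, VanishesAt (σ.left q) g ∧ pullFF σ g = f := by
  obtain ⟨a, ha, rfl⟩ := h
  obtain ⟨b, rfl⟩ := stalkMap_surjective σ q a
  exact ⟨_, ⟨b, fun hb => ha (hb.map (stalkMap σ q)), rfl⟩, pullFF_stalkToFF σ q b⟩

theorem IsUniformizer.pullFF {q : X.left} {s : FunField Y} (h : IsUniformizer (σ.left q) s) :
    IsUniformizer q (KScheme.pullFF σ s) where
  vanishes := vanishesAt_pullFF σ h.vanishes
  ne_zero := (map_ne_zero_iff _ (KScheme.pullFF σ).injective).mpr h.ne_zero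
  div_mem f hf := by
    obtain ⟨g, hg, rfl⟩ := exists_pullFF σ hf
    rw [← map_div₀, pullFF_mem_localRing_iff]
    exact h.div_mem g hg

end Pullback

end KScheme

end

noncomputable section

namespace CechCohomology.LatticeModel

/-- Pullback of cohomology classes, in terms of adeles. -/
theorem Represents.map {k : Type u} [CommRing k] {S T : Type u} [TopologicalSpace S]
    [TopologicalSpace T] {φ : C(S, T)} {F : ModPresheaf k T} {G : ModPresheaf k S}
    {K L : Type u} [AddCommGroup K] [Module k K] [AddCommGroup L] [Module k L]
    {M : LatticeModel F K} {M' : LatticeModel G L} {α : HomOver φ F G} {τ : K →ₗ[k] L}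
    (hτ : ∀ (U : Opens T) (V : Opens S) (h : ∀ z ∈ V, φ z ∈ U) (hU : M.η ∈ U) (hV : M'.η ∈ V)
      (s : F.obj U), M'.toK V hV (α.app U V h s) = τ (M.toK U hU s))
    {b : T → K} {c : H1 F} (h : M.Represents b c) :
    M'.Represents (fun q => τ (b (φ q))) (H1.map α c) := by
  obtain ⟨N, z, rfl, h⟩ := h
  refine ⟨N.pullback φ, _, (H1.map_mk α z).symm, fun q r => ?_⟩
  rw [← map_sub, ← h]
  exact hτ _ _ _ _ _ _

end CechCohomology.LatticeModel

/-! ## Pullback along automorphisms, in terms of rational functions -/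

namespace ASCurve

namespace Charts

open CechCohomology KScheme LatticeModel

variable {k : Type u} [Field k]
variable {X : Over (Spec (CommRingCat.of k))} {p m : ℕ} {D : Charts X p m}
  [AlgebraicGeometry.IsIntegral X.left] [CharP k p]
variable {δ : Derivation k (FunField X) (FunField X)} (hδ : D.IsDerivY δ)
variable (σ : X ⟶ X) [IsIso σ.left]

omit [CharP k p] in
/-- Pullback of functions, in terms of adeles. -/
theorem represents_pullH1Fun {b : X.left → FunField X} {c : H1Fun X}
    (h : (functionModel X).Represents b c) :
    (functionModel X).Represents (fun q => pullFF σ (b (σ.left q))) (pullH1Fun σ c) := by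
  have hτ : ∀ (U V : X.left.Opens) (hUV : ∀ z ∈ V, σ.left z ∈ U) (hU : genericPoint X.left ∈ U)
      (hV : genericPoint X.left ∈ V) (s : Γ(X.left, U)),
      toFF V hV (appLE σ U V hUV s) = (pullFF σ).toLinearMap (toFF U hU s) :=
    fun U V hUV hU hV s => (pullFF_toFF σ hUV hV hU s).symm
  have key := Represents.map (α := pullFun σ) (M := functionModel X) (M' := functionModel X)
    (τ := (pullFF σ).toLinearMap) hτ h
  exact key

include hδ

omit hδ in
variable (D) in
theorem exists_eq_smul_D_yF (ω : Ω[FunField X⁄k]) :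
    ∃ a : FunField X, ω = a • KaehlerDifferential.D k _ D.yF :=
  exists_eq_smul_D_germ D.affine_U D.y (D.chart_U.exists_eq_smul_D one_ne_zero) D.mem_U ω

/-- The chain rule: a dy pulls back to σ*(a) d(σ*y), whose coefficient with respect to dy is σ*(a)
δ(σ*y). -/
theorem IsDerivY.lift_kaehlerMap_pullFF (ω : Ω[FunField X⁄k]) :
    δ.liftKaehlerDifferential (kaehlerMap (pullFF σ) ω) =
      pullFF σ (δ.liftKaehlerDifferential ω) * δ (pullFF σ D.yF) := by
  obtain ⟨a, rfl⟩ := D.exists_eq_smul_D_yF ω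
  rw [kaehlerMap_smul, kaehlerMap_D, map_smul, map_smul, Derivation.liftKaehlerDifferential_comp_D,
    Derivation.liftKaehlerDifferential_comp_D, hδ.1, smul_eq_mul, smul_eq_mul, mul_one]

theorem IsDerivY.contract_stalkMap (q : X.left) (ω : Ω[X.left.presheaf.stalk (σ.left q)⁄k]) :
    contract δ q (kaehlerMap (stalkMap σ q) ω) =
      pullFF σ (contract δ (σ.left q) ω) * δ (pullFF σ D.yF) := by
  have h : (stalkToFF q).comp (stalkMap σ q) = (pullFF σ).comp (stalkToFF (σ.left q)) :=
    AlgHom.ext fun a => (pullFF_stalkToFF σ q a).symm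
  have h1 : contract δ q (kaehlerMap (stalkMap σ q) ω) =
      δ.liftKaehlerDifferential (kaehlerMap (pullFF σ) (kaehlerMap (stalkToFF (σ.left q)) ω)) := by
    rw [contract, LinearMap.comp_apply, ← kaehlerMap_comp, h, kaehlerMap_comp]
    rfl
  rw [h1, hδ.lift_kaehlerMap_pullFF]
  rfl

theorem IsDerivY.mem_lat_pullFF {q : X.left} {f : FunField X}
    (h : f ∈ (formsModel hδ.isFormCoordinate).lat (σ.left q)) :
    pullFF σ f * δ (pullFF σ D.yF) ∈ (formsModel hδ.isFormCoordinate).lat q := by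
  obtain ⟨ω, rfl⟩ := h
  exact ⟨_, hδ.contract_stalkMap σ q ω⟩

theorem IsDerivY.toK_pullForms (U V : X.left.Opens) (h : ∀ z ∈ V, σ.left z ∈ U)
    (hU : genericPoint X.left ∈ U) (hV : genericPoint X.left ∈ V) (ω : (formsSheaf X).obj U) :
    (formsModel hδ.isFormCoordinate).toK V hV ((pullForms σ).app U V h ω) =
      pullFF σ ((formsModel hδ.isFormCoordinate).toK U hU ω) * δ (pullFF σ D.yF) := by
  rw [formsModel_toK _ U hU ω (h _ hV), ← hδ.contract_stalkMap]
  exact formsModel_toK _ V hV _ hV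

theorem IsDerivY.quotientByDy_pullH0Forms (ω : H0Forms X) :
    hδ.quotientByDy (pullH0Forms σ ω) =
      pullFF σ (hδ.quotientByDy ω) * δ (pullFF σ D.yF) :=
  hδ.toK_pullForms σ ⊤ ⊤ _ trivial trivial ω

theorem IsDerivY.represents_pullH1Forms {b : X.left → FunField X} {c : H1Forms X}
    (h : (formsModel hδ.isFormCoordinate).Represents b c) :
    (formsModel hδ.isFormCoordinate).Represents
      (fun q => pullFF σ (b (σ.left q)) * δ (pullFF σ D.yF)) (pullH1Forms σ c) := by
  have hτ := hδ.toK_pullForms σ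
  have key := Represents.map (α := pullForms σ) (M := formsModel hδ.isFormCoordinate)
    (M' := formsModel hδ.isFormCoordinate)
    (τ := LinearMap.mulRight k (δ (pullFF σ D.yF)) ∘ₗ (pullFF σ).toLinearMap) hτ h
  exact key

/-- Both sides are represented by the same adele, since pullback of functions is multiplicative. -/
theorem IsDerivY.pullH1Forms_cup (ω : H0Forms X) (c : H1Fun X) :
    pullH1Forms σ (cup X ω c) = cup X (pullH0Forms σ ω) (pullH1Fun σ c) := by
  obtain ⟨b, hb⟩ := (functionModel X).exists_represents c
  refine ((hδ.represents_pullH1Forms σ (hδ.represents_cup ω hb)).eq_iff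
    (hδ.represents_cup _ (represents_pullH1Fun σ hb))).mpr ⟨0, fun q => ?_⟩
  rw [hδ.quotientByDy_pullH0Forms, map_mul, mul_right_comm, sub_self, sub_zero]
  exact zero_mem _

end Charts

end ASCurve

end

noncomputable section

/-! ## Automorphisms act trivially on `H¹(X, Ω¹)`

The class of the logarithmic derivative of a uniformizer at a closed point does not depend on the
point, because the function `(y + b) / (x - a)` has a simple pole at the point `(a, b)` and at the
point at infinity. -/

namespace ASCurve

namespace Charts

open CechCohomology KScheme

variable {k : Type u} [Field k]
variable {X : Over (Spec (CommRingCat.of k))} {p m : ℕ} {D : Charts X p m}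
  [AlgebraicGeometry.IsIntegral X.left] [CharP k p]
variable {δ : Derivation k (FunField X) (FunField X)}

section Derivation

variable (hδ : D.IsDerivY δ)
include hδ

/-- Over U the lattice of forms, relative to dy, is the local ring itself, and δ(f) is the
coefficient of df. -/
theorem IsDerivY.apply_mem {q : X.left} (hq : q ∈ D.U) {f : FunField X} (hf : f ∈ localRing q) :
    δ f ∈ localRing q := by
  obtain ⟨a, rfl⟩ := hf
  rw [← hδ.isTwist_formsModel.mem_lat_U q hq]
  exact ⟨KaehlerDifferential.D k _ a, contract_D δ q a⟩

/-- The difference is the logarithmic derivative of s/t, and s/t and t/s are both regular at q. -/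
theorem IsDerivY.dlog_sub_dlog_mem {q : X.left} (hq : q ∈ D.U) {s t : FunField X}
    (hs : IsUniformizer q s) (ht : IsUniformizer q t) : δ s / s - δ t / t ∈ localRing q := by
  have hs0 := hs.ne_zero
  have ht0 := ht.ne_zero
  have h1 := hδ.apply_mem hq (ht.div_mem s hs.vanishes)
  have h2 := mul_mem h1 (hs.div_mem t ht.vanishes)
  convert h2 using 1
  rw [Derivation.leibniz_div]
  simp only [smul_eq_mul]
  field_simp

/-- If f/s vanished at q, so would δ(f) = s δ(f/s) + (f/s) δ(s). Hence f/s is a unit at q. -/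
theorem IsDerivY.isUniformizer_of_apply {q : X.left} (hq : q ∈ D.U) {s f : FunField X}
    (hs : IsUniformizer q s) (hf : VanishesAt q f) (hf' : ¬ VanishesAt q (δ f)) :
    IsUniformizer q f := by
  have hs0 := hs.ne_zero
  have hf0 : f ≠ 0 := by
    rintro rfl
    rw [map_zero] at hf'
    exact hf' hf
  have ht := hs.div_mem f hf
  refine ⟨hf, hf0, fun g hg => ?_⟩
  rcases vanishesAt_or_inv_mem ht with h | h
  · refine (hf' ?_).elim
    have h1 : δ f = s * δ (f / s) + f / s * δ s := by
      rw [← smul_eq_mul, ← smul_eq_mul, ← Derivation.leibniz, mul_div_cancel₀ _ hs0]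
    rw [h1]
    exact (hs.vanishes.mul_right (hδ.apply_mem hq ht)).add
      (h.mul_right (hδ.apply_mem hq hs.vanishes.mem))
  · have := mul_mem (hs.div_mem g hg) h
    rwa [inv_div, div_mul_div_cancel₀ hs0] at this

end Derivation

section Points

variable (D)

/-- By additivity of Frobenius, (x - a)^p - (x - a) = (x^p - x) - (a^p - a) = y² - b². -/
theorem xF_sub_pow_sub [Fact p.Prime] {a b : k} (hab : b ^ 2 = a ^ p - a) :
    (D.yF - algebraMap k _ b) * (D.yF + algebraMap k _ b) =
      (D.xF - algebraMap k _ a) * ((D.xF - algebraMap k _ a) ^ (p - 1) - 1) := by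
  have := (Algebra.charP_iff k (FunField X) p).mp inferInstance
  have h1 : (D.xF - algebraMap k _ a) * ((D.xF - algebraMap k _ a) ^ (p - 1) - 1) =
      (D.xF - algebraMap k _ a) ^ p - (D.xF - algebraMap k _ a) := by
    rw [mul_sub, mul_one, mul_pow_sub_one (Fact.out : p.Prime).ne_zero]
  have h2 : (algebraMap k (FunField X) b) ^ 2 = algebraMap k _ a ^ p - algebraMap k _ a := by
    rw [← map_pow, hab, map_sub, map_pow]
  have h3 := D.yF_sq
  rw [h1, sub_pow_char]
  linear_combination h3 - h2

omit [CharP k p] in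
include D in
theorem sub_pow_inv_mem {q : X.left} {f : FunField X} (hf : VanishesAt q f) :
    f ^ (p - 1) - 1 ≠ 0 ∧ (f ^ (p - 1) - 1)⁻¹ ∈ localRing q := by
  have h2 := D.two_lt_p
  have h3 : ¬ VanishesAt q (f ^ (p - 1) - 1) := by
    intro h
    have := (hf.pow (n := p - 1) (by omega)).sub h
    rw [sub_sub_cancel, ← map_one (algebraMap k (FunField X))] at this
    exact not_vanishesAt_algebraMap one_ne_zero this
  refine ⟨?_, (vanishesAt_or_inv_mem (sub_mem (pow_mem hf.mem _) (one_mem _))).resolve_left h3⟩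
  intro h
  rw [h] at h3
  exact h3 ⟨0, zero_mem _, map_zero _⟩

/-- A function with a simple pole at the point `(a, b)` and at infinity. -/
def poleFun (a b : k) : FunField X :=
  (D.yF + algebraMap k _ b) / (D.xF - algebraMap k _ a)

/-- Where x - a is a unit there is nothing to do. Where x = a but y ≠ b, the equation rewrites the
function as ((x - a)^(p-1) - 1)/(y - b). -/
theorem poleFun_mem_of_mem_U [Fact p.Prime] {a b : k} (hab : b ^ 2 = a ^ p - a) {r : X.left}
    (hr : r ∈ D.U)
    (h : ¬ (VanishesAt r (D.xF - algebraMap k _ a) ∧ VanishesAt r (D.yF - algebraMap k _ b))) :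
    D.poleFun a b ∈ localRing r := by
  have hx : D.xF - algebraMap k _ a ∈ localRing r :=
    sub_mem (D.xF_mem hr) (Subalgebra.algebraMap_mem _ _)
  have hy : D.yF - algebraMap k _ b ∈ localRing r :=
    sub_mem (D.yF_mem hr) (Subalgebra.algebraMap_mem _ _)
  have hy' : D.yF + algebraMap k _ b ∈ localRing r :=
    add_mem (D.yF_mem hr) (Subalgebra.algebraMap_mem _ _)
  rcases vanishesAt_or_inv_mem hx with h1 | h1
  · have h2 := (vanishesAt_or_inv_mem hy).resolve_left fun h2 => h ⟨h1, h2⟩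
    have h3 := D.xF_sub_pow_sub hab
    by_cases hx0 : D.xF - algebraMap k _ a = 0
    · rw [poleFun, hx0, div_zero]
      exact zero_mem _
    have hy0 : D.yF - algebraMap k _ b ≠ 0 := by
      intro h0
      refine h ⟨h1, ?_⟩
      rw [h0]
      exact ⟨0, zero_mem _, map_zero _⟩
    have h4 : D.poleFun a b =
        ((D.xF - algebraMap k _ a) ^ (p - 1) - 1) * (D.yF - algebraMap k _ b)⁻¹ := by
      rw [poleFun, ← div_eq_mul_inv, div_eq_div_iff hx0 hy0]
      linear_combination h3
    rw [h4]
    exact mul_mem (sub_mem (pow_mem hx _) (one_mem _)) h2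
  · exact mul_mem hy' h1

variable {D} in
-- The poles at infinity cancel: y/x - (y + b)/(x - a) = -(a y + b x)/(x(x - a)). Multiplied by
-- x^(-(m-1)) this is -(a v + b u^m)/(1 - a u), and u vanishes at the point at infinity.
theorem IsDerivY.sub_poleFun_mem_lat (hδ : D.IsDerivY δ) (a b : k) {r : X.left} (hr : r ∉ D.U) :
    D.yF / D.xF - D.poleFun a b ∈ (formsModel hδ.isFormCoordinate).lat r := by
  have hrV : r ∈ D.V := (D.mem_or_mem r).resolve_left hr
  have hx0 := D.xF_ne_zero
  have hu : VanishesAt r D.xF⁻¹ := by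
    rw [← D.toFF_u, vanishesAt_toFF_iff D.mem_V hrV, D.basicOpen_u]
    exact fun h => hr h.1
  have hv := D.v_mem hrV
  have ha : (1 - algebraMap k (FunField X) a * D.xF⁻¹) ≠ 0 ∧
      (1 - algebraMap k (FunField X) a * D.xF⁻¹)⁻¹ ∈ localRing r := by
    have h1 : VanishesAt r (algebraMap k (FunField X) a * D.xF⁻¹) :=
      hu.mul_left (Subalgebra.algebraMap_mem _ _)
    have h2 : ¬ VanishesAt r (1 - algebraMap k (FunField X) a * D.xF⁻¹) := by
      intro h
      have := h.add h1
      rw [sub_add_cancel, ← map_one (algebraMap k (FunField X))] at this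
      exact not_vanishesAt_algebraMap one_ne_zero this
    refine ⟨?_, (vanishesAt_or_inv_mem (sub_mem (one_mem _) h1.mem)).resolve_left h2⟩
    intro h
    rw [h] at h2
    exact h2 ⟨0, zero_mem _, map_zero _⟩
  rw [hδ.isTwist_formsModel.mem_lat_V r hrV]
  obtain ⟨ha0, ha⟩ := ha
  have hA : (algebraMap k (FunField X) a) ∈ localRing r := Subalgebra.algebraMap_mem _ _
  have hB : (algebraMap k (FunField X) b) ∈ localRing r := Subalgebra.algebraMap_mem _ _
  have key : D.xF ^ (-((m : ℤ) - 1)) * (D.yF / D.xF - D.poleFun a b) =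
      -((algebraMap k (FunField X) a * (D.yF * D.xF⁻¹ ^ (m + 1)) +
        algebraMap k (FunField X) b * D.xF⁻¹ ^ m) *
          (1 - algebraMap k (FunField X) a * D.xF⁻¹)⁻¹) := by
    obtain ⟨j, hj⟩ : ∃ j, m = j + 1 := ⟨m - 1, by have := D.m_pos; omega⟩
    have h1 : D.xF ^ (-((m : ℤ) - 1)) = D.xF⁻¹ ^ j := by
      have h2 : -((m : ℤ) - 1) = -(j : ℤ) := by omega
      rw [h2, zpow_neg, zpow_natCast, inv_pow]
    rw [h1, poleFun]
    have h2 : D.xF - algebraMap k (FunField X) a =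
        D.xF * (1 - algebraMap k (FunField X) a * D.xF⁻¹) := by
      field_simp
    rw [h2]
    generalize D.xF = x at *
    generalize D.yF = y at *
    generalize algebraMap k (FunField X) a = α at *
    generalize algebraMap k (FunField X) b = β at *
    have h3 : 1 - α * x⁻¹ = (x - α) / x := by field_simp
    have h4 : x - α ≠ 0 := by
      rw [h3] at ha0
      exact (div_ne_zero_iff.mp ha0).1
    subst hj
    rw [h3, inv_pow, inv_pow, inv_pow]
    field_simp
    ring
  rw [key]
  exact neg_mem (mul_mem (add_mem (mul_mem hA hv) (mul_mem hB (pow_mem hu.mem _))) ha)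

/-- A point of the first chart whose maximal ideal is generated by a nonzero function has
coordinates in `k`. -/
theorem exists_coordinates [IsAlgClosed k] [Fact p.Prime] {q : X.left} (hq : q ∈ D.U)
    {s : FunField X} (hs : IsUniformizer q s) : ∃ a b : k, b ^ 2 = a ^ p - a ∧
      VanishesAt q (D.xF - algebraMap k _ a) ∧ VanishesAt q (D.yF - algebraMap k _ b) := by
  have hmem : ∀ P : Polynomial k, Polynomial.aeval D.xF P ∈ localRing q := fun P =>
    Algebra.adjoin_le (Set.singleton_subset_iff.mpr (D.xF_mem hq))
      (Polynomial.aeval_mem_adjoin_singleton k D.xF)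
  have h1 : ∃ a : k, VanishesAt q (D.xF - algebraMap k _ a) := by
    by_contra! h
    -- If no x - a vanishes at q, then no nonzero polynomial in x does, because such a polynomial
    -- splits into linear factors over k.
    have hP : ∀ P : Polynomial k, P ≠ 0 → ¬ VanishesAt q (Polynomial.aeval D.xF P) := by
      intro P hP0 hv
      have hsp := IsAlgClosed.splits P
      rw [hsp.eq_prod_roots, map_mul, Polynomial.aeval_C] at hv
      rcases hv.or_of_mul (Subalgebra.algebraMap_mem _ _) (hmem _) with hv | hv
      · exact not_vanishesAt_algebraMap (Polynomial.leadingCoeff_ne_zero.mpr hP0) hv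
      · generalize P.roots = S at hv
        induction S using Multiset.induction_on with
        | empty =>
          rw [Multiset.map_zero, Multiset.prod_zero, map_one,
            ← map_one (algebraMap k (FunField X))] at hv
          exact not_vanishesAt_algebraMap one_ne_zero hv
        | cons a S ih =>
          rw [Multiset.map_cons, Multiset.prod_cons, map_mul] at hv
          refine (hv.or_of_mul (hmem _) (hmem _)).elim (fun h1 => h a ?_) ih
          simpa using h1
    have : Nonempty D.U := ⟨⟨_, D.mem_U⟩⟩
    have : IsFractionRing Γ(X.left, D.U) (FunField X) :=
      functionField_isFractionRing_of_isAffineOpen X.left D.U D.affine_U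
    -- Norm argument: multiplying P + yQ by its conjugate P - yQ gives P² - (x^p - x)Q², a nonzero
    -- polynomial in x if f ≠ 0. So every nonzero function on U is a unit at q.
    have hA : ∀ f : Γ(X.left, D.U), f ≠ 0 → (toFF D.U D.mem_U f)⁻¹ ∈ localRing q := by
      intro f hf
      refine (vanishesAt_or_inv_mem (toFF_mem_localRing _ _ _ hq)).resolve_left fun hv => ?_
      obtain ⟨P, Q, rfl⟩ := D.chart_U.exists_eq f
      have e : toFF D.U D.mem_U (Polynomial.aeval D.x P + D.y * Polynomial.aeval D.x Q) =
          Polynomial.aeval D.xF P + D.yF * Polynomial.aeval D.xF Q := by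
        rw [map_add, map_mul, ← Polynomial.aeval_algHom_apply, ← Polynomial.aeval_algHom_apply]
        rfl
      rw [e] at hv
      have h2 := hv.mul_right (sub_mem (hmem P) (mul_mem (D.yF_mem hq) (hmem Q)))
      have h3 : (Polynomial.aeval D.xF P + D.yF * Polynomial.aeval D.xF Q) *
          (Polynomial.aeval D.xF P - D.yF * Polynomial.aeval D.xF Q) =
          Polynomial.aeval D.xF (P ^ 2 - (Polynomial.X ^ p - Polynomial.X) * Q ^ 2) := by
        simp only [map_sub, map_mul, map_pow, Polynomial.aeval_X]
        rw [← D.yF_sq]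
        ring
      rw [h3] at h2
      refine hP _ (fun h0 => hf ?_) h2
      rw [h0, map_zero] at h3
      apply toFF_injective D.U D.mem_U
      rw [map_zero, e]
      rcases mul_eq_zero.mp h3 with h4 | h4
      · exact h4
      · have h5 := D.chart_U.eq_zero_of_eq_zero D.odd_p D.two_lt_p one_ne_zero (P := P) (Q := -Q) (by
          apply toFF_injective D.U D.mem_U
          rw [map_zero, map_neg, mul_neg, ← sub_eq_add_neg, map_sub, map_mul,
            ← Polynomial.aeval_algHom_apply, ← Polynomial.aeval_algHom_apply]
          exact h4)
        rw [h5.1, neg_eq_zero.mp h5.2, map_zero, mul_zero, add_zero]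
    -- The local ring at q would then be the whole function field and contain 1/s, although s
    -- vanishes at q.
    obtain ⟨f, g, hg, hfg⟩ := IsFractionRing.div_surjective (A := Γ(X.left, D.U)) s⁻¹
    refine hs.vanishes.mul_ne_one (g := s⁻¹) ?_ (mul_inv_cancel₀ hs.ne_zero)
    rw [← hfg]
    exact mul_mem (toFF_mem_localRing D.U D.mem_U f hq) (hA g (nonZeroDivisors.ne_zero hg))
  obtain ⟨a, ha⟩ := h1
  obtain ⟨b, hb⟩ := IsAlgClosed.exists_pow_nat_eq (a ^ p - a) (n := 2) two_pos
  have h2 : VanishesAt q ((D.yF - algebraMap k _ b) * (D.yF + algebraMap k _ b)) := by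
    rw [D.xF_sub_pow_sub hb]
    exact ha.mul_right (sub_mem (pow_mem ha.mem _) (one_mem _))
  rcases h2.or_of_mul (sub_mem (D.yF_mem hq) (Subalgebra.algebraMap_mem _ _))
    (add_mem (D.yF_mem hq) (Subalgebra.algebraMap_mem _ _)) with h | h
  · exact ⟨a, b, hb, ha, h⟩
  · refine ⟨a, -b, by rw [neg_sq, hb], ha, ?_⟩
    rwa [map_neg, sub_neg_eq_add]

omit [CharP k p] in
theorem eq_of_vanishesAt {a b : k} {q r : X.left} (hq : q ∈ D.U) (hr : r ∈ D.U)
    (hqx : VanishesAt q (D.xF - algebraMap k _ a)) (hqy : VanishesAt q (D.yF - algebraMap k _ b))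
    (hrx : VanishesAt r (D.xF - algebraMap k _ a)) (hry : VanishesAt r (D.yF - algebraMap k _ b)) :
    q = r := by
  have h : ∀ (f : Γ(X.left, D.U)) (c : k) (z : X.left), z ∈ D.U →
      VanishesAt z (toFF D.U D.mem_U f - algebraMap k _ c) →
      z ∉ X.left.basicOpen (f - algebraMap k _ c) := by
    intro f c z hz h
    rwa [← vanishesAt_toFF_iff D.mem_U hz, map_sub, AlgHom.commutes]
  exact eq_of_notMem_basicOpen D.affine_U D.chart_U.adjoin_eq a b hq hr (h _ _ _ hq hqx)
    (h _ _ _ hq hqy) (h _ _ _ hr hrx) (h _ _ _ hr hry)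

omit [AlgebraicGeometry.IsIntegral X.left] [CharP k p] in
/-- There is only one point at infinity. -/
theorem eq_of_notMem_U {q r : X.left} (hq : q ∉ D.U) (hr : r ∉ D.U) : q = r := by
  have hu : ∀ z ∉ D.U, z ∉ X.left.basicOpen (D.u - algebraMap k _ 0) := by
    intro z hz h
    rw [map_zero, sub_zero, D.basicOpen_u] at h
    exact hz h.1
  -- Off U the function u vanishes, and v² = u(1 - u^(p-1)) forces v to vanish too: the only such
  -- point is (u, v) = (0, 0).
  have hv : ∀ z ∉ D.U, z ∉ X.left.basicOpen (D.v - algebraMap k _ 0) := by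
    intro z hz h
    rw [map_zero, sub_zero] at h
    have h1 : z ∈ X.left.basicOpen (D.v ^ 2) := by
      rw [Scheme.basicOpen_pow _ _ (by norm_num)]
      exact h
    have h2 : D.v ^ 2 = D.u * (1 - D.u ^ (p - 1)) := by
      rw [D.chart_V.sq_eq, neg_one_smul, mul_sub, mul_pow_sub_one (by have := D.two_lt_p; omega)]
      ring
    rw [h2, Scheme.basicOpen_mul, D.basicOpen_u] at h1
    exact hz h1.1.1
  exact eq_of_notMem_basicOpen D.affine_V D.chart_V.adjoin_eq 0 0
    ((D.mem_or_mem q).resolve_left hq) ((D.mem_or_mem r).resolve_left hr) (hu q hq) (hv q hq)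
    (hu r hr) (hv r hr)

end Points

end Charts

end ASCurve

end

/-! ### Logarithmic derivatives of uniformizers and the class at infinity. -/

noncomputable section

namespace ASCurve

namespace Charts

open CechCohomology KScheme

variable {k : Type u} [Field k]
variable {X : Over (Spec (CommRingCat.of k))} {p m : ℕ} {D : Charts X p m}
  [AlgebraicGeometry.IsIntegral X.left] [CharP k p] [Fact p.Prime]
variable {δ : Derivation k (FunField X) (FunField X)}

variable (D) in
omit [CharP k p] [Fact p.Prime] in
theorem yF_ne_zero : D.yF ≠ 0 := by
  intro h
  have h1 : D.y = 0 := toFF_injective D.U D.mem_U (h.trans (map_zero _).symm)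
  have := D.chart_U.eq_zero_of_eq_zero D.odd_p D.two_lt_p one_ne_zero (P := 0) (Q := 1)
    (by rw [h1, zero_mul, map_zero, add_zero])
  exact one_ne_zero this.2

variable (D) in
/-- The function `y` is a uniformizer at the points where it vanishes. -/
theorem exists_isUniformizer_yF {a : k} (ha : a ^ p = a) :
    ∃ q ∈ D.U, VanishesAt q (D.xF - algebraMap k _ a) ∧ IsUniformizer q D.yF := by
  -- The k-point (a, 0) as a homomorphism to k: it shows that x - a is not a unit on U, hence
  -- vanishes somewhere.
  obtain ⟨φ, hφ, hφ'⟩ := D.chart_U.exists_lift k a 0 (by rw [ha, sub_self, smul_zero, sq, zero_mul])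
  obtain ⟨q, hq, hqx⟩ := exists_notMem_basicOpen (s := D.x - algebraMap k _ a) (by
    intro h
    have := h.map φ
    rw [map_sub, hφ, AlgHom.commutes, Algebra.algebraMap_self_apply, sub_self] at this
    exact not_isUnit_zero this)
  have hx : VanishesAt q (D.xF - algebraMap k _ a) := by
    rw [← vanishesAt_toFF_iff D.mem_U hq, map_sub, AlgHom.commutes] at hqx
    exact hqx
  have hxy : D.yF * D.yF =
      (D.xF - algebraMap k _ a) * ((D.xF - algebraMap k _ a) ^ (p - 1) - 1) := by
    have := D.xF_sub_pow_sub (a := a) (b := 0) (by rw [ha, sub_self, sq, zero_mul])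
    rwa [map_zero, sub_zero, add_zero] at this
  have hy : VanishesAt q D.yF := by
    have h : VanishesAt q (D.yF * D.yF) := by
      rw [hxy]
      exact hx.mul_right (sub_mem (pow_mem hx.mem _) (one_mem _))
    exact (h.or_of_mul (D.yF_mem hq) (D.yF_mem hq)).elim id id
  obtain ⟨h0, hinv⟩ := D.sub_pow_inv_mem hx
  refine ⟨q, hq, hx, hy, D.yF_ne_zero, fun f hf => ?_⟩
  obtain ⟨r, s, hs, rfl⟩ := exists_toFF_div D.affine_U D.mem_U hq hf.mem
  have hs' := (vanishesAt_or_inv_mem (toFF_mem_localRing D.U D.mem_U s hq)).resolve_left hs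
  have hs0 : toFF D.U D.mem_U s ≠ 0 := by
    intro h
    rw [h] at hs
    exact hs ⟨0, zero_mem _, map_zero _⟩
  have hmem : ∀ P : Polynomial k, Polynomial.aeval D.xF P ∈ localRing q := fun P =>
    Algebra.adjoin_le (Set.singleton_subset_iff.mpr (D.xF_mem hq))
      (Polynomial.aeval_mem_adjoin_singleton k D.xF)
  obtain ⟨P, Q, hr⟩ := D.chart_U.exists_eq r
  have e : toFF D.U D.mem_U r = Polynomial.aeval D.xF P + D.yF * Polynomial.aeval D.xF Q := by
    rw [hr, map_add, map_mul, ← Polynomial.aeval_algHom_apply, ← Polynomial.aeval_algHom_apply]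
    rfl
  -- Division by X - a. Since y² is x - a times a unit at q, the term (x - a) P₁(x) is divisible by
  -- y², and the remainder P(a) is zero because r vanishes at q. So P(x) + y Q(x) is divisible by y.
  have hP : Polynomial.aeval D.xF P = (D.xF - algebraMap k _ a) *
      Polynomial.aeval D.xF (P /ₘ (Polynomial.X - Polynomial.C a)) +
        algebraMap k _ (P.eval a) := by
    conv_lhs => rw [← Polynomial.modByMonic_add_div P (Polynomial.X - Polynomial.C a)]
    rw [Polynomial.modByMonic_X_sub_C_eq_C_eval]
    simp only [map_add, map_mul, map_sub, Polynomial.aeval_C, Polynomial.aeval_X]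
    ring
  have hr' : VanishesAt q (toFF D.U D.mem_U r) := by
    have := hf.mul_right (toFF_mem_localRing D.U D.mem_U s hq)
    rwa [div_mul_cancel₀ _ hs0] at this
  have hPa : P.eval a = 0 := by
    by_contra hne
    refine not_vanishesAt_algebraMap (q := q) hne ?_
    have := (hr'.sub (hy.mul_right (hmem Q))).sub (hx.mul_right (hmem (P /ₘ (Polynomial.X - Polynomial.C a))))
    rw [e, add_sub_cancel_right, hP, add_sub_cancel_left] at this
    exact this
  have key : toFF D.U D.mem_U r / toFF D.U D.mem_U s / D.yF =
      (D.yF * ((D.xF - algebraMap k _ a) ^ (p - 1) - 1)⁻¹ *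
        Polynomial.aeval D.xF (P /ₘ (Polynomial.X - Polynomial.C a)) +
          Polynomial.aeval D.xF Q) * (toFF D.U D.mem_U s)⁻¹ := by
    have hy0 := D.yF_ne_zero
    rw [e, hP, hPa, map_zero, add_zero]
    field_simp
    linear_combination (-Polynomial.aeval D.xF (P /ₘ (Polynomial.X - Polynomial.C a))) * hxy
  rw [key]
  exact mul_mem (add_mem (mul_mem (mul_mem (D.yF_mem hq) hinv) (hmem _)) (hmem _)) hs'

variable (hδ : D.IsDerivY δ)
include hδ

/-- The principal parts cancel: δ(s)/s and (y + b)/(x - a) have simple poles at (a, b) with opposite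
residues with respect to dy. The statement does not depend on the uniformizer, so a convenient one
is used: y if b = 0, and x - a if b ≠ 0. -/
theorem IsDerivY.dlog_add_poleFun_mem {q : X.left} (hq : q ∈ D.U) {s : FunField X}
    (hs : IsUniformizer q s) {a b : k} (hab : b ^ 2 = a ^ p - a)
    (hx : VanishesAt q (D.xF - algebraMap k _ a)) (hy : VanishesAt q (D.yF - algebraMap k _ b)) :
    δ s / s + D.poleFun a b ∈ localRing q := by
  suffices h : ∃ t, IsUniformizer q t ∧ δ t / t + D.poleFun a b ∈ localRing q by
    obtain ⟨t, ht, h⟩ := h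
    have := add_mem (hδ.dlog_sub_dlog_mem hq hs ht) h
    rwa [← add_assoc, sub_add_cancel] at this
  have hxy := D.xF_sub_pow_sub hab
  have hx0 : D.xF - algebraMap k _ a ≠ 0 := by
    intro h
    rw [sub_eq_zero] at h
    have h1 := D.aeval_xF_injective (a₁ := Polynomial.X) (a₂ := Polynomial.C a) (by
      rwa [Polynomial.aeval_X, Polynomial.aeval_C])
    exact Polynomial.X_ne_C a h1
  by_cases hb : b = 0
  · subst hb
    rw [map_zero, sub_zero] at hy
    rw [map_zero, sub_zero, add_zero] at hxy
    refine ⟨D.yF, hδ.isUniformizer_of_apply hq hs hy ?_, ?_⟩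
    · rw [hδ.1, ← map_one (algebraMap k (FunField X))]
      exact not_vanishesAt_algebraMap one_ne_zero
    · obtain ⟨h0, hinv⟩ := D.sub_pow_inv_mem hx
      have hy0 := D.yF_ne_zero
      -- With w = (x - a)^(p-1) - 1 and y² = (x - a) w, the sum 1/y + y/(x - a) is (x - a)^(p-1)/y =
      -- y (x - a)^(p-2)/w, and w is a unit at q.
      have key : δ D.yF / D.yF + D.poleFun a 0 = D.yF * (D.xF - algebraMap k _ a) ^ (p - 2) *
          ((D.xF - algebraMap k _ a) ^ (p - 1) - 1)⁻¹ := by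
        have h2 := D.two_lt_p
        rw [hδ.1, poleFun, map_zero, add_zero]
        have h3 : (D.xF - algebraMap k _ a) * (D.xF - algebraMap k _ a) ^ (p - 2) =
            (D.xF - algebraMap k _ a) ^ (p - 1) := by
          rw [← pow_succ']
          congr 1
          omega
        have h4 : (D.xF - algebraMap k _ a) ^ (p - 1) - 1 = D.yF * D.yF / (D.xF - algebraMap k _ a) := by
          rw [hxy, mul_div_cancel_left₀ _ hx0]
        have h5 : D.xF - algebraMap k _ a + D.yF * D.yF =
            (D.xF - algebraMap k _ a) ^ (p - 2) * (D.xF - algebraMap k _ a) ^ 2 := by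
          rw [hxy, ← h3]
          ring
        rw [h4]
        field_simp
        linear_combination h5
      rw [key]
      exact mul_mem (mul_mem (D.yF_mem hq) (pow_mem hx.mem _)) hinv
  · have h2 : (2 : k) ≠ 0 := by
      have h2 := D.two_lt_p
      have : ((2 : ℕ) : k) ≠ 0 := by
        rw [Ne, CharP.cast_eq_zero_iff k p]
        exact fun h => (Nat.le_of_dvd two_pos h).not_gt h2
      exact_mod_cast this
    have hy' : ¬ VanishesAt q (D.yF + algebraMap k _ b) := by
      intro h
      have := h.sub hy
      rw [add_sub_sub_cancel, ← map_add, ← two_mul] at this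
      exact not_vanishesAt_algebraMap (mul_ne_zero h2 hb) this
    have hinv := (vanishesAt_or_inv_mem (add_mem (D.yF_mem hq)
      (Subalgebra.algebraMap_mem _ _))).resolve_left hy'
    have hy0 : D.yF + algebraMap k _ b ≠ 0 := by
      intro h
      rw [h] at hy'
      exact hy' ⟨0, zero_mem _, map_zero _⟩
    have hδx : δ (D.xF - algebraMap k _ a) = -2 * D.yF := by
      rw [map_sub, Derivation.map_algebraMap, sub_zero, hδ.2]
    refine ⟨D.xF - algebraMap k _ a, hδ.isUniformizer_of_apply hq hs hx ?_, ?_⟩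
    · rw [hδx]
      intro h
      have h3 : VanishesAt q (algebraMap k _ (2 * b)) := by
        have := h.neg.sub ((hy.add hy))
        convert this using 1
        rw [map_mul, map_ofNat]
        ring
      exact not_vanishesAt_algebraMap (mul_ne_zero h2 hb) h3
    -- Here (-2y + y + b)/(x - a) = -(y - b)/(x - a), which the equation turns into a fraction with
    -- denominator y + b, a unit because 2b ≠ 0.
    · have key : δ (D.xF - algebraMap k _ a) / (D.xF - algebraMap k _ a) + D.poleFun a b =
          -(((D.xF - algebraMap k _ a) ^ (p - 1) - 1) * (D.yF + algebraMap k _ b)⁻¹) := by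
        rw [hδx, poleFun]
        field_simp
        linear_combination -hxy
      rw [key]
      exact neg_mem (mul_mem (sub_mem (pow_mem hx.mem _) (one_mem _)) hinv)

open Classical in
-- This moves the class from infinity to q: y/x placed at infinity and δ(s)/s placed at q differ by
-- the global function (y + b)/(x - a), up to elements of the lattices.
theorem IsDerivY.exists_dlog [IsAlgClosed k] {q : X.left} (hq : q ∈ D.U) {s : FunField X}
    (hs : IsUniformizer q s) : ∃ g, ∀ r,
      LatticeModel.extendOff (k := k) D.U (D.yF / D.xF) r - g - (if r = q then δ s / s else 0) ∈
        (formsModel hδ.isFormCoordinate).lat r := by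
  obtain ⟨a, b, hab, hx, hy⟩ := D.exists_coordinates hq hs
  refine ⟨D.poleFun a b, fun r => ?_⟩
  by_cases hr : r ∈ D.U
  · rw [LatticeModel.extendOff_of_mem _ _ hr, hδ.isTwist_formsModel.mem_lat_U r hr, zero_sub]
    split_ifs with h
    · subst h
      rw [← neg_add', neg_mem_iff, add_comm]
      exact hδ.dlog_add_poleFun_mem hq hs hab hx hy
    · rw [sub_zero, neg_mem_iff]
      exact D.poleFun_mem_of_mem_U hab hr fun h' =>
        h (D.eq_of_vanishesAt hr hq h'.1 h'.2 hx hy)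
  · rw [LatticeModel.extendOff_of_notMem _ _ hr, if_neg (ne_of_mem_of_not_mem hq hr).symm, sub_zero]
    exact hδ.sub_poleFun_mem_lat a b hr

omit [Fact p.Prime] in
theorem IsDerivY.represents_fundamentalClass : (formsModel hδ.isFormCoordinate).Represents
    (LatticeModel.extendOff (k := k) D.U (D.yF / D.xF)) hδ.fundamentalClass := by
  have := hδ.isTwist_formsModel.represents_tailClass (Finsupp.single (.inr (-1)) 1)
  rwa [Finsupp.linearCombination_single, one_smul, monomials, Sum.elim_inr, zpow_neg_one,
    ← div_eq_mul_inv] at this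

/-- Represent the class by δ(y)/y = 1/y at a zero q of y where y is a uniformizer. Its pullback is
δ(σ*y)/σ*y at the preimage q', the logarithmic derivative of a uniformizer there, which represents
the fundamental class by `exists_dlog` again. -/
theorem IsDerivY.pullH1Forms_fundamentalClass [IsAlgClosed k] (σ : X ⟶ X) [IsIso σ.left] :
    pullH1Forms σ hδ.fundamentalClass = hδ.fundamentalClass := by
  classical
  -- The argument at q' requires q' ∈ U. The points (0, 0) and (1, 0) are distinct and only one
  -- point lies outside U, so one of their preimages is in U.
  have hq : ∃ q' ∈ D.U, ∃ q ∈ D.U, σ.left q' = q ∧ IsUniformizer q D.yF := by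
    obtain ⟨q0, hq0, hx0, hs0⟩ := D.exists_isUniformizer_yF (a := 0)
      (zero_pow (Fact.out : p.Prime).ne_zero)
    obtain ⟨q1, hq1, hx1, hs1⟩ := D.exists_isUniformizer_yF (a := 1) (one_pow _)
    have hsurj : ∀ q, ∃ q', σ.left q' = q := fun q => (σ.left.homeomorph.surjective q)
    obtain ⟨r0, hr0⟩ := hsurj q0
    obtain ⟨r1, hr1⟩ := hsurj q1
    by_cases h0 : r0 ∈ D.U
    · exact ⟨r0, h0, q0, hq0, hr0, hs0⟩
    by_cases h1 : r1 ∈ D.U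
    · exact ⟨r1, h1, q1, hq1, hr1, hs1⟩
    exfalso
    have h2 : q0 = q1 := by rw [← hr0, ← hr1, D.eq_of_notMem_U h0 h1]
    subst h2
    have := hx0.sub hx1
    rw [sub_sub_sub_cancel_left, ← map_sub, sub_zero] at this
    exact not_vanishesAt_algebraMap one_ne_zero this
  obtain ⟨q', hq', q, hq, rfl, hs⟩ := hq
  obtain ⟨g, hg⟩ := hδ.exists_dlog hq hs
  obtain ⟨g', hg'⟩ := hδ.exists_dlog hq' hs.pullFF
  refine ((hδ.represents_pullH1Forms σ hδ.represents_fundamentalClass).eq_iff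
    -- The global function relating the two adeles combines the pullback of the one used at q with
    -- the one used at q'.
    hδ.represents_fundamentalClass).mpr ⟨pullFF σ g * δ (pullFF σ D.yF) - g', fun r => ?_⟩
  have h := sub_mem (hδ.mem_lat_pullFF σ (hg (σ.left r))) (hg' r)
  convert h using 1
  have hinj : σ.left r = σ.left q' ↔ r = q' := σ.left.homeomorph.injective.eq_iff
  rw [hinj, map_sub, map_sub, hδ.1]
  split_ifs
  · rw [map_div₀ (pullFF σ) 1, map_one]
    ring
  · rw [map_zero]
    ring

/-- Automorphisms act trivially on `H¹(X, Ω¹)`. -/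
theorem IsDerivY.pullH1Forms_apply [IsAlgClosed k] (σ : X ⟶ X) [IsIso σ.left] (c : H1Forms X) :
    pullH1Forms σ c = c := by
  obtain ⟨r, rfl⟩ := hδ.exists_eq_smul_fundamentalClass c
  rw [map_smul, hδ.pullH1Forms_fundamentalClass]

end Charts

end ASCurve

end

noncomputable section

/-! ## `Proj` of a graded algebra over a field -/

namespace ProjOver

open KScheme HomogeneousLocalization

variable {k A : Type u} [Field k] [CommRing A] [Algebra k A] (𝒜 : ℕ → Submodule k A)
  [GradedAlgebra 𝒜]

/-- `Proj` of a graded `k`-algebra, as a `k`-scheme. -/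
abbrev proj : Over (Spec (CommRingCat.of k)) :=
  Over.mk (Proj.toSpecZero 𝒜 ≫ Spec.map (CommRingCat.ofHom (algebraMap k (𝒜 0))))

/-- The standard open subset defined by an element of the graded ring. -/
abbrev opens (f : A) : (proj 𝒜).left.Opens := Proj.basicOpen 𝒜 f

variable {𝒜}

/-- Over D₊(f) the structure morphism factors through the ring of degree-zero fractions via k → A₀.
This identifies the scalars of the scheme with those of A. -/
theorem awayToSection_algebraMap {f : A} {d : ℕ} (hf : f ∈ 𝒜 d) (hd : 0 < d) (r : k) :
    (Proj.awayToSection 𝒜 f).hom (fromZeroRingHom 𝒜 _ (algebraMap k (𝒜 0) r)) =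
      algebraMap k Γ((proj 𝒜).left, opens 𝒜 f) r := by
  have h1 : fromBase (proj 𝒜) (opens 𝒜 f) =
      CommRingCat.ofHom ((fromZeroRingHom 𝒜 (Submonoid.powers f)).comp (algebraMap k (𝒜 0))) ≫
        Proj.awayToSection 𝒜 f := by
    have h2 : (opens 𝒜 f).ι ≫ Proj.toSpecZero 𝒜 =
        Proj.basicOpenToSpec 𝒜 f ≫ Spec.map (CommRingCat.ofHom (fromZeroRingHom 𝒜 _)) := by
      rw [← Proj.awayι_toSpecZero 𝒜 f hf hd, ← Proj.basicOpenIsoSpec_hom 𝒜 f hf hd, Proj.awayι]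
      simp
    have h3 : structMap (proj 𝒜) =
        Proj.toSpecZero 𝒜 ≫ Spec.map (CommRingCat.ofHom (algebraMap k (𝒜 0))) := rfl
    have h4 : (structMap (proj 𝒜)).appLE ⊤ (opens 𝒜 f) (le_preimage_top _ _) =
        ((opens 𝒜 f).ι ≫ structMap (proj 𝒜)).appTop ≫ (opens 𝒜 f).topIso.hom := by
      simp [Scheme.Hom.appLE]
      rfl
    have h5 : (opens 𝒜 f).ι ≫ structMap (proj 𝒜) = Proj.basicOpenToSpec 𝒜 f ≫ Spec.map
        (CommRingCat.ofHom ((fromZeroRingHom 𝒜 (Submonoid.powers f)).comp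
          (algebraMap k (𝒜 0)))) := by
      rw [h3, ← Category.assoc, h2, Category.assoc, ← Spec.map_comp, CommRingCat.ofHom_comp]
    have h6 : (Proj.basicOpenToSpec 𝒜 f).appTop = (Scheme.ΓSpecIso _).hom ≫
        Proj.awayToSection 𝒜 f ≫ (Proj.basicOpen 𝒜 f).topIso.inv := Proj.basicOpenToSpec_app_top 𝒜 f
    rw [fromBase, h4, h5, Scheme.Hom.comp_appTop, h6, Category.assoc,
      ← Scheme.ΓSpecIso_inv_naturality_assoc, Category.assoc, Category.assoc,
      Iso.inv_hom_id_assoc, Iso.inv_hom_id, Category.comp_id]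
  exact (ConcreteCategory.congr_hom h1 r).symm

/-- The section `a / f ^ n` over the open subset defined by `f`. -/
def frac {f : A} {d : ℕ} (hf : f ∈ 𝒜 d) (n : ℕ) (a : A) (ha : a ∈ 𝒜 (n • d)) :
    Γ((proj 𝒜).left, opens 𝒜 f) :=
  (Proj.awayToSection 𝒜 f).hom (Away.mk 𝒜 hf n a ha)

theorem exists_frac {f : A} {d : ℕ} (hf : f ∈ 𝒜 d) (hd : 0 < d)
    (s : Γ((proj 𝒜).left, opens 𝒜 f)) : ∃ n a ha, frac hf n a ha = s := by
  have h : Function.Surjective (Proj.awayToSection 𝒜 f).hom :=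
    (ConcreteCategory.bijective_of_isIso (Proj.basicOpenIsoAway 𝒜 f hf hd).hom).2
  obtain ⟨b, rfl⟩ := h s
  obtain ⟨n, a, ha, rfl⟩ := Away.mk_surjective 𝒜 hf b
  exact ⟨n, a, ha, rfl⟩

/-- The homogeneous prime ideal of a point. -/
abbrev ideal (q : (proj 𝒜).left) : Ideal A :=
  (ProjectiveSpectrum.asHomogeneousIdeal (𝒜 := 𝒜) q).toIdeal

instance (q : (proj 𝒜).left) : (ideal q).IsPrime := ProjectiveSpectrum.isPrime (𝒜 := 𝒜) q

/-- The value of a section at a point. -/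
def valueAt {W : (proj 𝒜).left.Opens} {q : (proj 𝒜).left} (hq : q ∈ W) :
    Γ((proj 𝒜).left, W) →+* Localization.AtPrime (ideal q) where
  toFun s := (s.1 ⟨q, hq⟩).val
  map_one' := val_one
  map_zero' := val_zero
  map_add' s t := val_add (s.1 ⟨q, hq⟩) (t.1 ⟨q, hq⟩)
  map_mul' s t := val_mul (s.1 ⟨q, hq⟩) (t.1 ⟨q, hq⟩)

/-- Sections on `Proj` are families of homogeneous fractions, so identities between them may be
checked in the localizations of A, where denominators can be cleared. -/
theorem ext_valueAt {W : (proj 𝒜).left.Opens} {s t : Γ((proj 𝒜).left, W)}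
    (h : ∀ q (hq : q ∈ W), valueAt hq s = valueAt hq t) : s = t :=
  Subtype.ext (funext fun q => val_injective _ (h q.1 q.2))

theorem valueAt_resFun {W W' : (proj 𝒜).left.Opens} (h : W ≤ W') {q : (proj 𝒜).left} (hq : q ∈ W)
    (s : Γ((proj 𝒜).left, W')) : valueAt hq (resFun h s) = valueAt (h hq) s := rfl

theorem valueAt_frac {f : A} {d : ℕ} (hf : f ∈ 𝒜 d) (n : ℕ) (a : A) (ha : a ∈ 𝒜 (n • d))
    {q : (proj 𝒜).left} (hq : q ∈ opens 𝒜 f) :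
    valueAt hq (frac hf n a ha) * algebraMap A (Localization.AtPrime (ideal q)) f ^ n =
      algebraMap A _ a := by
  have h1 : valueAt hq (frac hf n a ha) = Localization.mk a (S := (ideal q).primeCompl) ⟨f ^ n, fun h =>
    hq (Ideal.IsPrime.mem_of_pow_mem (I := ideal q) inferInstance n h)⟩ := rfl
  rw [h1, ← map_pow, Localization.mk_eq_mk']
  exact IsLocalization.mk'_spec _ _ _

theorem isUnit_algebraMap_iff {q : (proj 𝒜).left} (f : A) :
    IsUnit (algebraMap A (Localization.AtPrime (ideal q)) f) ↔
      q ∈ opens 𝒜 f := by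
  exact IsLocalization.AtPrime.isUnit_to_map_iff _ _ _

theorem mem_opens_of_mem_basicOpen {f : A} {d : ℕ} (hf : f ∈ 𝒜 d) (n : ℕ) (a : A)
    (ha : a ∈ 𝒜 (n • d)) {q : (proj 𝒜).left}
    (hq : q ∈ (proj 𝒜).left.basicOpen (frac hf n a ha)) : q ∈ opens 𝒜 a := by
  have hqf : q ∈ opens 𝒜 f := (proj 𝒜).left.basicOpen_le _ hq
  have h1 := (RingedSpace.isUnit_res_basicOpen (proj 𝒜).left.toRingedSpace (frac hf n a ha)).map
    (valueAt (W := (proj 𝒜).left.basicOpen (frac hf n a ha)) hq)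
  have h2 : IsUnit (valueAt hqf (frac hf n a ha)) := h1
  rw [← isUnit_algebraMap_iff, ← valueAt_frac hf n a ha hqf]
  exact h2.mul (((isUnit_algebraMap_iff f).mpr hqf).pow n)

theorem valueAt_algebraMap {f : A} {d : ℕ} (hf : f ∈ 𝒜 d) (hd : 0 < d) {q : (proj 𝒜).left}
    (hq : q ∈ opens 𝒜 f) (r : k) : valueAt hq (algebraMap k _ r) =
      algebraMap A (Localization.AtPrime (ideal q)) (algebraMap k A r) := by
  rw [← awayToSection_algebraMap hf hd]
  exact Localization.mk_one_eq_algebraMap _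

/-- A homomorphism of `k`-algebras that maps `f` to `1` extends to the fractions of degree zero. -/
theorem exists_algHom {f : A} {d : ℕ} (hf : f ∈ 𝒜 d) (hd : 0 < d) {S : Type*} [CommRing S]
    [Algebra k S] (ψ : A →ₐ[k] S) (h : ψ f = 1) :
    ∃ φ : Γ((proj 𝒜).left, opens 𝒜 f) →ₐ[k] S, ∀ n a ha, φ (frac hf n a ha) = ψ a := by
  have hu : IsUnit (ψ.toRingHom f) := by
    change IsUnit (ψ f)
    rw [h]
    exact isUnit_one
  let χ : Away 𝒜 f →+* S := (Localization.awayLift ψ.toRingHom f hu).comp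
    (algebraMap (Away 𝒜 f) (Localization.Away f))
  have hχ : ∀ (a : A) (n : ℕ) (b : Away 𝒜 f), b.val =
      Localization.mk a (⟨f ^ n, ⟨n, rfl⟩⟩ : Submonoid.powers f) →
      χ b = ψ a := by
    intro a n b hb
    change Localization.awayLift ψ.toRingHom f hu b.val = ψ a
    rw [hb, Localization.awayLift_mk (v := 1) (hv := by rw [mul_one]; exact h), one_pow, mul_one]
    rfl
  let I := Proj.basicOpenIsoAway 𝒜 f hf hd
  have hI : ∀ b, I.inv.hom ((Proj.awayToSection 𝒜 f).hom b) = b := fun b =>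
    ConcreteCategory.congr_hom I.hom_inv_id b
  refine ⟨{ toRingHom := χ.comp I.inv.hom, commutes' := fun r => ?_ }, fun n a ha => ?_⟩
  · refine Eq.trans ?_ (ψ.commutes r)
    rw [← awayToSection_algebraMap hf hd]
    change χ (I.inv.hom _) = _
    rw [hI]
    refine hχ _ 0 _ ?_
    change Localization.mk (algebraMap k A r) 1 = _
    congr 1
    exact Subtype.ext (pow_zero f).symm
  · change χ (I.inv.hom _) = _
    rw [frac, hI]
    exact hχ _ n _ rfl

/-! ### Automorphisms of `Proj` defined by graded automorphisms. -/

section Automorphisms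

variable (𝒜) in
/-- A graded automorphism as a homomorphism of graded rings. -/
def gradedHom (e : A ≃ₐ[k] A) (he : ∀ i, ∀ a ∈ 𝒜 i, e a ∈ 𝒜 i) : 𝒜 →+*ᵍ 𝒜 where
  toRingHom := e
  map_mem h := he _ _ h

variable (e : A ≃ₐ[k] A) (he : ∀ i, ∀ a ∈ 𝒜 i, e a ∈ 𝒜 i) (he' : ∀ i, ∀ a ∈ 𝒜 i, e.symm a ∈ 𝒜 i)

include he' in
theorem irrelevant_le_map : HomogeneousIdeal.irrelevant 𝒜 ≤
    (HomogeneousIdeal.irrelevant 𝒜).map (gradedHom 𝒜 e he) := by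
  rw [HomogeneousIdeal.irrelevant_le]
  intro i hi x hx
  have h1 : e.symm x ∈ HomogeneousIdeal.irrelevant 𝒜 := by
    rw [HomogeneousIdeal.mem_irrelevant_iff, GradedRing.proj_apply,
      DirectSum.decompose_of_mem_ne 𝒜 (he' i x hx) hi.ne']
  have h2 := Ideal.mem_map_of_mem (gradedHom 𝒜 e he) h1
  rwa [show gradedHom 𝒜 e he (e.symm x) = x from e.apply_symm_apply x] at h2

/-- The morphism of `Proj` defined by a graded automorphism. -/
abbrev projMap : Proj 𝒜 ⟶ Proj 𝒜 := Proj.map (gradedHom 𝒜 e he) (irrelevant_le_map e he he')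

theorem projMap_comp : projMap e he he' ≫ projMap e.symm he' he = 𝟙 _ := by
  refine (Proj.map_comp _ _ _ _).symm.trans (Eq.trans ?_ Proj.map_id)
  congr 1
  ext x
  exact e.apply_symm_apply x

theorem awayι_comp_projMap_comp_hom {i : ℕ} (hi : 0 < i) (s : A) (hs : s ∈ 𝒜 i) :
    Proj.awayι 𝒜 (gradedHom 𝒜 e he s) ((gradedHom 𝒜 e he).2 hs) hi ≫ projMap e he he' ≫
      (proj 𝒜).hom =
    Proj.awayι 𝒜 (gradedHom 𝒜 e he s) ((gradedHom 𝒜 e he).2 hs) hi ≫ (proj 𝒜).hom := by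
  have h2 := Proj.awayι_comp_map (gradedHom 𝒜 e he) (irrelevant_le_map e he he') hi s hs
  have h3 : (proj 𝒜).hom =
      Proj.toSpecZero 𝒜 ≫ Spec.map (CommRingCat.ofHom (algebraMap k (𝒜 0))) := rfl
  have h4 := Proj.awayι_toSpecZero 𝒜 (gradedHom 𝒜 e he s) ((gradedHom 𝒜 e he).2 hs) hi
  have h5 := Proj.awayι_toSpecZero 𝒜 s hs hi
  rw [h3, reassoc_of% h4, reassoc_of% h2, reassoc_of% h5, ← Spec.map_comp, ← Spec.map_comp,
    ← Spec.map_comp]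
  congr 1
  ext r
  change Localization.mk (S := Submonoid.powers (gradedHom 𝒜 e he s)) (e (algebraMap k A r))
    ⟨e 1, _⟩ = Localization.mk (S := Submonoid.powers (gradedHom 𝒜 e he s)) (algebraMap k A r) 1
  congr 1
  · exact e.commutes r
  · exact Subtype.ext (map_one e)

theorem projMap_comp_hom : projMap e he he' ≫ (proj 𝒜).hom = (proj 𝒜).hom :=
  (Proj.mapAffineOpenCover (gradedHom 𝒜 e he)
    (irrelevant_le_map e he he')).openCover.hom_ext _ _ fun s =>
      awayι_comp_projMap_comp_hom e he he' s.1.2 s.2.1 s.2.2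

/-- The automorphism of `Proj` defined by a graded automorphism. -/
def projAut : Aut (proj 𝒜) :=
  Over.isoMk ⟨projMap e he he', projMap e.symm he' he, projMap_comp e he he',
    projMap_comp e.symm he' he⟩ (projMap_comp_hom e he he')

theorem appLE_frac {f g : A} {d : ℕ} (hf : f ∈ 𝒜 d) (hg : g ∈ 𝒜 d) (h : e f = g) (n : ℕ) (a b : A)
    (ha : a ∈ 𝒜 (n • d)) (hb : b ∈ 𝒜 (n • d)) (hab : e a = b)
    (hle : opens 𝒜 g ≤ (projAut e he he').hom.left ⁻¹ᵁ opens 𝒜 f) :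
    appLE (projAut e he he').hom (opens 𝒜 f) (opens 𝒜 g) hle (frac hf n a ha) =
      frac hg n b hb := by
  subst h hab
  have h1 := ConcreteCategory.congr_hom (Proj.awayToSection_comp_appLE (gradedHom 𝒜 e he)
    (irrelevant_le_map e he he') hf) (Away.mk 𝒜 hf n a ha)
  refine h1.trans ?_
  simp only [CommRingCat.hom_comp, RingHom.comp_apply]
  exact congrArg (Proj.awayToSection 𝒜 (e f)).hom (Away.map_mk (gradedHom 𝒜 e he) f hf n a ha)

theorem le_preimage_opens {f g : A} (h : e f = g) :
    opens 𝒜 g ≤ (projAut e he he').hom.left ⁻¹ᵁ opens 𝒜 f := by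
  subst h
  exact le_rfl

end Automorphisms

end ProjOver

end

noncomputable section

/-! ## The charts of the curve -/

namespace ASCurve

open KScheme ProjOver MvPolynomial

/-- The scaling law of weighted homogeneous polynomials; it translates between homogeneous and
affine coordinates. -/
theorem aeval_of_isWeightedHomogeneous {k ι B : Type*} [CommRing k] [CommRing B] [Algebra k B]
    {w : ι → ℕ} {g v : ι → B} {f : B} (h : ∀ j, g j = v j * f ^ w j) {n : ℕ}
    {φ : MvPolynomial ι k} (hφ : φ.IsWeightedHomogeneous w n) :
    aeval g φ = aeval v φ * f ^ n := by
  induction hφ using IsWeightedHomogeneous.induction_on with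
  | zero => simp
  | add p q _ _ hp hq => rw [map_add, map_add, hp, hq, add_mul]
  | monomial d r hd =>
    rw [aeval_monomial, aeval_monomial, mul_assoc, ← hd, Finsupp.weight_apply, Finsupp.prod,
      Finsupp.prod, Finsupp.sum, ← Finset.prod_pow_eq_pow_sum, ← Finset.prod_mul_distrib]
    congr 1
    refine Finset.prod_congr rfl fun j _ => ?_
    rw [h, mul_pow, ← pow_mul, smul_eq_mul, mul_comm (w j)]

variable (k : Type u) [Field k] (p : ℕ)

/-- The homogeneous coordinates `x`, `z`, `y`, as elements of the homogeneous coordinate ring. -/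
def coord (j : Fin 3) : CoordRing k p := Ideal.Quotient.mk _ (X j)

theorem coord_sq : coord k p 2 ^ 2 = coord k p 0 ^ p * coord k p 1 - coord k p 0 * coord k p 1 ^ p := by
  rw [← sub_eq_zero]
  simp only [coord, ← map_pow, ← map_mul, ← map_sub]
  exact Ideal.Quotient.eq_zero_iff_mem.mpr (Ideal.subset_span rfl)

theorem coord_mem (j : Fin 3) : coord k p j ∈ grading k p (weights p j) :=
  ⟨X j, isWeightedHomogeneous_X k (weights p) j, rfl⟩

theorem coord_mem_zero : coord k p 0 ∈ grading k p 1 := coord_mem k p 0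

theorem coord_mem_one : coord k p 1 ∈ grading k p 1 := coord_mem k p 1

variable {k p} in
/-- Homomorphisms from the homogeneous coordinate ring. -/
def lift {S : Type*} [CommRing S] [Algebra k S] (r : Fin 3 → S)
    (h : r 2 ^ 2 = r 0 ^ p * r 1 - r 0 * r 1 ^ p) : CoordRing k p →ₐ[k] S :=
  Ideal.Quotient.liftₐ _ (aeval r) fun a ha => by
    have : Ideal.span {equation k p} ≤ RingHom.ker (aeval r : MvPolynomial (Fin 3) k →ₐ[k] S) := by
      rw [Ideal.span_le, Set.singleton_subset_iff]
      change aeval r (equation k p) = 0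
      simp only [equation, map_sub, map_mul, map_pow, aeval_X, h, sub_self]
    exact this ha

variable {k p} in
theorem lift_coord {S : Type*} [CommRing S] [Algebra k S] (r : Fin 3 → S)
    (h : r 2 ^ 2 = r 0 ^ p * r 1 - r 0 * r 1 ^ p) (j : Fin 3) : lift r h (coord k p j) = r j :=
  aeval_X r j

variable [Fact p.Prime] [Fact (2 < p)]

section Chart

variable {k p}
variable {i : Fin 3} (hi : coord k p i ∈ grading k p 1)

/-- The affine coordinates on a standard open subset. -/
def affineCoord (j : Fin 3) : Γ((proj (grading k p)).left, opens (grading k p) (coord k p i)) :=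
  frac hi (weights p j) (coord k p j) (by
    rw [smul_eq_mul, mul_one]
    exact coord_mem k p j)

theorem valueAt_affineCoord (j : Fin 3) {q : (proj (grading k p)).left}
    (hq : q ∈ opens (grading k p) (coord k p i)) :
    algebraMap _ (Localization.AtPrime (ideal q)) (coord k p j) =
      valueAt hq (affineCoord hi j) * algebraMap _ _ (coord k p i) ^ weights p j :=
  (valueAt_frac hi _ _ _ hq).symm

/-- The value at a point of a standard open subset, as a homomorphism of `k`-algebras. -/
def valueAtₐ {q : (proj (grading k p)).left} (hq : q ∈ opens (grading k p) (coord k p i)) :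
    Γ((proj (grading k p)).left, opens (grading k p) (coord k p i)) →ₐ[k]
      Localization.AtPrime (ideal q) where
  __ := valueAt hq
  commutes' r := (valueAt_algebraMap hi one_pos hq r).trans
    (IsScalarTower.algebraMap_apply k _ _ r).symm

/-- A fraction whose numerator is the class of a weighted homogeneous φ is φ evaluated at the affine
coordinates. In each localization this is the scaling law. -/
theorem exists_aeval_affineCoord
    (s : Γ((proj (grading k p)).left, opens (grading k p) (coord k p i))) :
    ∃ φ : MvPolynomial (Fin 3) k, aeval (affineCoord hi) φ = s := by
  obtain ⟨n, a, ha, rfl⟩ := exists_frac hi one_pos s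
  have ha' := ha
  rw [smul_eq_mul, mul_one] at ha'
  obtain ⟨φ, hφ, h⟩ := ha'
  have hφa : Ideal.Quotient.mk _ φ = a := h
  refine ⟨φ, ext_valueAt fun q hq => ?_⟩
  have hu : IsUnit (algebraMap _ (Localization.AtPrime (ideal q)) (coord k p i) ^ n) :=
    ((isUnit_algebraMap_iff _).mpr hq).pow n
  rw [← hu.mul_left_inj, valueAt_frac hi n a ha hq]
  have h1 := aeval_of_isWeightedHomogeneous (valueAt_affineCoord hi · hq) hφ
  have h2 : aeval (fun j => algebraMap _ (Localization.AtPrime (ideal q)) (coord k p j)) φ =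
      algebraMap _ _ a := by
    have h3 : aeval (fun j => algebraMap _ (Localization.AtPrime (ideal q)) (coord k p j)) =
        (IsScalarTower.toAlgHom k (CoordRing k p) (Localization.AtPrime (ideal q))).comp
          (Ideal.Quotient.mkₐ k (Ideal.span {equation k p})) :=
      MvPolynomial.algHom_ext fun j => by
        rw [aeval_X]
        rfl
    rw [h3, ← hφa]
    rfl
  have h4 : aeval (fun j => valueAt hq (affineCoord hi j)) φ =
      valueAt hq (aeval (affineCoord hi) φ) := by
    have h3 : aeval (fun j => valueAt hq (affineCoord hi j)) =
        (valueAtₐ hi hq).comp (aeval (affineCoord hi)) :=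
      MvPolynomial.algHom_ext fun j => by
        rw [aeval_X, AlgHom.comp_apply, aeval_X]
        rfl
    rw [h3]
    rfl
  rw [← h4, ← h1, h2]

theorem affineCoord_self (hw : weights p i = 1) : affineCoord hi i = 1 := by
  refine ext_valueAt fun q hq => ?_
  have h := valueAt_affineCoord hi i hq
  rw [hw, pow_one] at h
  rw [map_one, ← ((isUnit_algebraMap_iff _).mpr hq).mul_left_inj, one_mul, ← h]

theorem adjoin_affineCoord : Algebra.adjoin k (Set.range (affineCoord hi)) = ⊤ := by
  rw [Algebra.adjoin_range_eq_range_aeval]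
  exact (AlgHom.range_eq_top _).mpr (exists_aeval_affineCoord hi)

end Chart

end ASCurve

end

/-! ### Equations of the charts and their gluing. -/

noncomputable section

namespace ASCurve

open KScheme ProjOver MvPolynomial

theorem two_mul_weights {p : ℕ} (h : p.Prime) (h2 : 2 < p) : 2 * weights p 2 = p + 1 := by
  have := h.eq_two_or_odd
  change 2 * ((p + 1) / 2) = p + 1
  omega

variable {k : Type u} [Field k] {p : ℕ}

theorem adjoin_coord : Algebra.adjoin k (Set.range (coord k p)) = ⊤ := by
  rw [Algebra.adjoin_range_eq_range_aeval]
  refine (AlgHom.range_eq_top _).mpr fun a => ?_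
  obtain ⟨φ, rfl⟩ := Ideal.Quotient.mk_surjective a
  refine ⟨φ, ?_⟩
  have h : aeval (coord k p) = Ideal.Quotient.mkₐ k (Ideal.span {equation k p}) :=
    MvPolynomial.algHom_ext fun j => aeval_X _ _
  rw [h]
  rfl

variable [hp : Fact p.Prime] [hp2 : Fact (2 < p)]

/-- The homogeneous equation has weighted degree p + 1, twice the weight of y, and is divided by the
(p + 1)-st power of the chosen coordinate. -/
theorem affineCoord_sq {i : Fin 3} (hi : coord k p i ∈ grading k p 1) :
    affineCoord hi 2 ^ 2 =
      affineCoord hi 0 ^ p * affineCoord hi 1 - affineCoord hi 0 * affineCoord hi 1 ^ p := by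
  refine ext_valueAt fun q hq => ?_
  have hu : IsUnit (algebraMap _ (Localization.AtPrime (ideal q)) (coord k p i) ^ (p + 1)) :=
    ((isUnit_algebraMap_iff _).mpr hq).pow _
  have h := congrArg (algebraMap _ (Localization.AtPrime (ideal q))) (coord_sq k p)
  simp only [map_sub, map_mul, map_pow] at h ⊢
  rw [valueAt_affineCoord hi 0 hq, valueAt_affineCoord hi 1 hq, valueAt_affineCoord hi 2 hq] at h
  rw [← hu.mul_left_inj, ← two_mul_weights hp.1 hp2.1]
  have e0 : weights p 0 = 1 := rfl
  have e1 : weights p 1 = 1 := rfl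
  rw [mul_pow, ← pow_mul, mul_comm (weights p 2), e0, e1, two_mul_weights hp.1 hp2.1] at h
  rw [two_mul_weights hp.1 hp2.1, h]
  ring

theorem exists_algHom_affineCoord {i : Fin 3} (hi : coord k p i ∈ grading k p 1) {S : Type u}
    [CommRing S] [Algebra k S] (r : Fin 3 → S) (h : r 2 ^ 2 = r 0 ^ p * r 1 - r 0 * r 1 ^ p)
    (h1 : r i = 1) : ∃ φ : Γ((proj (grading k p)).left, opens (grading k p) (coord k p i)) →ₐ[k] S,
      ∀ j, φ (affineCoord hi j) = r j := by
  obtain ⟨φ, hφ⟩ := exists_algHom hi one_pos (lift r h) ((lift_coord r h i).trans h1)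
  exact ⟨φ, fun j => (hφ _ _ _).trans (lift_coord r h j)⟩

variable (k p) in
-- A homogeneous prime containing x and z contains y², hence y. So the standard open subset of y
-- adds nothing to those of x and z.
theorem sup_opens_eq_top : opens (grading k p) (coord k p 1) ⊔ opens (grading k p) (coord k p 0) =
    ⊤ := by
  rw [eq_top_iff]
  have h0 := Proj.iSup_basicOpen_eq_top' (grading k p) (coord k p)
    (fun j => ⟨_, coord_mem k p j⟩) (by
      rw [eq_top_iff]
      intro a _
      have ha : a ∈ Algebra.adjoin k (Set.range (coord k p)) := adjoin_coord (k := k) ▸ trivial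
      induction ha using Algebra.adjoin_induction with
      | mem x hx => exact Algebra.subset_adjoin hx
      | algebraMap r => exact Subalgebra.algebraMap_mem _ (algebraMap k (grading k p 0) r)
      | add x y _ _ hx hy => exact add_mem (hx trivial) (hy trivial)
      | mul x y _ _ hx hy => exact mul_mem (hx trivial) (hy trivial))
  rw [← h0]
  refine iSup_le fun j q hq => ?_
  by_contra hn
  have hn1 : q ∉ opens (grading k p) (coord k p 1) := fun h => hn (Or.inl h)
  have hn0 : q ∉ opens (grading k p) (coord k p 0) := fun h => hn (Or.inr h)
  have m1 : coord k p 1 ∈ ideal q := not_not.mp hn1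
  have m0 : coord k p 0 ∈ ideal q := not_not.mp hn0
  have m2 : coord k p 2 ∈ ideal q := by
    refine Ideal.IsPrime.mem_of_pow_mem inferInstance 2 ?_
    rw [coord_sq]
    exact sub_mem (Ideal.mul_mem_left _ _ m1) (Ideal.mul_mem_right _ _ m0)
  have : coord k p j ∉ ideal q := hq
  fin_cases j
  exacts [this m0, this m1, this m2]

theorem resFun_affineCoord_mul_eq_one {i j : Fin 3} (hi : coord k p i ∈ grading k p 1)
    (hj : coord k p j ∈ grading k p 1) (wi : weights p i = 1) (wj : weights p j = 1)
    {W : (proj (grading k p)).left.Opens} (hWi : W ≤ opens (grading k p) (coord k p i))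
    (hWj : W ≤ opens (grading k p) (coord k p j)) :
    resFun hWi (affineCoord hi j) * resFun hWj (affineCoord hj i) = 1 := by
  refine ext_valueAt fun q hq => ?_
  have h1 := valueAt_affineCoord hi j (hWi hq)
  have h2 := valueAt_affineCoord hj i (hWj hq)
  rw [wj, pow_one] at h1
  rw [wi, pow_one, h1, ← mul_assoc, mul_comm (valueAt _ _)] at h2
  rw [map_mul, map_one, valueAt_resFun, valueAt_resFun,
    ← ((isUnit_algebraMap_iff _).mpr (hWi hq)).mul_left_inj, one_mul, ← h2]

theorem resFun_affineCoord {i j : Fin 3} (hi : coord k p i ∈ grading k p 1)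
    (hj : coord k p j ∈ grading k p 1) (wj : weights p j = 1) (l : Fin 3)
    {W : (proj (grading k p)).left.Opens} (hWi : W ≤ opens (grading k p) (coord k p i))
    (hWj : W ≤ opens (grading k p) (coord k p j)) :
    resFun hWi (affineCoord hi l) =
      resFun hWj (affineCoord hj l) * resFun hWi (affineCoord hi j) ^ weights p l := by
  refine ext_valueAt fun q hq => ?_
  have h1 := valueAt_affineCoord hi j (hWi hq)
  have h2 := valueAt_affineCoord hj l (hWj hq)
  rw [valueAt_affineCoord hi l (hWi hq), h1, wj, pow_one, mul_pow, ← mul_assoc,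
    (((isUnit_algebraMap_iff _).mpr (hWi hq)).pow _).mul_left_inj] at h2
  rw [map_mul, map_pow, valueAt_resFun, valueAt_resFun, valueAt_resFun, h2]

theorem basicOpen_affineCoord {i j : Fin 3} (hi : coord k p i ∈ grading k p 1)
    (hj : coord k p j ∈ grading k p 1) (wi : weights p i = 1) (wj : weights p j = 1) :
    (proj (grading k p)).left.basicOpen (affineCoord hi j) =
      opens (grading k p) (coord k p i) ⊓ opens (grading k p) (coord k p j) := by
  refine le_antisymm (fun q hq => ⟨(proj (grading k p)).left.basicOpen_le _ hq,
    mem_opens_of_mem_basicOpen hi _ _ _ hq⟩) ?_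
  have h := resFun_affineCoord_mul_eq_one hi hj wi wj (inf_le_left (b := opens _ (coord k p j)))
    (inf_le_right (a := opens _ (coord k p i)))
  have h1 := Scheme.basicOpen_of_isUnit _ (IsUnit.of_mul_eq_one _ h)
  rw [← h1]
  exact (Scheme.basicOpen_res _ _ _).trans_le inf_le_right

variable (k p) in
/-- The two affine charts of the curve. -/
def charts : Charts (proj (grading k p)) p ((p - 1) / 2) where
  p_eq := by have := hp.1.eq_two_or_odd; have := hp2.1; omega
  m_pos := by have := hp2.1; omega
  U := opens (grading k p) (coord k p 1)
  V := opens (grading k p) (coord k p 0)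
  affine_U := Proj.isAffineOpen_basicOpen (grading k p) _ (coord_mem_one k p) one_pos
  affine_V := Proj.isAffineOpen_basicOpen (grading k p) _ (coord_mem_zero k p) one_pos
  sup_eq := sup_opens_eq_top k p
  x := affineCoord (coord_mem_one k p) 0
  y := affineCoord (coord_mem_one k p) 2
  u := affineCoord (coord_mem_zero k p) 1
  v := affineCoord (coord_mem_zero k p) 2
  chart_U :=
    { sq_eq := by
        rw [affineCoord_sq, affineCoord_self (i := 1) _ rfl, one_smul, mul_one, one_pow, mul_one]
      adjoin_eq := by
        rw [eq_top_iff, ← adjoin_affineCoord (coord_mem_one k p), Algebra.adjoin_le_iff]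
        rintro _ ⟨j, rfl⟩
        fin_cases j
        · exact Algebra.subset_adjoin (Or.inl rfl)
        · exact (affineCoord_self (i := 1) (coord_mem_one k p) rfl) ▸ one_mem _
        · exact Algebra.subset_adjoin (Or.inr rfl)
      exists_lift := fun S _ _ r s h => by
        obtain ⟨φ, hφ⟩ := exists_algHom_affineCoord (coord_mem_one k p) ![r, 1, s]
          (by simpa using h) rfl
        exact ⟨φ, hφ 0, hφ 2⟩ }
  chart_V :=
    { sq_eq := by
        rw [affineCoord_sq, affineCoord_self (i := 0) _ rfl, one_pow, one_mul, one_mul, neg_smul,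
          one_smul, neg_sub]
      adjoin_eq := by
        rw [eq_top_iff, ← adjoin_affineCoord (coord_mem_zero k p), Algebra.adjoin_le_iff]
        rintro _ ⟨j, rfl⟩
        fin_cases j
        · exact (affineCoord_self (i := 0) (coord_mem_zero k p) rfl) ▸ one_mem _
        · exact Algebra.subset_adjoin (Or.inl rfl)
        · exact Algebra.subset_adjoin (Or.inr rfl)
      exists_lift := fun S _ _ r s h => by
        obtain ⟨φ, hφ⟩ := exists_algHom_affineCoord (coord_mem_zero k p) ![1, r, s]
          (by simpa using h) rfl
        exact ⟨φ, hφ 1, hφ 2⟩ }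
  basicOpen_x := basicOpen_affineCoord _ (coord_mem_zero k p) rfl rfl
  basicOpen_u := (basicOpen_affineCoord _ (coord_mem_one k p) rfl rfl).trans (inf_comm _ _)
  x_mul_u := resFun_affineCoord_mul_eq_one _ _ rfl rfl _ _
  y_eq := by
    have h := resFun_affineCoord (coord_mem_one k p) (coord_mem_zero k p) rfl 2
      (inf_le_left (b := opens _ (coord k p 0))) (inf_le_right (a := opens _ (coord k p 1)))
    -- The weight (p + 1)/2 of y is m + 1, the exponent in the gluing y = v x^(m+1).
    have e : weights p 2 = (p - 1) / 2 + 1 := by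
      have := two_mul_weights hp.1 hp2.1
      omega
    rw [e] at h
    exact h

end ASCurve

end

noncomputable section

/-! ## Two automorphisms of the curve -/

namespace KScheme

variable {k : Type u} [CommRing k] {X : Over (Spec (CommRingCat.of k))} (σ : Aut X)

instance : IsIso σ.hom.left :=
  have : IsIso σ.hom := Iso.isIso_hom σ
  inferInstanceAs (IsIso ((Over.forget _).map σ.hom))

instance : IsIso σ.inv.left :=
  have : IsIso σ.inv := Iso.isIso_inv σ
  inferInstanceAs (IsIso ((Over.forget _).map σ.inv))

end KScheme

namespace ASCurve

open KScheme ProjOver MvPolynomial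

variable {k : Type u} [Field k] {p : ℕ} [hp : Fact p.Prime] [hp2 : Fact (2 < p)]

theorem lift_mem {r : Fin 3 → CoordRing k p} (h : r 2 ^ 2 = r 0 ^ p * r 1 - r 0 * r 1 ^ p)
    (hr : ∀ j, r j ∈ grading k p (weights p j)) (n : ℕ) (a : CoordRing k p)
    (ha : a ∈ grading k p n) : lift r h a ∈ grading k p n := by
  obtain ⟨φ, hφ, rfl⟩ := ha
  change aeval r φ ∈ grading k p n
  have hφ' : φ.IsWeightedHomogeneous (weights p) n := hφ
  clear hφ
  induction hφ' using IsWeightedHomogeneous.induction_on with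
  | zero => rw [map_zero]; exact zero_mem _
  | add f g _ _ hf hg => rw [map_add]; exact add_mem hf hg
  | monomial d c hd =>
    rw [aeval_monomial, ← Algebra.smul_def]
    refine Submodule.smul_mem _ _ ?_
    rw [← hd, Finsupp.weight_apply, Finsupp.prod, Finsupp.sum]
    exact SetLike.prod_pow_mem_graded (grading k p) _ _ _ fun j _ => hr j

omit hp hp2 in
theorem lift_comp_lift {r r' : Fin 3 → CoordRing k p}
    (h : r 2 ^ 2 = r 0 ^ p * r 1 - r 0 * r 1 ^ p)
    (h' : r' 2 ^ 2 = r' 0 ^ p * r' 1 - r' 0 * r' 1 ^ p) (hc : ∀ j, lift r h (r' j) = coord k p j) :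
    (lift r h).comp (lift r' h') = AlgHom.id k _ :=
  Ideal.Quotient.algHom_ext k (MvPolynomial.algHom_ext fun j =>
    (congrArg (lift r h) (lift_coord r' h' j)).trans (hc j))

theorem frac_eq {i : Fin 3} (hi : coord k p i ∈ grading k p 1) {n : ℕ} {a : CoordRing k p}
    (ha : a ∈ grading k p (n • 1)) {s : Γ((proj (grading k p)).left, opens (grading k p) (coord k p i))}
    (h : ∀ q (hq : q ∈ opens (grading k p) (coord k p i)),
      algebraMap _ (Localization.AtPrime (ideal q)) a =
        valueAt hq s * algebraMap _ _ (coord k p i) ^ n) :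
    frac hi n a ha = s := by
  refine ext_valueAt fun q hq => ?_
  rw [← (((isUnit_algebraMap_iff _).mpr hq).pow n).mul_left_inj, valueAt_frac, h]

/-- The automorphism comes from substituting r_j for the j-th homogeneous coordinate. The last
clause computes pullbacks of affine coordinates, by an identity in the localizations of the
coordinate ring. -/
theorem exists_aut {r r' : Fin 3 → CoordRing k p}
    (h : r 2 ^ 2 = r 0 ^ p * r 1 - r 0 * r 1 ^ p)
    (h' : r' 2 ^ 2 = r' 0 ^ p * r' 1 - r' 0 * r' 1 ^ p)
    (hr : ∀ j, r j ∈ grading k p (weights p j)) (hr' : ∀ j, r' j ∈ grading k p (weights p j))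
    (hc : ∀ j, lift r h (r' j) = coord k p j) (hc' : ∀ j, lift r' h' (r j) = coord k p j) :
    ∃ σ : Aut (proj (grading k p)), ∀ (i i' : Fin 3) (hi : coord k p i ∈ grading k p 1)
      (_ : coord k p i' ∈ grading k p 1), r i = coord k p i' →
        ∃ hle : opens (grading k p) (coord k p i') ≤
          σ.hom.left ⁻¹ᵁ opens (grading k p) (coord k p i),
        ∀ (j : Fin 3) (s : Γ((proj (grading k p)).left, opens (grading k p) (coord k p i'))),
          (∀ q (hq : q ∈ opens (grading k p) (coord k p i')),
            algebraMap _ (Localization.AtPrime (ideal q)) (r j) =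
              valueAt hq s * algebraMap _ _ (coord k p i') ^ weights p j) →
          appLE σ.hom (opens (grading k p) (coord k p i)) (opens (grading k p) (coord k p i')) hle
            (affineCoord hi j) = s := by
  let e : CoordRing k p ≃ₐ[k] CoordRing k p := AlgEquiv.ofAlgHom (lift r h) (lift r' h')
    (lift_comp_lift h h' hc) (lift_comp_lift h' h hc')
  refine ⟨projAut e (lift_mem h hr) (lift_mem h' hr'), fun i i' hi hi' hii => ?_⟩
  have hei : e (coord k p i) = coord k p i' := (lift_coord r h i).trans hii
  refine ⟨le_preimage_opens e _ _ hei, fun j s hs => ?_⟩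
  refine (appLE_frac e _ _ hi hi' hei _ _ (r j) _ ?_ (lift_coord r h j) _).trans (frac_eq hi' _ hs)
  rw [smul_eq_mul, mul_one]
  exact hr j

theorem valueAt_algebraMap_coord {i : Fin 3} (hi : coord k p i ∈ grading k p 1)
    {q : (proj (grading k p)).left} (hq : q ∈ opens (grading k p) (coord k p i)) (r : k) :
    algebraMap k (Localization.AtPrime (ideal q)) r = valueAt hq (algebraMap k _ r) :=
  ((valueAtₐ hi hq).commutes r).symm

/-- The substitution x ↦ x + c z preserves x^p z - x z^p whenever c^p = c, by additivity of
Frobenius. It is used for c = 1 and, as inverse, for c = -1, where p odd enters. -/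
theorem exists_aut_translation [CharP k p] [IsIntegral (proj (grading k p)).left] :
    ∃ σ : Aut (proj (grading k p)), pullFF σ.hom (charts k p).xF = (charts k p).xF + 1 ∧
      pullFF σ.hom (charts k p).yF = (charts k p).yF := by
  have hadd : ∀ c : k, (coord k p 0 + c • coord k p 1) ^ p =
      coord k p 0 ^ p + c ^ p • coord k p 1 ^ p := fun c => by
    have h := congrArg (Ideal.Quotient.mkₐ k (Ideal.span {equation k p}))
      (add_pow_char (R := MvPolynomial (Fin 3) k) (p := p) (X 0) (c • X 1))
    rw [smul_pow, map_pow, map_add, map_add, map_smul, map_smul, map_pow, map_pow] at h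
    exact h
  have hrel : ∀ c : k, c ^ p = c → coord k p 2 ^ 2 = (coord k p 0 + c • coord k p 1) ^ p *
      coord k p 1 - (coord k p 0 + c • coord k p 1) * coord k p 1 ^ p := fun c hc => by
    rw [hadd, hc, coord_sq, add_mul, add_mul, smul_mul_assoc, smul_mul_assoc, ← pow_succ,
      ← pow_succ']
    ring
  have hmem : ∀ (c : k) (j : Fin 3), (![coord k p 0 + c • coord k p 1, coord k p 1, coord k p 2] :
      Fin 3 → CoordRing k p) j ∈ grading k p (weights p j) := fun c j => by
    fin_cases j
    · exact add_mem (coord_mem_zero k p) (Submodule.smul_mem _ _ (coord_mem_one k p))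
    · exact coord_mem_one k p
    · exact coord_mem k p 2
  have h := hrel 1 (one_pow p)
  have h' := hrel (-1) ((Fact.out : p.Prime).odd_of_ne_two (Fact.out : 2 < p).ne').neg_one_pow
  have hcomp : ∀ (a b : k) (hab : a + b = 0) (h) (j : Fin 3),
      lift ![coord k p 0 + a • coord k p 1, coord k p 1, coord k p 2] h
        ((![coord k p 0 + b • coord k p 1, coord k p 1, coord k p 2] : Fin 3 → CoordRing k p) j) =
          coord k p j := fun a b hab h j => by
    fin_cases j
    · refine (map_add _ _ _).trans ?_
      rw [map_smul, lift_coord, lift_coord]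
      change coord k p 0 + a • coord k p 1 + b • coord k p 1 = coord k p 0
      rw [add_assoc, ← add_smul, hab, zero_smul, add_zero]
    · exact lift_coord _ h 1
    · exact lift_coord _ h 2
  obtain ⟨σ, hσ⟩ := exists_aut h h' (hmem 1) (hmem (-1)) (hcomp 1 (-1) (by ring) h)
    (hcomp (-1) 1 (by ring) h')
  obtain ⟨hle, hσ⟩ := hσ 1 1 (coord_mem_one k p) (coord_mem_one k p) rfl
  refine ⟨σ, (pullFF_toFF σ.hom hle (charts k p).mem_U _ _).trans ?_,
    (pullFF_toFF σ.hom hle (charts k p).mem_U _ _).trans ?_⟩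
  · refine (congrArg _ (hσ 0 (affineCoord (coord_mem_one k p) 0 + 1) fun q hq => ?_)).trans ?_
    · change algebraMap _ _ (coord k p 0 + (1 : k) • coord k p 1) = _
      have e0 : weights p 0 = 1 := rfl
      rw [one_smul, map_add, valueAt_affineCoord (coord_mem_one k p) 0 hq, e0, map_add, map_one,
        pow_one, add_mul, one_mul]
    · exact (map_add _ _ _).trans (congrArg _ (map_one _))
  · exact congrArg _ (hσ 2 (affineCoord (coord_mem_one k p) 2) fun q hq =>
      valueAt_affineCoord (coord_mem_one k p) 2 hq)

/-- Exchanging x and z changes the sign of x^p z - x z^p, which multiplying y by i with i² = -1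
compensates. The exchange carries the affine coordinate y of U to i v on V. -/
theorem exists_aut_inversion {i : k} (hi : i ^ 2 = -1) [IsIntegral (proj (grading k p)).left] :
    ∃ σ : Aut (proj (grading k p)), pullFF σ.hom (charts k p).yF =
        i • toFF (charts k p).V (charts k p).mem_V (charts k p).v := by
  have hrel : ∀ c : k, c ^ 2 = -1 → (c • coord k p 2) ^ 2 = coord k p 1 ^ p *
      coord k p 0 - coord k p 1 * coord k p 0 ^ p := fun c hc => by
    rw [smul_pow, hc, coord_sq, neg_smul, one_smul]
    ring
  have hmem : ∀ (c : k) (j : Fin 3), (![coord k p 1, coord k p 0, c • coord k p 2] :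
      Fin 3 → CoordRing k p) j ∈ grading k p (weights p j) := fun c j => by
    fin_cases j
    · exact coord_mem_one k p
    · exact coord_mem_zero k p
    · exact Submodule.smul_mem _ _ (coord_mem k p 2)
  have h := hrel i hi
  have h' := hrel (-i) (by rw [neg_sq, hi])
  have hcomp : ∀ (a b : k) (hab : b * a = 1) (h) (j : Fin 3),
      lift ![coord k p 1, coord k p 0, a • coord k p 2] h
        ((![coord k p 1, coord k p 0, b • coord k p 2] : Fin 3 → CoordRing k p) j) =
          coord k p j := fun a b hab h j => by
    fin_cases j
    · exact lift_coord _ h 1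
    · exact lift_coord _ h 0
    · refine (map_smul _ _ _).trans ?_
      rw [lift_coord]
      change b • a • coord k p 2 = coord k p 2
      rw [smul_smul, hab, one_smul]
  obtain ⟨σ, hσ⟩ := exists_aut h h' (hmem i) (hmem (-i)) (hcomp i (-i) (by linear_combination -hi) h)
    (hcomp (-i) i (by linear_combination -hi) h')
  obtain ⟨hle, hσ⟩ := hσ 1 0 (coord_mem_one k p) (coord_mem_zero k p) rfl
  refine ⟨σ, (pullFF_toFF σ.hom hle (charts k p).mem_V _ _).trans ?_⟩
  refine (congrArg _ (hσ 2 (algebraMap k _ i * affineCoord (coord_mem_zero k p) 2)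
    fun q hq => ?_)).trans ?_
  · have hs : i • coord k p 2 = algebraMap k (CoordRing k p) i * coord k p 2 :=
      Algebra.smul_def i (coord k p 2)
    change algebraMap _ _ (i • coord k p 2) = _
    rw [hs, map_mul, map_mul, valueAt_affineCoord (coord_mem_zero k p) 2 hq,
      ← IsScalarTower.algebraMap_apply k (CoordRing k p),
      valueAt_algebraMap_coord (coord_mem_zero k p) hq, mul_assoc]
  · rw [map_mul, AlgHom.commutes, ← Algebra.smul_def]
    rfl

end ASCurve

end

noncomputable section

/-! ## Irreducibility -/

namespace Polynomial

/-- In P(X + 1) the coefficient of X^d receives only that of P itself and d + 1 times the leading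
one. -/
theorem coeff_taylor_one_sub_self {k : Type*} [Field k] {P : k[X]} {d : ℕ}
    (h : P.natDegree = d + 1) : (taylor 1 P - P).coeff d = (d + 1 : ℕ) * P.leadingCoeff := by
  have h1 : (hasseDeriv d P).natDegree < 2 :=
    (natDegree_hasseDeriv_le P d).trans_lt (by omega)
  rw [coeff_sub, taylor_coeff, eval_eq_sum_range' h1, Finset.sum_range_succ, Finset.sum_range_one,
    hasseDeriv_coeff, hasseDeriv_coeff, leadingCoeff, h]
  simp [add_comm 1 d]

theorem natDegree_taylor_one_sub_self_le {k : Type*} [Field k] {P : k[X]} {d : ℕ}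
    (h : P.natDegree = d + 1) : (taylor 1 P - P).natDegree ≤ d := by
  rw [natDegree_le_iff_coeff_eq_zero]
  intro j hj
  rw [coeff_sub]
  rcases (Nat.succ_le_of_lt hj).eq_or_lt with rfl | hj
  · rw [Nat.succ_eq_add_one, ← h, taylor_coeff, hasseDeriv_natDegree_eq_C, eval_C, leadingCoeff,
      sub_self]
  · rw [coeff_eq_zero_of_natDegree_lt (by rw [natDegree_taylor]; omega),
      coeff_eq_zero_of_natDegree_lt (by omega), sub_self]

/-- In characteristic `p`, a space of polynomials that is stable under `P(X) ↦ P(X + 1)` and contains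
a polynomial of degree `d < p` contains all polynomials of degree at most `d`. -/
theorem degreeLT_le_of_taylor_mem {k : Type*} [Field k] {p : ℕ} [CharP k p] {W : Submodule k k[X]}
    (hW : ∀ P ∈ W, taylor 1 P ∈ W) {d : ℕ} (hd : d < p) {P : k[X]} (hP : P ∈ W) (h0 : P ≠ 0)
    (h : P.natDegree = d) : degreeLT k (d + 1) ≤ W := by
  -- A polynomial of degree at most d is a multiple of P plus one of smaller degree.
  have key : ∀ {d : ℕ} {P : k[X]}, P ∈ W → P ≠ 0 → P.natDegree = d →
      degreeLT k d ≤ W → degreeLT k (d + 1) ≤ W := by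
    intro d P hP h0 h hle Q hQ
    have h1 : Q - (Q.coeff d / P.leadingCoeff) • P ∈ degreeLT k d := by
      rw [mem_degreeLT, degree_lt_iff_coeff_zero]
      intro j hj
      rw [coeff_sub, coeff_smul, smul_eq_mul]
      rcases hj.eq_or_lt with rfl | hj
      · rw [leadingCoeff, h, div_mul_cancel₀ _ (by rwa [← h, coeff_natDegree, leadingCoeff_ne_zero]),
          sub_self]
      · rw [mem_degreeLT, degree_lt_iff_coeff_zero] at hQ
        rw [hQ j hj, coeff_eq_zero_of_natDegree_lt (h.trans_lt hj), mul_zero, sub_zero]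
    have h2 := add_mem (hle h1) (W.smul_mem (Q.coeff d / P.leadingCoeff) hP)
    rwa [sub_add_cancel] at h2
  induction d generalizing P with
  | zero =>
    refine key hP h0 h fun Q hQ => ?_
    rw [mem_degreeLT, degree_lt_iff_coeff_zero] at hQ
    have hQ0 : Q = 0 := Polynomial.ext fun j => hQ j (Nat.zero_le _)
    exact hQ0 ▸ zero_mem W
  | succ d ih =>
    refine key hP h0 h ?_
    -- Since 0 < d + 1 < p, the factor d + 1 is nonzero in k. So P(X + 1) - P has degree exactly d
    -- and the induction goes on.
    have hc : (taylor 1 P - P).coeff d ≠ 0 := by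
      rw [coeff_taylor_one_sub_self h]
      refine mul_ne_zero ?_ (leadingCoeff_ne_zero.mpr h0)
      rw [Ne, CharP.cast_eq_zero_iff k p]
      exact Nat.not_dvd_of_pos_of_lt (Nat.succ_pos d) hd
    refine ih (by omega) (sub_mem (hW P hP) hP) (fun h => hc (by rw [h, coeff_zero])) ?_
    exact le_antisymm (natDegree_taylor_one_sub_self_le h) (le_natDegree_of_ne_zero hc)

end Polynomial

namespace Representation

variable {k G V W : Type*} [Field k] [Group G] [AddCommGroup V] [Module k V] [AddCommGroup W]
  [Module k W] {ρ : Representation k G V} {σ : Representation k G W}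

theorem isIrreducible_of_toSubmodule_eq_top [Nontrivial V]
    (h : ∀ (N : Subrepresentation ρ), ∀ v ∈ N.toSubmodule, v ≠ 0 → N.toSubmodule = ⊤) :
    ρ.IsIrreducible where
  exists_pair_ne := ⟨⊥, ⊤, fun h => bot_ne_top (α := Submodule k V)
    (congrArg Subrepresentation.toSubmodule h)⟩
  eq_bot_or_eq_top N := by
    by_cases hN : N.toSubmodule = ⊥
    · exact Or.inl (Subrepresentation.toSubmodule_injective hN)
    · obtain ⟨v, hv, h0⟩ := Submodule.exists_mem_ne_zero_of_ne_bot hN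
      exact Or.inr (Subrepresentation.toSubmodule_injective (h N v hv h0))

/-- The contragredient of an irreducible representation is irreducible. -/
theorem IsIrreducible.of_equiv_dual [FiniteDimensional k V] (hρ : ρ.IsIrreducible)
    (e : σ.Equiv ρ.dual) : σ.IsIrreducible := by
  have hV : Nontrivial V := by
    by_contra hn
    rw [not_nontrivial_iff_subsingleton] at hn
    exact bot_ne_top (α := Subrepresentation ρ)
      (Subrepresentation.toSubmodule_injective (Subsingleton.elim _ _))
  have : Nontrivial W := e.toLinearEquiv.toEquiv.nontrivial
  refine isIrreducible_of_toSubmodule_eq_top fun N v hv h0 => ?_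
  have he : ∀ g w x, e.toLinearEquiv (σ g w) x = e.toLinearEquiv w (ρ g⁻¹ x) := fun g w x => by
    have h := LinearMap.congr_fun (e.toIntertwiningMap.isIntertwining' g) w
    exact LinearMap.congr_fun h x
  -- The common kernel in V of the functionals coming from N is stable. If it is zero, N is
  -- everything by finite dimension; if it is V, all these functionals vanish, contrary to v ≠ 0.
  let A : Subrepresentation ρ :=
    { toSubmodule := (N.toSubmodule.map e.toLinearEquiv.toLinearMap).dualCoannihilator
      apply_mem_toSubmodule := fun g x hx => by
        rw [Submodule.mem_dualCoannihilator] at hx ⊢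
        rintro _ ⟨w, hw, rfl⟩
        have h1 := he g⁻¹ w x
        rw [inv_inv] at h1
        exact h1.symm.trans (hx _ ⟨_, N.apply_mem_toSubmodule g⁻¹ hw, rfl⟩) }
  rcases hρ.eq_bot_or_eq_top A with hA | hA
  · have h1 : (N.toSubmodule.map e.toLinearEquiv.toLinearMap).dualCoannihilator = ⊥ :=
      congrArg Subrepresentation.toSubmodule hA
    have h2 := congrArg Submodule.dualAnnihilator h1
    rw [Subspace.dualCoannihilator_dualAnnihilator_eq, Submodule.dualAnnihilator_bot] at h2
    exact (Submodule.map_eq_top_iff (e := e.toLinearEquiv)).mp h2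
  · have h1 : (N.toSubmodule.map e.toLinearEquiv.toLinearMap).dualCoannihilator = ⊤ :=
      congrArg Subrepresentation.toSubmodule hA
    refine (h0 (e.toLinearEquiv.map_eq_zero_iff.mp (LinearMap.ext fun x => ?_))).elim
    have hx : x ∈ (N.toSubmodule.map e.toLinearEquiv.toLinearMap).dualCoannihilator := h1 ▸ Submodule.mem_top
    exact (Submodule.mem_dualCoannihilator _).mp hx _ ⟨v, hv, rfl⟩

end Representation

end

/-! ### Irreducibility of the canonical representation, equivariance of duality, and conclusion. -/

noncomputable section

namespace ASCurve

namespace Charts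

open KScheme Polynomial

variable {k : Type u} [Field k] {X : Over (Spec (CommRingCat.of k))} {p m : ℕ} {D : Charts X p m}
variable [AlgebraicGeometry.IsIntegral X.left] [CharP k p]
variable {δ : Derivation k (FunField X) (FunField X)} (hδ : D.IsDerivY δ)
include hδ

/-- The canonical representation is irreducible, as soon as the automorphisms `(x, y) ↦ (x + 1, y)`
and `(x, y) ↦ (1 / x, i y / x ^ (m + 1))` exist. -/
theorem IsDerivY.isIrreducible_H0FormsRep {τ ι : Aut X} {i : k} (hi : i ≠ 0)
    (hτx : pullFF τ.hom D.xF = D.xF + 1) (hτy : pullFF τ.hom D.yF = D.yF)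
    (hιy : pullFF ι.hom D.yF = i • toFF D.V D.mem_V D.v) : (H0FormsRep X).IsIrreducible := by
  have hm := D.m_pos
  have hmp : m < p := by have := D.p_eq; omega
  have : Nontrivial (H0Forms X) :=
    Module.nontrivial_of_finrank_pos (R := k) (hδ.finrank_H0Forms.symm ▸ hm)
  refine Representation.isIrreducible_of_toSubmodule_eq_top fun N ω hω h0 => ?_
  -- W consists of the polynomials P for which P(x) dy lies in N.
  let W : Submodule k k[X] :=
    (N.toSubmodule.map hδ.quotientByDy).comap (aeval D.xF).toLinearMap
  have hW : ∀ P ∈ W, taylor 1 P ∈ W := by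
    rintro P ⟨ω, hω, hP⟩
    -- The group acts by pullback along the inverse, so pullback along τ is the action of τ⁻¹.
    refine ⟨pullH0Forms τ.hom ω, N.apply_mem_toSubmodule τ⁻¹ hω, ?_⟩
    have hP : hδ.quotientByDy ω = aeval D.xF P := hP
    have h1 : aeval D.xF (taylor 1 P) = aeval (D.xF + 1) P := by
      rw [taylor_apply, aeval_comp, map_add, aeval_X, aeval_C, map_one]
    refine Eq.trans ?_ h1.symm
    rw [hδ.quotientByDy_pullH0Forms, hP, hτy, hδ.1, mul_one, ← aeval_algHom_apply, hτx]
  obtain ⟨P, rfl⟩ := hδ.form.surjective ω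
  have hPW : P.1 ∈ W := ⟨_, hω, hδ.quotientByDy_form P⟩
  have hP0 : P.1 ≠ 0 := fun h => h0 (by
    rw [show P = 0 from Subtype.ext h, map_zero])
  have hPm : P.1.natDegree < m := by
    rw [natDegree_lt_iff_degree_lt hP0]
    exact mem_degreeLT.mp P.2
  have h1 : (1 : k[X]) ∈ W := by
    refine degreeLT_le_of_taylor_mem hW (hPm.trans hmp) hPW hP0 rfl ?_
    rw [mem_degreeLT, degree_one]
    exact_mod_cast Nat.succ_pos _
  -- Pullback along ι takes dy to i dv = i x^(m-1) dy, a form of the largest possible degree.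
  have hX : (Polynomial.X ^ (m - 1) : k[X]) ∈ W := by
    obtain ⟨ω, hω, h1⟩ := h1
    have h1 : hδ.quotientByDy ω = aeval D.xF (1 : k[X]) := h1
    refine (W.smul_mem_iff hi).mp ⟨pullH0Forms ι.hom ω, N.apply_mem_toSubmodule ι⁻¹ hω, ?_⟩
    refine Eq.trans ?_ (map_smul (aeval D.xF) i (Polynomial.X ^ (m - 1) : k[X])).symm
    rw [hδ.quotientByDy_pullH0Forms, h1, hιy, map_one, map_one, one_mul, Derivation.map_smul,
      hδ.apply_v, map_pow, aeval_X]
  have hle : degreeLT k m ≤ W := by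
    have h := degreeLT_le_of_taylor_mem hW (Nat.sub_lt_of_lt hmp) hX (pow_ne_zero _ X_ne_zero)
      (natDegree_X_pow _)
    rwa [Nat.sub_add_cancel hm] at h
  rw [eq_top_iff]
  intro η _
  obtain ⟨Q, rfl⟩ := hδ.form.surjective η
  obtain ⟨η', hη', h⟩ := hle Q.2
  rwa [← hδ.quotientByDy_injective (h.trans (hδ.quotientByDy_form Q).symm)]

/-- The Serre duality isomorphism, as an isomorphism of representations. -/
theorem IsDerivY.exists_equiv_dual [Fact p.Prime] [IsAlgClosed k]
    (t : H1Forms X ≃ₗ[k] k) : ∃ e : (H1FunRep X).Equiv (H0FormsRep X).dual,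
      ∀ (c : H1Fun X) (ω : H0Forms X), e c ω = t (cup X ω c) := by
  refine ⟨.mk (.ofBijective _ (hδ.serreMap_bijective t)) fun σ => ?_, fun c ω => rfl⟩
  refine LinearMap.ext fun c => LinearMap.ext fun ω => ?_
  change t (cup X ω (pullH1Fun σ.inv c)) = t (cup X (pullH0Forms σ.hom ω) c)
  refine congrArg t ?_
  -- Pullback along σ fixes H¹(Ω¹), so it may be applied to the cup product; it cancels the pullback
  -- along σ⁻¹ on c and moves to ω.
  rw [← hδ.pullH1Forms_apply σ.hom (cup X ω (pullH1Fun σ.inv c)), hδ.pullH1Forms_cup]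
  have h : pullH1Fun σ.hom ∘ₗ pullH1Fun σ.inv = LinearMap.id :=
    (pullH1Fun_comp σ.hom σ.inv).symm.trans
      ((congrArg pullH1Fun (Iso.hom_inv_id σ)).trans pullH1Fun_id)
  exact congrArg (cup X (pullH0Forms σ.hom ω)) (LinearMap.congr_fun h c)

omit hδ

variable (D) in
/-- The canonical representation of the curve and its contragredient. -/
theorem representations [Fact p.Prime] [IsAlgClosed k]
    (hτ : ∃ τ : Aut X, pullFF τ.hom D.xF = D.xF + 1 ∧ pullFF τ.hom D.yF = D.yF)
    (hι : ∀ i : k, i ^ 2 = -1 → ∃ ι : Aut X, pullFF ι.hom D.yF = i • toFF D.V D.mem_V D.v) :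
    Module.finrank k (H0Forms X) = m ∧ (H0FormsRep X).IsIrreducible ∧
    Module.finrank k (H1Forms X) = 1 ∧
    (∀ (σ : Aut X) (c : H1Forms X), H1FormsRep X σ c = c) ∧
    (∀ t : H1Forms X ≃ₗ[k] k, ∃ e : (H1FunRep X).Equiv (H0FormsRep X).dual,
      ∀ (c : H1Fun X) (ω : H0Forms X), e c ω = t (cup X ω c)) ∧
    (H1FunRep X).IsIrreducible := by
  obtain ⟨δ, hδ⟩ := D.exists_isDerivY
  obtain ⟨i, hi⟩ := IsAlgClosed.exists_pow_nat_eq (-1 : k) two_pos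
  obtain ⟨τ, hτx, hτy⟩ := hτ
  obtain ⟨ι, hιy⟩ := hι i hi
  have hi0 : i ≠ 0 := by
    rintro rfl
    simp at hi
  have hirr := hδ.isIrreducible_H0FormsRep hi0 hτx hτy hιy
  have h1 := hδ.finrank_H1Forms
  have : FiniteDimensional k (H0Forms X) := .of_basis hδ.formBasis
  have : FiniteDimensional k (H1Forms X) := Module.finite_of_finrank_eq_succ h1
  -- Some trace isomorphism exists because H¹(Ω¹) is one-dimensional. Any one gives the duality
  -- needed for irreducibility of H¹(𝒪).
  obtain ⟨e, _⟩ := hδ.exists_equiv_dual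
    (.ofFinrankEq _ _ (h1.trans (Module.finrank_self k).symm))
  exact ⟨hδ.finrank_H0Forms, hirr, h1, fun σ c => hδ.pullH1Forms_apply σ.inv c,
    hδ.exists_equiv_dual, hirr.of_equiv_dual e⟩

end Charts

open KScheme in
theorem representations_of_eq_proj {k : Type u} [Field k] {p : ℕ} [Fact p.Prime] [Fact (2 < p)]
    [CharP k p] [IsAlgClosed k] {X : Over (Spec (CommRingCat.of k))}
    (hX : X = ProjOver.proj (grading k p)) :
    Module.finrank k (H0Forms X) = (p - 1) / 2 ∧ (H0FormsRep X).IsIrreducible ∧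
    Module.finrank k (H1Forms X) = 1 ∧
    (∀ (σ : Aut X) (c : H1Forms X), H1FormsRep X σ c = c) ∧
    (∀ t : H1Forms X ≃ₗ[k] k, ∃ e : (H1FunRep X).Equiv (H0FormsRep X).dual,
      ∀ (c : H1Fun X) (ω : H0Forms X), e c ω = t (cup X ω c)) ∧
    (H1FunRep X).IsIrreducible := by
  subst hX
  have := (charts k p).isIntegral
  exact (charts k p).representations exists_aut_translation fun _ hi => exists_aut_inversion hi

end ASCurve

end

open KScheme in
theorem mainTheorem1 (k : Type u) [Field k] [IsAlgClosed k] (p : ℕ) [Fact p.Prime] [Fact (2 < p)]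
    [CharP k p] :
    -- the canonical representation has dimension `g = (p - 1) / 2` and is irreducible
    Module.finrank k (H0Forms (ASCurve.curve k p)) = (p - 1) / 2 ∧
    (H0FormsRep (ASCurve.curve k p)).IsIrreducible ∧
    -- `H¹(X, Ω¹)` is one-dimensional, with trivial action of `Aut_k(X)`
    Module.finrank k (H1Forms (ASCurve.curve k p)) = 1 ∧
    (∀ (σ : Aut (ASCurve.curve k p)) (c : H1Forms (ASCurve.curve k p)),
      H1FormsRep (ASCurve.curve k p) σ c = c) ∧
    -- for each trace isomorphism `t : H¹(X, Ω¹) ≃ k`, the Serre duality pairing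
    -- `(ω, c) ↦ t (ω ∪ c)` identifies `H¹(X, 𝒪_X)` with the contragredient of `H⁰(X, Ω¹)`
    (∀ t : H1Forms (ASCurve.curve k p) ≃ₗ[k] k,
      ∃ e : (H1FunRep (ASCurve.curve k p)).Equiv (H0FormsRep (ASCurve.curve k p)).dual,
        ∀ (c : H1Fun (ASCurve.curve k p)) (ω : H0Forms (ASCurve.curve k p)),
          e c ω = t (cup (ASCurve.curve k p) ω c)) ∧
    -- `H¹(X, 𝒪_X)` is irreducible
    (H1FunRep (ASCurve.curve k p)).IsIrreducible := by
  exact ASCurve.representations_of_eq_proj rfl
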